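/- **Setting.** Let $\mathcal C$ be a rigid $C^*$-tensor category, i.e. a $C^*$-tensor category with irreducible unit $\varepsilon$, closed under direct sums and subobjects, in which every object has a conjugate. Write $(\beta,\alpha)$ for the space of morphisms $\alpha\to\beta$, $\alpha\beta$ for the tensor product, $\mathrm{Irr}(\mathcal C)$ for a set of representatives of the irreducible objects, and $\mathrm{mult}(\gamma,\alpha)=\dim(\gamma,\alpha)$. For $\alpha\in\mathrm{Irr}(\mathcal C)$ fix a conjugate $\bar\alpha$ and a standard solution $s_\alpha\in(\alpha\bar\alpha,\varepsilon)$, $t_\alpha\in(\bar\alpha\alpha,\varepsilon)$ of the conjugate equations, and put $\mathrm{Tr}_\alpha(T)=s_\alpha^*(T\otimes1)s_\alpha$ and $d(\alpha)=\mathrm{Tr}_\alpha(1)$. For $\gamma$ irreducible, $(\alpha,\gamma)$ and $(\gamma,\alpha)$ carry the inner products $\langle T,U\rangle=\mathrm{Tr}_\gamma(U^*T)$ and $\langle T,U\rangle=\mathrm{Tr}_\gamma(TU^*)$, and $\mathrm{onb}(\alpha,\gamma)$ is an orthonormal basis of $(\alpha,\gamma)$. **Tube algebra and property (T).** Let $\mathcal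 A=\bigoplus_{i,j,\alpha\in\mathrm{Irr}(\mathcal C)}(i\alpha,\alpha j)$. For any object $X$, a morphism $V\in(iX,Xj)$ is viewed as the element $\sum_{\gamma\in\mathrm{Irr}(\mathcal C)} d(\gamma)\sum_{W\in\mathrm{onb}(X,\gamma)}(1\otimes W^*)V(W\otimes1)$ of $\mathcal A$. The $*$-algebra structure of $\mathcal A$ is given by $V\cdot W=\delta_{j,j'}(V\otimes1)(1\otimes W)\in(i\alpha\beta,\alpha\beta k)$ and $V^\#=(t_\alpha^*\otimes1\otimes1)(1\otimes V^*\otimes1)(1\otimes1\otimes s_\alpha)\in(j\bar\alpha,\bar\alpha i)$ for $V\in(i\alpha,\alpha j)$ and $W\in(j'\beta,\beta k)$. Let $p_i\in\mathcal A$ be given by the identity of $i$ in $(i\varepsilon,\varepsilon i)$, and $1_\alpha\in\mathcal A$ by the identity of $\alpha$ in $(\varepsilon\alpha,\alpha\varepsilon)$. A nondegenerate right Hilbert $\mathcal A$-module is a right $*$-representation of $\mathcal A$ by bounded operators on a Hilbert space $\mathcal H$ such that the subspaces $\mathcal H\cdot p_i$ span a dense subspace. A vector $\xi\in\mathcal H$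 is invariant if $\xi\cdot1_\alpha=d(\alpha)\xi$ for all $\alpha\in\mathrm{Irr}(\mathcal C)$; for a finite set $F\subset\mathrm{Irr}(\mathcal C)$ and $\delta>0$ it is $(F,\delta)$-invariant if $\|\xi\cdot1_\alpha-d(\alpha)\xi\|<d(\alpha)\,\delta\,\|\xi\|$ for all $\alpha\in F$. The pair $(F,\delta)$ is a Kazhdan pair if every nondegenerate right Hilbert $\mathcal A$-module that contains an $(F,\delta)$-invariant vector contains a nonzero invariant vector. $\mathcal C$ has property (T) if it has a Kazhdan pair. **Laplacian.** Let $S\subset\mathrm{Irr}(\mathcal C)\setminus\{\varepsilon\}$ be finite, symmetric ($\alpha\in S\Rightarrow\bar\alpha\in S$, up to isomorphism) and generating (every irreducible object appears in some tensor product of elements of $S$). Put $$\nu(\alpha)=\frac1{d(\alpha)}\sum_{\beta,\gamma\in S}\mathrm{mult}(\gamma,\bar\beta\alpha)\qquad(\alpha\in S)$$ and assume that $\nu(\alpha)>0$ for all $\alpha\in S$. Let $\mathcal V=\bigoplus_{\alpha\in S,\,i\in\mathrm{Irr}(\mathcal C)}(i\alpha,\alpha)$, a finite-dimensional space, with the inner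 product $\langle\xi,\eta\rangle_\nu=\sum_{\alpha,i}\nu(\alpha)\mathrm{Tr}_\alpha(\eta_{i,\alpha}^*\xi_{i,\alpha})$, and let $\mathcal E=\bigoplus_{\alpha,\beta,\gamma\in S,\,i\in\mathrm{Irr}(\mathcal C)}(\bar\beta i\alpha,\gamma)\otimes(\gamma,\bar\beta\alpha)$ with the orthogonal sum of the tensor product inner products. Define $\partial_\ell,\partial_r:\mathcal V\to\mathcal E$ by $$(\partial_\ell\xi)_{\alpha,\beta,\gamma,i}=\sum_{W\in\mathrm{onb}(\bar\beta\alpha,\gamma)}(1\otimes\xi_{i,\alpha})W\otimes W^*,\qquad(\partial_r\xi)_{\alpha,\beta,\gamma,i}=\sum_{W\in\mathrm{onb}(\bar\beta\alpha,\gamma)}(\tilde\xi_{i,\beta}\otimes1)W\otimes W^*,$$ where $\tilde V=(1\otimes1\otimes s_\alpha^*)(1\otimes V\otimes1)(t_\alpha\otimes1)\in(\bar\alpha i,\bar\alpha)$ for $V\in(i\alpha,\alpha)$. The Laplacian of $S$ is $\Delta=\frac12(\partial_\ell-\partial_r)^*(\partial_\ell-\partial_r)$, the adjoint being taken with respect to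 $\langle\cdot,\cdot\rangle_\nu$ and the inner product of $\mathcal E$. **Theorem.** Suppose that $0$ is a simple eigenvalue of $\Delta$ and that the smallest nonzero eigenvalue $\lambda_1$ of $\Delta$ satisfies $\lambda_1>1/2$. Then $\mathcal C$ has property (T). More precisely: - if $\lambda_1\le1$, then $(S,2-\lambda_1^{-1})$ is a Kazhdan pair for $\mathcal C$; - in all cases, every nondegenerate right Hilbert $\mathcal A$-module $\mathcal H$ for which $\mathcal H\cdot p_\varepsilon$ contains an $(S,2-\lambda_1^{-1})$-invariant vector contains a nonzero invariant vector. -/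

import Mathlib

open CategoryTheory MonoidalCategory
open scoped TensorProduct DirectSum BigOperators

universe w v u

noncomputable section

namespace RigidCStar

/-! ## Rigid C*-tensor categories -/

/-- A C*-category: the morphism spaces are complex Banach spaces, composition is bilinear and
submultiplicative, and there is an antilinear contravariant involution `dag` (written `T ↦ T*` on
paper, identical on objects) that satisfies the C*-identity and for which every `T* T` is a positive
element of the C*-algebra of endomorphisms of the source of `T`.
Composition is diagrammatic, so that `T* T` is `T ≫ dag T`. -/
class CStarCategory (C : Type u) [Category.{v} C] where
  homNormed : ∀ X Y : C, NormedAddCommGroup (X ⟶ Y)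
  homSpace : ∀ X Y : C, NormedSpace ℂ (X ⟶ Y)
  homComplete : ∀ X Y : C, CompleteSpace (X ⟶ Y)
  add_comp : ∀ {X Y Z : C} (f g : X ⟶ Y) (h : Y ⟶ Z), (f + g) ≫ h = f ≫ h + g ≫ h
  comp_add : ∀ {X Y Z : C} (f : X ⟶ Y) (g h : Y ⟶ Z), f ≫ (g + h) = f ≫ g + f ≫ h
  smul_comp : ∀ {X Y Z : C} (r : ℂ) (f : X ⟶ Y) (g : Y ⟶ Z), (r • f) ≫ g = r • (f ≫ g)
  comp_smul : ∀ {X Y Z : C} (f : X ⟶ Y) (r : ℂ) (g : Y ⟶ Z), f ≫ (r • g) = r • (f ≫ g)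
  dag : ∀ {X Y : C}, (X ⟶ Y) → (Y ⟶ X)
  dag_dag : ∀ {X Y : C} (f : X ⟶ Y), dag (dag f) = f
  dag_comp : ∀ {X Y Z : C} (f : X ⟶ Y) (g : Y ⟶ Z), dag (f ≫ g) = dag g ≫ dag f
  dag_add : ∀ {X Y : C} (f g : X ⟶ Y), dag (f + g) = dag f + dag g
  dag_smul : ∀ {X Y : C} (r : ℂ) (f : X ⟶ Y), dag (r • f) = (starRingEnd ℂ r) • dag f
  norm_comp_le : ∀ {X Y Z : C} (f : X ⟶ Y) (g : Y ⟶ Z), ‖f ≫ g‖ ≤ ‖f‖ * ‖g‖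
  norm_comp_dag : ∀ {X Y : C} (f : X ⟶ Y), ‖f ≫ dag f‖ = ‖f‖ * ‖f‖
  comp_dag_pos : ∀ {X Y : C} (f : X ⟶ Y), ∃ g : X ⟶ X, f ≫ dag f = g ≫ dag g

open CStarCategory (dag)

attribute [reducible, instance] CStarCategory.homNormed
attribute [reducible, instance] CStarCategory.homSpace
attribute [instance] CStarCategory.homComplete

instance (C : Type u) [Category.{v} C] [CStarCategory C] : Preadditive C where
  homGroup _ _ := inferInstance
  add_comp _ _ _ f g h := CStarCategory.add_comp f g h
  comp_add _ _ _ f g h := CStarCategory.comp_add f g h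

instance (C : Type u) [Category.{v} C] [CStarCategory C] : Linear ℂ C where
  homModule _ _ := inferInstance
  smul_comp _ _ _ r f g := CStarCategory.smul_comp r f g
  comp_smul _ _ _ f r g := CStarCategory.comp_smul f r g

theorem dag_id {C : Type u} [Category.{v} C] [CStarCategory C] (X : C) : dag (𝟙 X) = 𝟙 X := by
  have h := CStarCategory.dag_comp (dag (𝟙 X)) (𝟙 X)
  rw [Category.comp_id, CStarCategory.dag_dag, Category.comp_id] at h
  exact h.symm

theorem dag_zero {C : Type u} [Category.{v} C] [CStarCategory C] (X Y : C) :
    dag (0 : X ⟶ Y) = 0 := by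
  have h := CStarCategory.dag_add (0 : X ⟶ Y) 0
  rw [add_zero] at h
  exact left_eq_add.mp h

/-- An object is irreducible if its endomorphisms are exactly the scalars (and it is nonzero). -/
def IsIrreducible {C : Type u} [Category.{v} C] [CStarCategory C] (X : C) : Prop :=
  𝟙 X ≠ 0 ∧ ∀ f : X ⟶ X, ∃ c : ℂ, f = c • 𝟙 X

/-- A C*-tensor category: a C*-category with a bilinear, `*`-preserving tensor product whose
associators and unitors are unitary, with irreducible unit, closed under (orthogonal) direct sums
and under subobjects (projections split). No strictness is assumed. -/
class CStarTensorCategory (C : Type u) [Category.{v} C] [CStarCategory C] [MonoidalCategory C] :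
    Prop extends MonoidalPreadditive C, MonoidalLinear ℂ C where
  dag_whiskerLeft : ∀ (X : C) {Y Z : C} (f : Y ⟶ Z), dag (X ◁ f) = X ◁ dag f
  dag_whiskerRight : ∀ {Y Z : C} (f : Y ⟶ Z) (X : C), dag (f ▷ X) = dag f ▷ X
  dag_associator : ∀ X Y Z : C, dag (α_ X Y Z).hom = (α_ X Y Z).inv
  dag_leftUnitor : ∀ X : C, dag (λ_ X).hom = (λ_ X).inv
  dag_rightUnitor : ∀ X : C, dag (ρ_ X).hom = (ρ_ X).inv
  unit_irreducible : IsIrreducible (𝟙_ C)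
  exists_directSum : ∀ X Y : C, ∃ (Z : C) (a : X ⟶ Z) (b : Y ⟶ Z),
    a ≫ dag a = 𝟙 X ∧ b ≫ dag b = 𝟙 Y ∧ dag a ≫ a + dag b ≫ b = 𝟙 Z
  exists_subobject : ∀ (X : C) (p : X ⟶ X), p ≫ p = p → dag p = p →
    ∃ (Y : C) (a : Y ⟶ X), a ≫ dag a = 𝟙 Y ∧ dag a ≫ a = p

/-- `(Xb, s, t)` solves the conjugate equations for `X`:
`(t* ⊗ 1)(1 ⊗ s) = 1` on `Xb` and `(s* ⊗ 1)(1 ⊗ t) = 1` on `X`. -/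
def ConjugateEquations {C : Type u} [Category.{v} C] [CStarCategory C] [MonoidalCategory C]
    (X Xb : C) (s : 𝟙_ C ⟶ X ⊗ Xb) (t : 𝟙_ C ⟶ Xb ⊗ X) : Prop :=
  (𝟙 Xb ⊗≫ Xb ◁ s ⊗≫ dag t ▷ Xb ⊗≫ 𝟙 Xb = 𝟙 Xb) ∧
  (𝟙 X ⊗≫ X ◁ t ⊗≫ dag s ▷ X ⊗≫ 𝟙 X = 𝟙 X)

/-- Rigidity: every object has a conjugate. -/
class IsRigid (C : Type u) [Category.{v} C] [CStarCategory C] [MonoidalCategory C] : Prop where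
  exists_conjugate : ∀ X : C, ∃ (Xb : C) (s : 𝟙_ C ⟶ X ⊗ Xb) (t : 𝟙_ C ⟶ Xb ⊗ X),
    ConjugateEquations X Xb s t

/-- A conjugate object together with a standard solution of the conjugate equations. -/
structure StandardSolution {C : Type u} [Category.{v} C] [CStarCategory C] [MonoidalCategory C]
    (X : C) where
  conj : C
  s : 𝟙_ C ⟶ X ⊗ conj
  t : 𝟙_ C ⟶ conj ⊗ X
  conjugateEquations : ConjugateEquations X conj s t
  standard : ∀ T : X ⟶ X, s ≫ (T ▷ conj) ≫ dag s = t ≫ (conj ◁ T) ≫ dag t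

section Existence

variable {C : Type u} [Category.{v} C] [CStarCategory C] [MonoidalCategory C]
  [CStarTensorCategory C]

theorem exists_scalar (f : 𝟙_ C ⟶ 𝟙_ C) : ∃ c : ℂ, f = c • 𝟙 (𝟙_ C) :=
  CStarTensorCategory.unit_irreducible.2 f

/-- `f* f` is a strictly positive scalar when `f` is a nonzero morphism out of the unit. -/
theorem exists_pos_scalar {X : C} (f : 𝟙_ C ⟶ X) (hf : f ≠ 0) :
    ∃ r : ℝ, 0 < r ∧ f ≫ dag f = (r : ℂ) • 𝟙 (𝟙_ C) := by
  obtain ⟨g, hg⟩ := CStarCategory.comp_dag_pos f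
  obtain ⟨z, rfl⟩ := exists_scalar g
  have h : f ≫ dag f = ((Complex.normSq z : ℝ) : ℂ) • 𝟙 (𝟙_ C) := by
    rw [hg, CStarCategory.dag_smul, dag_id, CStarCategory.smul_comp, Category.id_comp, smul_smul,
      Complex.mul_conj]
  refine ⟨Complex.normSq z, ?_, h⟩
  rw [Complex.normSq_pos]
  rintro rfl
  have h0 : ‖f‖ * ‖f‖ = 0 := by rw [← CStarCategory.norm_comp_dag, h]; simp
  exact hf (norm_eq_zero.mp (mul_self_eq_zero.mp h0))

/-- Rescaling a solution of the conjugate equations for an irreducible object makes it standard. -/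
theorem exists_standardSolution [IsRigid C] {X : C} (hX : IsIrreducible X) :
    Nonempty (StandardSolution X) := by
  obtain ⟨Xb, s, t, h1, h2⟩ := IsRigid.exists_conjugate X
  have hs : s ≠ 0 := by
    rintro rfl
    apply hX.1
    rw [← h2, dag_zero]
    simp [monoidalComp]
  have ht : t ≠ 0 := by
    rintro rfl
    apply hX.1
    rw [← h2]
    simp [monoidalComp]
  obtain ⟨a, ha, hsa⟩ := exists_pos_scalar s hs
  obtain ⟨b, hb, htb⟩ := exists_pos_scalar t ht
  set r : ℝ := Real.sqrt (Real.sqrt (b / a)) with hr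
  have hr0 : 0 < r := Real.sqrt_pos.mpr (Real.sqrt_pos.mpr (div_pos hb ha))
  have hr4 : r * r * (r * r) = b / a := by
    rw [hr, Real.mul_self_sqrt (Real.sqrt_nonneg _), Real.mul_self_sqrt (div_pos hb ha).le]
  have hc : (r : ℂ) * ((r⁻¹ : ℝ) : ℂ) = 1 := by exact_mod_cast mul_inv_cancel₀ hr0.ne'
  have hc' : ((r⁻¹ : ℝ) : ℂ) * (r : ℂ) = 1 := by rw [mul_comm, hc]
  have key : r * r * a = r⁻¹ * r⁻¹ * b := by
    field_simp
    field_simp at hr4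
    linarith
  refine ⟨⟨Xb, (r : ℂ) • s, ((r⁻¹ : ℝ) : ℂ) • t, ⟨?_, ?_⟩, ?_⟩⟩
  · refine Eq.trans ?_ h1
    simp only [monoidalComp, CStarCategory.dag_smul, Complex.conj_ofReal, smul_smul, hc',
      MonoidalLinear.smul_whiskerRight, MonoidalLinear.whiskerLeft_smul, Linear.smul_comp,
      Linear.comp_smul, one_smul]
  · refine Eq.trans ?_ h2
    simp only [monoidalComp, CStarCategory.dag_smul, Complex.conj_ofReal, smul_smul, hc,
      MonoidalLinear.smul_whiskerRight, MonoidalLinear.whiskerLeft_smul, Linear.smul_comp,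
      Linear.comp_smul, one_smul]
  · intro T
    obtain ⟨c, rfl⟩ := hX.2 T
    simp only [CStarCategory.dag_smul, Complex.conj_ofReal, MonoidalLinear.smul_whiskerRight,
      MonoidalLinear.whiskerLeft_smul, id_whiskerRight, whiskerLeft_id, Linear.smul_comp,
      Linear.comp_smul, Category.id_comp, hsa, htb, smul_smul]
    congr 1
    have : (r : ℂ) * r * a = (r⁻¹ : ℝ) * (r⁻¹ : ℝ) * b := by exact_mod_cast key
    linear_combination c * this

end Existence

/-! ## Irreducible objects, dimensions, traces -/

/-- The irreducible objects up to isomorphism. -/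
instance irrSetoid (C : Type u) [Category.{v} C] [CStarCategory C] :
    Setoid {X : C // IsIrreducible X} where
  r X Y := Nonempty (X.1 ≅ Y.1)
  iseqv := ⟨fun X => ⟨Iso.refl X.1⟩, fun ⟨e⟩ => ⟨e.symm⟩, fun ⟨e⟩ ⟨f⟩ => ⟨e.trans f⟩⟩

/-- `Irr(C)`, the set of isomorphism classes of irreducible objects. -/
def Irr (C : Type u) [Category.{v} C] [CStarCategory C] : Type u := Quotient (irrSetoid C)

/-- The fixed representative of a class of irreducible objects. -/
def rep {C : Type u} [Category.{v} C] [CStarCategory C] (a : Irr C) : C := (Quotient.out a).1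

theorem rep_irreducible {C : Type u} [Category.{v} C] [CStarCategory C] (a : Irr C) :
    IsIrreducible (rep a) := (Quotient.out a).2

section

variable {C : Type u} [Category.{v} C] [CStarCategory C] [MonoidalCategory C]

variable (C) in
/-- The class of the unit object. -/
def unitIrr [CStarTensorCategory C] : Irr C :=
  Quotient.mk (irrSetoid C) ⟨𝟙_ C, CStarTensorCategory.unit_irreducible⟩

variable (C) in
/-- An isomorphism between the representative of the unit class and the unit object. -/
def unitRepIso [CStarTensorCategory C] : rep (unitIrr C) ≅ 𝟙_ C :=
  Classical.choice (Quotient.mk_out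
    (⟨𝟙_ C, CStarTensorCategory.unit_irreducible⟩ : {X : C // IsIrreducible X}))

/-- `mult(c, X)`, the multiplicity of the irreducible `c` in `X`. -/
def mult (c : Irr C) (X : C) : ℕ := Module.finrank ℂ (rep c ⟶ X)

variable [CStarTensorCategory C]

/-- The identification of the endomorphisms of the unit object with `ℂ`. -/
def unitScalar : (𝟙_ C ⟶ 𝟙_ C) →ₗ[ℂ] ℂ :=
  (LinearEquiv.ofBijective (LinearMap.toSpanSingleton ℂ (𝟙_ C ⟶ 𝟙_ C) (𝟙 (𝟙_ C)))
    ⟨(injective_iff_map_eq_zero _).mpr fun _ hc => (smul_eq_zero.mp hc).resolve_right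
        CStarTensorCategory.unit_irreducible.1,
      fun f => (exists_scalar f).imp fun _ hc => hc.symm⟩).symm.toLinearMap

theorem unitScalar_smul_id (c : ℂ) : unitScalar (c • 𝟙 (𝟙_ C)) = c :=
  LinearEquiv.symm_apply_apply _ c

variable [IsRigid C]

/-- The fixed standard solution for (the representative of) an irreducible. -/
def std (a : Irr C) : StandardSolution (rep a) :=
  Classical.choice (exists_standardSolution (rep_irreducible a))

/-- The conjugate object of an irreducible. -/
abbrev conj (a : Irr C) : C := (std a).conj

/-- The categorical trace `Tr_a(T) = s_a* (T ⊗ 1) s_a` on the endomorphisms of an irreducible. -/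
def Tr (a : Irr C) : (rep a ⟶ rep a) →ₗ[ℂ] ℂ where
  toFun T := unitScalar ((std a).s ≫ (T ▷ conj a) ≫ dag (std a).s)
  map_add' T U := by simp
  map_smul' c T := by simp

/-- The categorical dimension `d(a) = s_a* s_a = Tr_a(1)`. -/
def dim (a : Irr C) : ℝ := (unitScalar ((std a).s ≫ dag (std a).s)).re

/-- The inner product `⟨S, T⟩ = Tr_c(S* T)` on the morphisms `c → X`, with `c` irreducible;
conjugate-linear in the first variable. -/
def homForm (c : Irr C) (X : C) : (rep c ⟶ X) →ₗ⋆[ℂ] (rep c ⟶ X) →ₗ[ℂ] ℂ :=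
  LinearMap.mk₂'ₛₗ (starRingEnd ℂ) (RingHom.id ℂ) (fun S T => Tr c (T ≫ dag S))
    (fun S S' T => by simp [CStarCategory.dag_add])
    (fun z S T => by simp [CStarCategory.dag_smul])
    (fun S T T' => by simp)
    (fun z S T => by simp)

/-- The inner product `⟨S, T⟩ = Tr_c(T S*)` on the morphisms `X → c`, with `c` irreducible;
conjugate-linear in the first variable. -/
def coHomForm (c : Irr C) (X : C) : (X ⟶ rep c) →ₗ⋆[ℂ] (X ⟶ rep c) →ₗ[ℂ] ℂ :=
  LinearMap.mk₂'ₛₗ (starRingEnd ℂ) (RingHom.id ℂ) (fun S T => Tr c (dag S ≫ T))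
    (fun S S' T => by simp [CStarCategory.dag_add])
    (fun z S T => by simp [CStarCategory.dag_smul])
    (fun S T T' => by simp)
    (fun z S T => by simp)

/-- `b` is an orthonormal basis of the space of morphisms `c → X`, with `c` irreducible. -/
def IsONB (c : Irr C) (X : C) {n : ℕ} (b : Fin n → (rep c ⟶ X)) : Prop :=
  (∀ k l, homForm c X (b k) (b l) = if k = l then 1 else 0) ∧
    Submodule.span ℂ (Set.range b) = ⊤

open Classical in
/-- The chosen orthonormal basis of the space of morphisms `c → X` (one exists, as these spaces are
finite-dimensional Hilbert spaces in a rigid C*-tensor category). -/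
def onb (c : Irr C) (X : C) : Σ n : ℕ, Fin n → (rep c ⟶ X) :=
  if h : ∃ p : Σ n : ℕ, Fin n → (rep c ⟶ X), IsONB c X p.2 then h.choose else ⟨0, Fin.elim0⟩

/-! ## The tube algebra -/

/-- The summand `(iα, αj)` of the tube algebra, that is the morphisms `αj → iα`;
the index is `(i, j, α)`. -/
abbrev TubeHom (p : Irr C × Irr C × Irr C) : Type v :=
  rep p.2.2 ⊗ rep p.2.1 ⟶ rep p.1 ⊗ rep p.2.2

variable (C) in
/-- The underlying vector space of the tube algebra. -/
abbrev Tube : Type (max u v) := ⨁ p : Irr C × Irr C × Irr C, TubeHom p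

open Classical in
/-- The element of the tube algebra given by a morphism `V : X j → i X` for an arbitrary object `X`,
namely `∑_c d(c) ∑_{W ∈ onb(X, c)} (1 ⊗ W*) V (W ⊗ 1)`; only the finitely many irreducible
components `c` of `X` contribute. -/
def toTube (i j : Irr C) (X : C) (V : X ⊗ rep j ⟶ rep i ⊗ X) : Tube C :=
  ∑ᶠ c : Irr C, DirectSum.lof ℂ (Irr C × Irr C × Irr C) TubeHom (i, j, c)
    ((dim c : ℂ) • ∑ k, ((onb c X).2 k ▷ rep j) ≫ V ≫ (rep i ◁ dag ((onb c X).2 k)))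

open Classical in
/-- The product of homogeneous elements: `V · W = δ (V ⊗ 1)(1 ⊗ W) ∈ (iαβ, αβk)` for
`V ∈ (iα, αj)` and `W ∈ (j'β, βk)`, where `δ` is `1` if `j = j'` and `0` otherwise. -/
def tubeMulHom (p q : Irr C × Irr C × Irr C) (V : TubeHom p) (W : TubeHom q) : Tube C :=
  if h : q.1 = p.2.1 then
    toTube p.1 q.2.1 (rep p.2.2 ⊗ rep q.2.2)
      (𝟙 _ ⊗≫ rep p.2.2 ◁ W ⊗≫ rep p.2.2 ◁ (eqToHom (congrArg rep h) ▷ rep q.2.2) ⊗≫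
        V ▷ rep q.2.2 ⊗≫ 𝟙 _)
  else 0

/-- The involution on homogeneous elements:
`V^# = (t_α* ⊗ 1 ⊗ 1)(1 ⊗ V* ⊗ 1)(1 ⊗ 1 ⊗ s_α) ∈ (j ᾱ, ᾱ i)` for `V ∈ (iα, αj)`. -/
def tubeStarHom (p : Irr C × Irr C × Irr C) (V : TubeHom p) : Tube C :=
  toTube p.2.1 p.1 (conj p.2.2)
    (𝟙 _ ⊗≫ (conj p.2.2 ⊗ rep p.1) ◁ (std p.2.2).s ⊗≫ conj p.2.2 ◁ dag V ▷ conj p.2.2 ⊗≫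
      dag (std p.2.2).t ▷ (rep p.2.1 ⊗ conj p.2.2) ⊗≫ 𝟙 _)

open Classical in
/-- The product of the tube algebra. -/
def tubeMul (x y : Tube C) : Tube C :=
  DFinsupp.sum x fun p V => DFinsupp.sum y fun q W => tubeMulHom p q V W

open Classical in
/-- The involution `#` of the tube algebra. -/
def tubeStar (x : Tube C) : Tube C :=
  DFinsupp.sum x fun p V => tubeStarHom p V

/-- The projection `p_i`: the identity of `i`, in `(i ε, ε i)`. -/
def tubeProj (i : Irr C) : Tube C :=
  toTube i i (𝟙_ C) ((λ_ (rep i)).hom ≫ (ρ_ (rep i)).inv)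

open Classical in
/-- The element `1_α ∈ (ε α, α ε)` of the tube algebra given by the identity of `α`. -/
def tubeOne (a : Irr C) : Tube C :=
  DirectSum.lof ℂ (Irr C × Irr C × Irr C) TubeHom (unitIrr C, unitIrr C, a)
    ((rep a ◁ (unitRepIso C).hom) ≫ (ρ_ (rep a)).hom ≫ (λ_ (rep a)).inv ≫
      ((unitRepIso C).inv ▷ rep a))

/-! ## Hilbert modules and property (T) -/

variable (C) in
/-- A nondegenerate right Hilbert module over the tube algebra: a right `*`-representation on the
Hilbert space `H`, `act x ξ` being `ξ · x`, such that the subspaces `H · p_i` span a dense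
subspace. -/
structure HilbertModule (H : Type w) [NormedAddCommGroup H] [InnerProductSpace ℂ H] where
  act : Tube C →ₗ[ℂ] (H →L[ℂ] H)
  act_mul : ∀ (x y : Tube C) (ξ : H), act (tubeMul x y) ξ = act y (act x ξ)
  act_star : ∀ (x : Tube C) (ξ η : H), inner ℂ (act x ξ) η = inner ℂ ξ (act (tubeStar x) η)
  nondegenerate : (⨆ i : Irr C, (act (tubeProj i)).range).topologicalClosure = ⊤

section Modules

variable {H : Type w} [NormedAddCommGroup H] [InnerProductSpace ℂ H]

/-- `ξ` is invariant: `ξ · 1_α = d(α) ξ` for all `α ∈ Irr(C)`. -/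
def IsInvariant (M : HilbertModule C H) (ξ : H) : Prop :=
  ∀ a : Irr C, M.act (tubeOne a) ξ = (dim a : ℂ) • ξ

/-- `ξ` is `(F, ε)`-invariant: `‖ξ · 1_α - d(α) ξ‖ < d(α) ε ‖ξ‖` for all `α ∈ F`. -/
def IsAlmostInvariant (M : HilbertModule C H) (F : Finset (Irr C)) (ε : ℝ) (ξ : H) : Prop :=
  ∀ a ∈ F, ‖M.act (tubeOne a) ξ - (dim a : ℂ) • ξ‖ < dim a * ε * ‖ξ‖

end Modules

/-- `(F, ε)` is a Kazhdan pair: `ε > 0`, and every nondegenerate right Hilbert module over the tube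
algebra that contains an `(F, ε)`-invariant vector contains a nonzero invariant vector. -/
def IsKazhdanPair (F : Finset (Irr C)) (ε : ℝ) : Prop :=
  0 < ε ∧ ∀ (H : Type w) [NormedAddCommGroup H] [InnerProductSpace ℂ H] [CompleteSpace H]
    (M : HilbertModule C H), (∃ ξ : H, IsAlmostInvariant M F ε ξ) →
      ∃ η : H, η ≠ 0 ∧ IsInvariant M η

/-- The same, but testing only `(F, ε)`-invariant vectors in the corner `H · p_ε` of the unit object,
where all invariant vectors live. For `ε ≤ 1` and nonempty `F` this is equivalent to being a Kazhdan
pair. -/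
def IsCornerKazhdanPair (F : Finset (Irr C)) (ε : ℝ) : Prop :=
  0 < ε ∧ ∀ (H : Type w) [NormedAddCommGroup H] [InnerProductSpace ℂ H] [CompleteSpace H]
    (M : HilbertModule C H),
    (∃ ξ : H, M.act (tubeProj (unitIrr C)) ξ = ξ ∧ IsAlmostInvariant M F ε ξ) →
      ∃ η : H, η ≠ 0 ∧ IsInvariant M η

variable (C) in
/-- Property (T): there is a Kazhdan pair. -/
def HasPropertyT : Prop :=
  ∃ (F : Finset (Irr C)) (ε : ℝ), IsKazhdanPair.{w} F ε

/-! ## Generating sets, the link and its Laplacian -/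

/-- `S` is symmetric: the conjugate of each member of `S` is (isomorphic to) a member of `S`. -/
def IsSymmetricSet (S : Finset (Irr C)) : Prop :=
  ∀ a ∈ S, ∃ b ∈ S, Nonempty (rep b ≅ conj a)

/-- The tensor product of a list of irreducibles. -/
def tensorList : List (Irr C) → C
  | [] => 𝟙_ C
  | a :: l => rep a ⊗ tensorList l

/-- `S` generates: every irreducible appears in some tensor product of elements of `S`. -/
def Generates (S : Finset (Irr C)) : Prop :=
  ∀ c : Irr C, ∃ l : List (Irr C), (∀ a ∈ l, a ∈ S) ∧ ∃ f : rep c ⟶ tensorList l, f ≠ 0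

/-- The weight `ν(α) = d(α)⁻¹ ∑_{β, γ ∈ S} mult(γ, β̄ α)`. -/
def weight (S : Finset (Irr C)) (a : Irr C) : ℝ :=
  ∑ b : S, ∑ c : S, (mult c.1 (conj b.1 ⊗ rep a) : ℝ) / dim a

/-- The vertex space `⨁_{α ∈ S, i ∈ Irr(C)} (iα, α)`. For each `α` only the finitely many irreducible
components `i` of `α ᾱ` give a nonzero summand, so that the direct sum is the product. -/
abbrev VertexSpace (S : Finset (Irr C)) : Type (max u v) :=
  ∀ p : S × Irr C, rep p.1.1 ⟶ rep p.2 ⊗ rep p.1.1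

/-- The summand `(β̄ i α, γ) ⊗ (γ, β̄ α)` of the edge space. -/
abbrev EdgeSummand (a b c i : Irr C) : Type v :=
  (rep c ⟶ conj b ⊗ (rep i ⊗ rep a)) ⊗[ℂ] (conj b ⊗ rep a ⟶ rep c)

/-- The edge space `⨁_{α, β, γ ∈ S, i ∈ Irr(C)} (β̄ i α, γ) ⊗ (γ, β̄ α)`; again only finitely many
summands are nonzero. The index is `(α, β, γ, i)`. -/
abbrev EdgeSpace (S : Finset (Irr C)) : Type (max u v) :=
  ∀ p : S × S × S × Irr C, EdgeSummand p.1.1 p.2.1.1 p.2.2.1.1 p.2.2.2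

/-- The inner product `⟨ξ, η⟩_ν = ∑ ν(α) Tr_α(ξ_{i,α}* η_{i,α})` of the vertex space,
conjugate-linear in the first variable. -/
def vertexInner (S : Finset (Irr C)) (ξ η : VertexSpace S) : ℂ :=
  ∑ a : S, ∑ᶠ i : Irr C, (weight S a.1 : ℂ) * homForm a.1 (rep i ⊗ rep a.1) (ξ (a, i)) (η (a, i))

/-- The inner product on a summand of the edge space,
`⟨T ⊗ X, T' ⊗ X'⟩ = Tr_γ(T* T') Tr_γ(X' X*)`. -/
def edgeSummandForm (a b c i : Irr C) :
    EdgeSummand a b c i →ₗ⋆[ℂ] EdgeSummand a b c i →ₗ[ℂ] ℂ :=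
  (TensorProduct.lift (TensorProduct.mapBilinear (RingHom.id ℂ) (rep c ⟶ conj b ⊗ (rep i ⊗ rep a))
      (conj b ⊗ rep a ⟶ rep c) ℂ ℂ)).compr₂ (LinearMap.mul' ℂ ℂ) ∘ₛₗ
    TensorProduct.map (homForm c (conj b ⊗ (rep i ⊗ rep a))) (coHomForm c (conj b ⊗ rep a))

theorem edgeSummandForm_tmul (a b c i : Irr C) (T T' : rep c ⟶ conj b ⊗ (rep i ⊗ rep a))
    (X X' : conj b ⊗ rep a ⟶ rep c) :
    edgeSummandForm a b c i (T ⊗ₜ X) (T' ⊗ₜ X') = Tr c (T' ≫ dag T) * Tr c (dag X ≫ X') := rfl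

/-- The inner product of the edge space. -/
def edgeInner (S : Finset (Irr C)) (x y : EdgeSpace S) : ℂ :=
  ∑ a : S, ∑ b : S, ∑ c : S, ∑ᶠ i : Irr C,
    edgeSummandForm a.1 b.1 c.1 i (x (a, b, c, i)) (y (a, b, c, i))

/-- The Frobenius transform `Ṽ = (1 ⊗ 1 ⊗ s_α*)(1 ⊗ V ⊗ 1)(t_α ⊗ 1) ∈ (ᾱ i, ᾱ)` of
`V ∈ (iα, α)`. -/
def tilde (i a : Irr C) : (rep a ⟶ rep i ⊗ rep a) →ₗ[ℂ] (conj a ⟶ conj a ⊗ rep i) where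
  toFun V := 𝟙 _ ⊗≫ (std a).t ▷ conj a ⊗≫ conj a ◁ V ▷ conj a ⊗≫
    (conj a ⊗ rep i) ◁ dag (std a).s ⊗≫ 𝟙 _
  map_add' V W := by simp [monoidalComp]
  map_smul' z V := by simp [monoidalComp]

/-- The source map `∂_ℓ(ξ)_{α,β,γ,i} = ∑_{W ∈ onb(β̄α, γ)} (1 ⊗ ξ_{i,α}) W ⊗ W*`. -/
def sourceMap (S : Finset (Irr C)) : VertexSpace S →ₗ[ℂ] EdgeSpace S where
  toFun ξ p := ∑ k, ((onb p.2.2.1.1 (conj p.2.1.1 ⊗ rep p.1.1)).2 k ≫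
      conj p.2.1.1 ◁ ξ (p.1, p.2.2.2)) ⊗ₜ[ℂ] dag ((onb p.2.2.1.1 (conj p.2.1.1 ⊗ rep p.1.1)).2 k)
  map_add' ξ η := by
    funext p
    simp [TensorProduct.add_tmul, Finset.sum_add_distrib]
  map_smul' z ξ := by
    funext p
    simp [TensorProduct.smul_tmul', Finset.smul_sum]

/-- The target map `∂_r(ξ)_{α,β,γ,i} = ∑_{W ∈ onb(β̄α, γ)} (ξ̃_{i,β} ⊗ 1) W ⊗ W*`. -/
def targetMap (S : Finset (Irr C)) : VertexSpace S →ₗ[ℂ] EdgeSpace S where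
  toFun ξ p := ∑ k, ((onb p.2.2.1.1 (conj p.2.1.1 ⊗ rep p.1.1)).2 k ≫
      tilde p.2.2.2 p.2.1.1 (ξ (p.2.1, p.2.2.2)) ▷ rep p.1.1 ≫
      (α_ (conj p.2.1.1) (rep p.2.2.2) (rep p.1.1)).hom) ⊗ₜ[ℂ]
      dag ((onb p.2.2.1.1 (conj p.2.1.1 ⊗ rep p.1.1)).2 k)
  map_add' ξ η := by
    funext p
    simp [TensorProduct.add_tmul, Finset.sum_add_distrib]
  map_smul' z ξ := by
    funext p
    simp [TensorProduct.smul_tmul', Finset.smul_sum]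

/-- `Δ` is the Laplacian `½ (∂_ℓ - ∂_r)* (∂_ℓ - ∂_r)` of `S`, the adjoint being taken with respect to
the inner products of the vertex space and of the edge space. When the weight is positive on `S`,
there is exactly one such operator. -/
def IsLaplacian (S : Finset (Irr C)) (Δ : Module.End ℂ (VertexSpace S)) : Prop :=
  ∃ D : EdgeSpace S →ₗ[ℂ] VertexSpace S,
    (∀ (e : EdgeSpace S) (ξ : VertexSpace S),
      vertexInner S (D e) ξ = edgeInner S e ((sourceMap S - targetMap S) ξ)) ∧
    Δ = (1 / 2 : ℂ) • (D ∘ₗ (sourceMap S - targetMap S))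

end

end RigidCStar

end

open RigidCStar

/-!
The action of the tube algebra on the corner of the unit object contains the self-adjoint operator
`A = N⁻¹ ∑_{α ∈ S} ν(α) 1_α`, `N = ∑_{α ∈ S} ν(α) d(α)` (`averaging`, `totalWeight`). By
`norm_tubeOne_le` each `1_α` has norm at most `d(α)`, so `A` is a contraction, a vector fixed by `A`
is fixed by every term of the average (`tubeOne_eq_of_averaging_eq`), and since the dimension is
multiplicative and `S` generates, such a vector is invariant (`isInvariant_of_generates`). An almost
invariant vector `ξ` satisfies `‖ξ - A ξ‖ < δ ‖ξ‖` (`norm_sub_averaging_lt`). Hence all that is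
needed is a spectral gap for `A`: if `λ (‖ξ‖² - ‖A ξ‖²) ≤ ‖ξ‖² - ⟨ξ, A ξ⟩` for all `ξ` in the corner
(`IsLaplacian.averaging_gap`), then `B = 1 - A` satisfies `B² ≥ (2 - λ⁻¹) B` there, so `B` is
bounded below by `2 - λ⁻¹` on the orthogonal complement of its kernel
(`mul_norm_le_of_orthogonal_ker`), and `ξ` cannot lie in that complement when `δ = 2 - λ⁻¹`
(`exists_invariant_of_gap`).

The gap of `A` comes from that of the Laplacian, as in the theorem for groups. The form of the
Laplacian is `⟨x, x⟩_ν - Re (crossForm x x)` (`edgeInner_eq`): symmetry of `S` makes both diagonal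
terms equal to the weighted inner product, and the cross term is expressed through the Frobenius
partner `link W V'` of a morphism `V' : b → i b` along `W : c → b̄ a`. Simplicity of the eigenvalue
`0` gives the inequality `IsLaplacian.gap` for all `x`, in which the constant vector `constVec`
spans the kernel. This inequality is applied to the vectors `testVec`: a vector `ξ` of the corner
has the components `toUnitOp M i a V ξ ∈ H · p_i`, which are paired with a vector `e` and scaled by
`√d(i)`. Summing over an orthonormal basis of vectors `e` turns the three terms of the inequality
into `N ‖ξ‖²`, `N ‖A ξ‖²` and `N ⟨ξ, A ξ⟩`.

The sums are evaluated in the tube algebra. Morphisms `X j → i X` for arbitrary `X` multiply by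
composition (`tubeMul_toTube`) and satisfy the trace relation `toTube_cyclic`; thus the operator
`cornerOp` of an endomorphism of `X` depends on it only up to cyclic permutation. The product of the
operators of `V` and `W` along the string `i` is the operator of `contract`, and by Frobenius
reciprocity together with completeness, the sum of `d(i) contract(V, V)` over all `i` and over
orthonormal bases of morphisms `V : b → i b` is `t_b t_b*` (`sum_contract_self`). The same sum with
`link W` in one of the two factors is, up to the trace relation, `d(c)⁻¹` times the identity of `c̄`
(`cornerOp_sum_contract_link`).

The underlying calculus rests on the fact that the standard solution for a product of irreducible
objects is standard (`StandardSolution.prod`) and on the trace property `StandardSolution.tr_comp`,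
which follows from two applications of the Cauchy-Schwarz inequality.
-/

noncomputable section

namespace RigidCStar

open RigidCStar.CStarCategory (dag)

set_option linter.unusedSectionVars false

attribute [simp] dag_id dag_zero CStarCategory.dag_dag CStarCategory.dag_comp
  CStarTensorCategory.dag_whiskerLeft CStarTensorCategory.dag_whiskerRight
  CStarTensorCategory.dag_associator CStarTensorCategory.dag_leftUnitor
  CStarTensorCategory.dag_rightUnitor

/-! ### Schur's lemma in a C*-category -/

section Category

variable {C : Type u} [Category.{v} C] [CStarCategory C]

/-- The adjoint as a conjugate-linear map. -/
def dagₗ (X Y : C) : (X ⟶ Y) →ₗ⋆[ℂ] (Y ⟶ X) where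
  toFun := dag
  map_add' := CStarCategory.dag_add
  map_smul' := CStarCategory.dag_smul

theorem dag_sum {X Y : C} {ι : Type*} (s : Finset ι) (f : ι → (X ⟶ Y)) :
    dag (∑ i ∈ s, f i) = ∑ i ∈ s, dag (f i) := map_sum (dagₗ X Y) f s

theorem dag_injective {X Y : C} {f g : X ⟶ Y} (h : dag f = dag g) : f = g := by
  rw [← CStarCategory.dag_dag f, h, CStarCategory.dag_dag]

theorem dag_sub {X Y : C} (f g : X ⟶ Y) : dag (f - g) = dag f - dag g := map_sub (dagₗ X Y) f g

theorem comp_dag_self_eq_zero {X Y : C} {f : X ⟶ Y} (h : f ≫ dag f = 0) : f = 0 := by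
  have h0 := CStarCategory.norm_comp_dag f
  rw [h, norm_zero] at h0
  exact norm_eq_zero.mp (mul_self_eq_zero.mp h0.symm)

@[simp]
theorem dag_associator_inv [MonoidalCategory C] [CStarTensorCategory C] (X Y Z : C) :
    dag (α_ X Y Z).inv = (α_ X Y Z).hom := by
  rw [← CStarTensorCategory.dag_associator, CStarCategory.dag_dag]

@[simp]
theorem dag_leftUnitor_inv [MonoidalCategory C] [CStarTensorCategory C] (X : C) :
    dag (λ_ X).inv = (λ_ X).hom := by
  rw [← CStarTensorCategory.dag_leftUnitor, CStarCategory.dag_dag]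

@[simp]
theorem dag_rightUnitor_inv [MonoidalCategory C] [CStarTensorCategory C] (X : C) :
    dag (ρ_ X).inv = (ρ_ X).hom := by
  rw [← CStarTensorCategory.dag_rightUnitor, CStarCategory.dag_dag]

theorem smul_id_injective {X : C} (hX : IsIrreducible X) {a b : ℂ} (h : a • 𝟙 X = b • 𝟙 X) :
    a = b := by
  have h0 : (a - b) • 𝟙 X = 0 := by rw [sub_smul, h, sub_self]
  exact sub_eq_zero.mp ((smul_eq_zero.mp h0).resolve_right hX.1)

/-- `f* f` is a nonnegative scalar when `f` is a morphism out of an irreducible object, and it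
vanishes only for `f = 0`. -/
theorem exists_nonneg_scalar {X Y : C} (hX : IsIrreducible X) (f : X ⟶ Y) :
    ∃ r : ℝ, 0 ≤ r ∧ f ≫ dag f = (r : ℂ) • 𝟙 X ∧ (r = 0 → f = 0) := by
  obtain ⟨g, hg⟩ := CStarCategory.comp_dag_pos f
  obtain ⟨z, rfl⟩ := hX.2 g
  have h : f ≫ dag f = ((Complex.normSq z : ℝ) : ℂ) • 𝟙 X := by
    rw [hg, CStarCategory.dag_smul, dag_id, CStarCategory.smul_comp, Category.id_comp, smul_smul,
      Complex.mul_conj]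
  refine ⟨Complex.normSq z, Complex.normSq_nonneg z, h, fun hz => comp_dag_self_eq_zero ?_⟩
  rw [h, hz, Complex.ofReal_zero, zero_smul]

theorem exists_pos_of_ne_zero {X Y : C} (hX : IsIrreducible X) (f : X ⟶ Y) (hf : f ≠ 0) :
    ∃ r : ℝ, 0 < r ∧ f ≫ dag f = (r : ℂ) • 𝟙 X := by
  obtain ⟨r, h0, h1, h2⟩ := exists_nonneg_scalar hX f
  exact ⟨r, lt_of_le_of_ne h0 fun h => hf (h2 h.symm), h1⟩

/-- A nonzero morphism out of an irreducible object is a positive multiple of an isometry. -/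
theorem exists_isometry_of_ne_zero {X Y : C} (hX : IsIrreducible X) (f : X ⟶ Y) (hf : f ≠ 0) :
    ∃ (r : ℝ) (w : X ⟶ Y), 0 < r ∧ w ≫ dag w = 𝟙 X ∧ f = (r : ℂ) • w := by
  obtain ⟨r, h0, h1⟩ := exists_pos_of_ne_zero hX f hf
  have hs : 0 < Real.sqrt r := Real.sqrt_pos.mpr h0
  have hs' : (Real.sqrt r : ℂ) ≠ 0 := by exact_mod_cast hs.ne'
  have hr : (Real.sqrt r : ℂ) * Real.sqrt r = r := by
    exact_mod_cast Real.mul_self_sqrt h0.le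
  refine ⟨Real.sqrt r, (Real.sqrt r : ℂ)⁻¹ • f, hs, ?_, ?_⟩
  · rw [CStarCategory.dag_smul, CStarCategory.smul_comp, CStarCategory.comp_smul, smul_smul, h1,
      smul_smul, ← hr, map_inv₀, Complex.conj_ofReal]
    field_simp
    rw [one_smul]
  · rw [smul_smul, mul_inv_cancel₀ hs', one_smul]

/-- Schur's lemma: a nonzero morphism of irreducible objects is a positive multiple of a unitary. -/
theorem exists_unitary_of_ne_zero {X Y : C} (hX : IsIrreducible X) (hY : IsIrreducible Y)
    (f : X ⟶ Y) (hf : f ≠ 0) :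
    ∃ (r : ℝ) (w : X ⟶ Y), 0 < r ∧ w ≫ dag w = 𝟙 X ∧ dag w ≫ w = 𝟙 Y ∧ f = (r : ℂ) • w := by
  obtain ⟨r, w, h0, h1, h2⟩ := exists_isometry_of_ne_zero hX f hf
  refine ⟨r, w, h0, h1, ?_, h2⟩
  obtain ⟨z, hz⟩ := hY.2 (dag w ≫ w)
  have h3 : z • w = (1 : ℂ) • w := by
    calc z • w = w ≫ (dag w ≫ w) := by rw [hz, CStarCategory.comp_smul, Category.comp_id]
      _ = (1 : ℂ) • w := by rw [← Category.assoc, h1, Category.id_comp, one_smul]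
  have hw : w ≠ 0 := by
    rintro rfl
    exact hf (by rw [h2, smul_zero])
  rw [hz, smul_left_injective ℂ hw h3, one_smul]

/-- Schur's lemma: there are no nonzero morphisms between different irreducible objects. -/
theorem eq_of_hom_ne_zero {a b : Irr C} (f : rep a ⟶ rep b) (hf : f ≠ 0) : a = b := by
  obtain ⟨r, w, -, h1, h2, -⟩ :=
    exists_unitary_of_ne_zero (rep_irreducible a) (rep_irreducible b) f hf
  rw [← Quotient.out_eq a, ← Quotient.out_eq b]
  exact Quotient.sound ⟨⟨w, dag w, h1, h2⟩⟩

/-- The class of an irreducible object. -/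
def irrOf {X : C} (hX : IsIrreducible X) : Irr C := Quotient.mk (irrSetoid C) ⟨X, hX⟩

theorem rep_irrOf_iso {X : C} (hX : IsIrreducible X) : Nonempty (rep (irrOf hX) ≅ X) :=
  Quotient.mk_out (⟨X, hX⟩ : {X : C // IsIrreducible X})

theorem irrOf_eq_of_hom_ne_zero {X : C} (hX : IsIrreducible X) {a : Irr C} (f : rep a ⟶ X)
    (hf : f ≠ 0) : a = irrOf hX := by
  obtain ⟨e⟩ := rep_irrOf_iso hX
  refine eq_of_hom_ne_zero (f ≫ e.inv) fun h => hf ?_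
  rw [← Category.comp_id f, ← e.inv_hom_id, ← Category.assoc, h, Limits.zero_comp]

theorem exists_unitary_irrOf {X : C} (hX : IsIrreducible X) :
    ∃ w : rep (irrOf hX) ⟶ X, w ≫ dag w = 𝟙 _ ∧ dag w ≫ w = 𝟙 _ := by
  obtain ⟨e⟩ := rep_irrOf_iso hX
  obtain ⟨-, w, -, h1, h2, -⟩ := exists_unitary_of_ne_zero (rep_irreducible _) hX e.hom
    fun h => hX.1 (by rw [← e.inv_hom_id, h, Limits.comp_zero])
  exact ⟨w, h1, h2⟩

end Category

/-! ### Scalars, dimensions and the inner products on morphisms -/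

section Scalars

variable {C : Type u} [Category.{v} C] [CStarCategory C] [MonoidalCategory C]
  [CStarTensorCategory C]

theorem smul_unitScalar (f : 𝟙_ C ⟶ 𝟙_ C) : unitScalar f • 𝟙 (𝟙_ C) = f := by
  obtain ⟨c, rfl⟩ := exists_scalar f
  rw [unitScalar_smul_id]

theorem unitScalar_dag (f : 𝟙_ C ⟶ 𝟙_ C) : unitScalar (dag f) = starRingEnd ℂ (unitScalar f) := by
  obtain ⟨c, rfl⟩ := exists_scalar f
  rw [CStarCategory.dag_smul, dag_id, unitScalar_smul_id, unitScalar_smul_id]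

@[simp]
theorem unitScalar_id : unitScalar (𝟙 (𝟙_ C)) = 1 := by
  rw [← unitScalar_smul_id (C := C) 1, one_smul]

/-- `unitScalar (f* f)` is nonnegative, and vanishes only for `f = 0`. -/
theorem unitScalar_comp_dag_self {X : C} (f : 𝟙_ C ⟶ X) :
    ∃ r : ℝ, 0 ≤ r ∧ unitScalar (f ≫ dag f) = r ∧ (r = 0 → f = 0) := by
  obtain ⟨r, h0, h1, h2⟩ := exists_nonneg_scalar CStarTensorCategory.unit_irreducible f
  exact ⟨r, h0, by rw [h1, unitScalar_smul_id], h2⟩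

/-- The inner product on the morphisms out of the unit object. -/
@[reducible]
def unitCore (X : C) : InnerProductSpace.Core ℂ (𝟙_ C ⟶ X) where
  inner f g := unitScalar (g ≫ dag f)
  conj_inner_symm f g := by rw [← unitScalar_dag]; simp
  re_inner_nonneg f := by
    obtain ⟨r, h0, h1, -⟩ := unitScalar_comp_dag_self f
    rw [h1]
    simpa using h0
  add_left f g h := by rw [CStarCategory.dag_add, CStarCategory.comp_add, map_add]
  smul_left f g c := by rw [CStarCategory.dag_smul, CStarCategory.comp_smul, map_smul, smul_eq_mul]
  definite f hf := by
    obtain ⟨r, -, h1, h2⟩ := unitScalar_comp_dag_self f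
    exact h2 (by exact_mod_cast h1.symm.trans hf)

/-- The Cauchy-Schwarz inequality for morphisms out of the unit object. -/
theorem norm_unitScalar_comp_dag_le {X : C} (f g : 𝟙_ C ⟶ X) :
    ‖unitScalar (g ≫ dag f)‖ ^ 2 ≤
      (unitScalar (f ≫ dag f)).re * (unitScalar (g ≫ dag g)).re := by
  have h := @InnerProductSpace.Core.inner_mul_inner_self_le ℂ (𝟙_ C ⟶ X) _ _ _
    (unitCore X).toCore f g
  refine le_trans (le_of_eq ?_) h
  rw [sq]
  congr 1
  change ‖unitScalar (g ≫ dag f)‖ = ‖unitScalar (f ≫ dag g)‖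
  rw [← RCLike.norm_conj, ← unitScalar_dag]
  simp

theorem StandardSolution.s_ne_zero {X : C} (hX : 𝟙 X ≠ 0) (σ : StandardSolution X) : σ.s ≠ 0 := by
  intro h
  apply hX
  rw [← σ.conjugateEquations.2, h, dag_zero]
  simp [monoidalComp]

variable [IsRigid C]

theorem Tr_apply (a : Irr C) (T : rep a ⟶ rep a) :
    Tr a T = unitScalar ((std a).s ≫ (T ▷ conj a) ≫ dag (std a).s) := rfl

theorem Tr_id (a : Irr C) : Tr a (𝟙 _) = dim a := by
  obtain ⟨r, -, h1, -⟩ := unitScalar_comp_dag_self (std a).s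
  rw [Tr_apply, dim]
  simp only [id_whiskerRight, Category.id_comp]
  rw [h1, Complex.ofReal_re]

theorem dim_pos (a : Irr C) : 0 < dim a := by
  obtain ⟨r, h0, h1, h2⟩ := unitScalar_comp_dag_self (std a).s
  rw [dim, h1, Complex.ofReal_re]
  exact lt_of_le_of_ne h0 fun h => (std a).s_ne_zero (rep_irreducible a).1 (h2 h.symm)

theorem dim_ne_zero (a : Irr C) : (dim a : ℂ) ≠ 0 := by exact_mod_cast (dim_pos a).ne'

theorem Tr_smul_id (a : Irr C) (z : ℂ) : Tr a (z • 𝟙 _) = z * dim a := by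
  rw [map_smul, Tr_id, smul_eq_mul]

theorem eq_Tr_smul_id (a : Irr C) (T : rep a ⟶ rep a) : T = (Tr a T / dim a) • 𝟙 _ := by
  obtain ⟨z, rfl⟩ := (rep_irreducible a).2 T
  rw [Tr_smul_id, mul_div_cancel_right₀ _ (dim_ne_zero a)]

theorem Tr_dag (a : Irr C) (T : rep a ⟶ rep a) : Tr a (dag T) = starRingEnd ℂ (Tr a T) := by
  obtain ⟨z, rfl⟩ := (rep_irreducible a).2 T
  rw [CStarCategory.dag_smul, dag_id, Tr_smul_id, Tr_smul_id, map_mul, Complex.conj_ofReal]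

theorem homForm_apply (c : Irr C) (X : C) (S T : rep c ⟶ X) :
    homForm c X S T = Tr c (T ≫ dag S) := rfl

theorem comp_dag_eq_homForm (c : Irr C) (X : C) (S T : rep c ⟶ X) :
    T ≫ dag S = (homForm c X S T / dim c) • 𝟙 _ := eq_Tr_smul_id c _

/-- The inner product on the morphisms out of an irreducible object. -/
@[reducible]
def homCore (c : Irr C) (X : C) : InnerProductSpace.Core ℂ (rep c ⟶ X) where
  inner f g := homForm c X f g
  conj_inner_symm f g := by
    rw [homForm_apply, homForm_apply, ← Tr_dag]; simp
  re_inner_nonneg f := by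
    obtain ⟨r, h0, h1, -⟩ := exists_nonneg_scalar (rep_irreducible c) f
    rw [homForm_apply, h1, Tr_smul_id]
    rw [← Complex.ofReal_mul]
    exact mul_nonneg h0 (dim_pos c).le
  add_left f g h := by simp
  smul_left f g c := by simp
  definite f hf := by
    obtain ⟨r, -, h1, h2⟩ := exists_nonneg_scalar (rep_irreducible c) f
    change homForm c X f f = 0 at hf
    rw [homForm_apply, h1, Tr_smul_id] at hf
    exact h2 (by exact_mod_cast (mul_eq_zero.mp hf).resolve_right (dim_ne_zero c))

theorem homForm_conj_symm (c : Irr C) (X : C) (S T : rep c ⟶ X) :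
    starRingEnd ℂ (homForm c X S T) = homForm c X T S := (homCore c X).conj_inner_symm T S

theorem homForm_self_eq_zero {c : Irr C} {X : C} {T : rep c ⟶ X} (h : homForm c X T T = 0) :
    T = 0 := (homCore c X).definite T h

end Scalars

/-! ### Solutions of the conjugate equations as natural transformations -/

section Cups

variable {C : Type u} [Category.{v} C] [CStarCategory C] [MonoidalCategory C]

/-- The morphism `s ⊗ 1 : U → X (Y U)` given by `s : 1 → X Y`. Tensoring with an arbitrary `U` on
the right makes it natural in `U`, so that string diagrams can be rewritten by naturality with all
associators hidden in `cup` and `cap`. -/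
def cup {X Y : C} (s : 𝟙_ C ⟶ X ⊗ Y) (U : C) : U ⟶ X ⊗ (Y ⊗ U) :=
  (λ_ U).inv ≫ s ▷ U ≫ (α_ X Y U).hom

/-- The morphism `s* ⊗ 1 : X (Y U) → U` given by `s : 1 → X Y`. -/
def cap {X Y : C} (s : 𝟙_ C ⟶ X ⊗ Y) (U : C) : X ⊗ (Y ⊗ U) ⟶ U :=
  (α_ X Y U).inv ≫ dag s ▷ U ≫ (λ_ U).hom

variable {X Y : C} (s : 𝟙_ C ⟶ X ⊗ Y) (t : 𝟙_ C ⟶ Y ⊗ X)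

theorem cup_naturality {U V : C} (f : U ⟶ V) : f ≫ cup s V = cup s U ≫ X ◁ Y ◁ f := by
  simp only [cup, Category.assoc, leftUnitor_inv_naturality_assoc]
  rw [whisker_exchange_assoc, tensor_whiskerLeft]
  simp

theorem cup_naturality_assoc {U V W : C} (f : U ⟶ V) (g : X ⊗ (Y ⊗ V) ⟶ W) :
    f ≫ cup s V ≫ g = cup s U ≫ X ◁ Y ◁ f ≫ g := by
  rw [← Category.assoc, cup_naturality, Category.assoc]

theorem cap_naturality {U V : C} (f : U ⟶ V) : X ◁ Y ◁ f ≫ cap s V = cap s U ≫ f := by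
  simp only [cap, Category.assoc]
  rw [← leftUnitor_naturality, ← whisker_exchange_assoc, tensor_whiskerLeft]
  simp

theorem cap_naturality_assoc {U V W : C} (f : U ⟶ V) (g : V ⟶ W) :
    X ◁ Y ◁ f ≫ cap s V ≫ g = cap s U ≫ f ≫ g := by
  rw [← Category.assoc, cap_naturality, Category.assoc]

section

variable [CStarTensorCategory C]

@[simp]
theorem dag_cup (U : C) : dag (cup s U) = cap s U := by
  simp [cup, cap]

@[simp]
theorem dag_cap (U : C) : dag (cap s U) = cup s U := by
  simp [cup, cap]

end

variable {s t}

theorem ConjugateEquations.left_cup_cap (h : ConjugateEquations X Y s t) (U : C) :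
    X ◁ cup t U ≫ cap s (X ⊗ U) = 𝟙 (X ⊗ U) := by
  calc X ◁ cup t U ≫ cap s (X ⊗ U)
      = 𝟙 _ ⊗≫ (𝟙 X ⊗≫ X ◁ t ⊗≫ dag s ▷ X ⊗≫ 𝟙 X) ▷ U ⊗≫ 𝟙 _ := by
        simp only [cup, cap]; monoidal
    _ = 𝟙 (X ⊗ U) := by rw [h.2]; monoidal

theorem ConjugateEquations.left_cup_cap_assoc (h : ConjugateEquations X Y s t) {U W : C}
    (g : X ⊗ U ⟶ W) : X ◁ cup t U ≫ cap s (X ⊗ U) ≫ g = g := by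
  rw [← Category.assoc, h.left_cup_cap, Category.id_comp]

theorem ConjugateEquations.right_cup_cap (h : ConjugateEquations X Y s t) (U : C) :
    Y ◁ cup s U ≫ cap t (Y ⊗ U) = 𝟙 (Y ⊗ U) := by
  calc Y ◁ cup s U ≫ cap t (Y ⊗ U)
      = 𝟙 _ ⊗≫ (𝟙 Y ⊗≫ Y ◁ s ⊗≫ dag t ▷ Y ⊗≫ 𝟙 Y) ▷ U ⊗≫ 𝟙 _ := by
        simp only [cup, cap]; monoidal
    _ = 𝟙 (Y ⊗ U) := by rw [h.1]; monoidal

/-- The conjugate equations in terms of `cup` and `cap`, which only need to hold at the unit. -/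
theorem ConjugateEquations.of_cup_cap (h₁ : X ◁ cup t (𝟙_ C) ≫ cap s (X ⊗ 𝟙_ C) = 𝟙 _)
    (h₂ : Y ◁ cup s (𝟙_ C) ≫ cap t (Y ⊗ 𝟙_ C) = 𝟙 _) : ConjugateEquations X Y s t := by
  constructor
  · calc 𝟙 Y ⊗≫ Y ◁ s ⊗≫ dag t ▷ Y ⊗≫ 𝟙 Y
        = (ρ_ Y).inv ≫ (Y ◁ cup s (𝟙_ C) ≫ cap t (Y ⊗ 𝟙_ C)) ≫ (ρ_ Y).hom := by
          simp only [cup, cap]; monoidal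
      _ = 𝟙 Y := by rw [h₂]; simp
  · calc 𝟙 X ⊗≫ X ◁ t ⊗≫ dag s ▷ X ⊗≫ 𝟙 X
        = (ρ_ X).inv ≫ (X ◁ cup t (𝟙_ C) ≫ cap s (X ⊗ 𝟙_ C)) ≫ (ρ_ X).hom := by
          simp only [cup, cap]; monoidal
      _ = 𝟙 X := by rw [h₁]; simp

theorem ConjugateEquations.symm (h : ConjugateEquations X Y s t) : ConjugateEquations Y X t s :=
  ⟨h.2, h.1⟩

variable [CStarTensorCategory C]

theorem ConjugateEquations.cup_left_cap (h : ConjugateEquations X Y s t) (U : C) :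
    cup s (X ⊗ U) ≫ X ◁ cap t U = 𝟙 (X ⊗ U) := by
  have := congrArg dag (h.left_cup_cap U)
  simpa using this

theorem ConjugateEquations.cup_left_cap_assoc (h : ConjugateEquations X Y s t) {U W : C}
    (g : X ⊗ U ⟶ W) : cup s (X ⊗ U) ≫ X ◁ cap t U ≫ g = g := by
  rw [← Category.assoc, h.cup_left_cap, Category.id_comp]

theorem ConjugateEquations.cup_right_cap (h : ConjugateEquations X Y s t) (U : C) :
    cup t (Y ⊗ U) ≫ Y ◁ cap s U = 𝟙 (Y ⊗ U) := by
  have := congrArg dag (h.right_cup_cap U)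
  simpa using this

theorem ConjugateEquations.cup_right_cap_assoc (h : ConjugateEquations X Y s t) {U W : C}
    (g : Y ⊗ U ⟶ W) : cup t (Y ⊗ U) ≫ Y ◁ cap s U ≫ g = g := by
  rw [← Category.assoc, h.cup_right_cap, Category.id_comp]

end Cups

/-! ### The trace of a standard solution -/

section Traces

variable {C : Type u} [Category.{v} C] [CStarCategory C] [MonoidalCategory C]
  [CStarTensorCategory C]

/-- The trace on the endomorphisms of an object defined by a standard solution. -/
def StandardSolution.tr {X : C} (σ : StandardSolution X) : (X ⟶ X) →ₗ[ℂ] ℂ where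
  toFun T := unitScalar (σ.s ≫ (T ▷ σ.conj) ≫ dag σ.s)
  map_add' T U := by simp
  map_smul' c T := by simp

theorem comp_whiskerRight_cap {X Y Z : C} (s : 𝟙_ C ⟶ X ⊗ Y) (s' : 𝟙_ C ⟶ Z ⊗ Y) (T : X ⟶ Z)
    (U : C) : cup s U ≫ T ▷ (Y ⊗ U) ≫ cap s' U = unitScalar (s ≫ T ▷ Y ≫ dag s') • 𝟙 U := by
  calc cup s U ≫ T ▷ (Y ⊗ U) ≫ cap s' U
      = (λ_ U).inv ≫ (s ≫ T ▷ Y ≫ dag s') ▷ U ≫ (λ_ U).hom := by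
        simp only [cup, cap]; monoidal
    _ = _ := by
        rw [← smul_unitScalar (s ≫ T ▷ Y ≫ dag s')]
        simp

theorem comp_whiskerLeft_cap {X Y Z : C} (s : 𝟙_ C ⟶ Y ⊗ X) (s' : 𝟙_ C ⟶ Y ⊗ Z) (T : X ⟶ Z)
    (U : C) : cup s U ≫ Y ◁ T ▷ U ≫ cap s' U = unitScalar (s ≫ Y ◁ T ≫ dag s') • 𝟙 U := by
  calc cup s U ≫ Y ◁ T ▷ U ≫ cap s' U
      = (λ_ U).inv ≫ (s ≫ Y ◁ T ≫ dag s') ▷ U ≫ (λ_ U).hom := by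
        simp only [cup, cap]; monoidal
    _ = _ := by
        rw [← smul_unitScalar (s ≫ Y ◁ T ≫ dag s')]
        simp

theorem StandardSolution.right_tr {X : C} (σ : StandardSolution X) (T : X ⟶ X) (U : C) :
    cup σ.s U ≫ T ▷ (σ.conj ⊗ U) ≫ cap σ.s U = σ.tr T • 𝟙 U :=
  comp_whiskerRight_cap _ _ _ _

theorem StandardSolution.left_tr {X : C} (σ : StandardSolution X) (T : X ⟶ X) (U : C) :
    cup σ.t U ≫ σ.conj ◁ T ▷ U ≫ cap σ.t U = σ.tr T • 𝟙 U := by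
  rw [comp_whiskerLeft_cap, ← σ.standard]
  rfl

/-- A conjugate of an irreducible object is irreducible. -/
theorem IsIrreducible.conj {X Y : C} (hX : IsIrreducible X) {s : 𝟙_ C ⟶ X ⊗ Y}
    {t : 𝟙_ C ⟶ Y ⊗ X} (h : ConjugateEquations X Y s t) : IsIrreducible Y := by
  have key : ∀ f : Y ⟶ Y, ∃ c : ℂ, f = c • 𝟙 Y := by
    intro f
    obtain ⟨c, hc⟩ := hX.2 (𝟙 X ⊗≫ X ◁ t ⊗≫ X ◁ f ▷ X ⊗≫ dag s ▷ X ⊗≫ 𝟙 X)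
    have hc' : ∀ U : C, X ◁ cup t U ≫ X ◁ f ▷ (X ⊗ U) ≫ cap s (X ⊗ U) = c • 𝟙 _ := by
      intro U
      calc _ = 𝟙 _ ⊗≫ (𝟙 X ⊗≫ X ◁ t ⊗≫ X ◁ f ▷ X ⊗≫ dag s ▷ X ⊗≫ 𝟙 X) ▷ U ⊗≫ 𝟙 _ := by
            simp only [cup, cap]; monoidal
        _ = _ := by rw [hc]; simp [monoidalComp]
    refine ⟨c, ?_⟩
    have hf : f ▷ 𝟙_ C = c • 𝟙 _ := by
      calc f ▷ 𝟙_ C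
          = cup t (Y ⊗ 𝟙_ C) ≫ Y ◁ (X ◁ f ▷ 𝟙_ C ≫ cap s (𝟙_ C)) := by
            rw [MonoidalCategory.whiskerLeft_comp, ← cup_naturality_assoc, h.cup_right_cap,
              Category.comp_id]
        _ = cup t (Y ⊗ 𝟙_ C) ≫ Y ◁ (X ◁ (cup t (Y ⊗ 𝟙_ C) ≫ f ▷ (X ⊗ (Y ⊗ 𝟙_ C)) ≫
              Y ◁ cap s (𝟙_ C)) ≫ cap s (𝟙_ C)) := by
            rw [← whisker_exchange, h.cup_right_cap_assoc]
        _ = cup t (Y ⊗ 𝟙_ C) ≫ Y ◁ ((X ◁ cup t (Y ⊗ 𝟙_ C) ≫ X ◁ f ▷ (X ⊗ (Y ⊗ 𝟙_ C)) ≫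
              cap s (X ⊗ (Y ⊗ 𝟙_ C))) ≫ cap s (𝟙_ C)) := by
            simp only [MonoidalCategory.whiskerLeft_comp, Category.assoc]
            simp only [← MonoidalCategory.whiskerLeft_comp, cap_naturality]
        _ = c • 𝟙 _ := by
            rw [hc', Linear.smul_comp, Category.id_comp, MonoidalLinear.whiskerLeft_smul,
              Linear.comp_smul, h.cup_right_cap]
    have h3 := congrArg (fun g => (ρ_ Y).inv ≫ g ≫ (ρ_ Y).hom) hf
    simpa using h3
  refine ⟨fun h0 => hX.1 ?_, key⟩
  have ht : t = 0 := by
    rw [← Category.comp_id t, ← id_whiskerRight, h0]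
    simp
  rw [← h.2, ht]
  simp [monoidalComp]

end Traces

/-! ### Standard solutions for products and conjugates -/

section Products

variable {C : Type u} [Category.{v} C] [CStarCategory C] [MonoidalCategory C]
  [CStarTensorCategory C]

/-- The nested solution `1 → y ȳ → (y z) (z̄ ȳ)` for a tensor product. -/
def nest {Y Z Yb Zb : C} (s : 𝟙_ C ⟶ Y ⊗ Yb) (s' : 𝟙_ C ⟶ Z ⊗ Zb) :
    𝟙_ C ⟶ (Y ⊗ Z) ⊗ (Zb ⊗ Yb) :=
  s ≫ Y ◁ cup s' Yb ≫ (α_ Y Z (Zb ⊗ Yb)).inv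

theorem cup_nest {Y Z Yb Zb : C} (s : 𝟙_ C ⟶ Y ⊗ Yb) (s' : 𝟙_ C ⟶ Z ⊗ Zb) (U : C) :
    cup (nest s s') U = cup s U ≫ Y ◁ cup s' (Yb ⊗ U) ≫ (α_ Y Z (Zb ⊗ (Yb ⊗ U))).inv ≫
      (Y ⊗ Z) ◁ (α_ Zb Yb U).inv := by
  simp only [cup, nest]; monoidal

theorem cap_nest {Y Z Yb Zb : C} (s : 𝟙_ C ⟶ Y ⊗ Yb) (s' : 𝟙_ C ⟶ Z ⊗ Zb) (U : C) :
    cap (nest s s') U = (Y ⊗ Z) ◁ (α_ Zb Yb U).hom ≫ (α_ Y Z (Zb ⊗ (Yb ⊗ U))).hom ≫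
      Y ◁ cap s' (Yb ⊗ U) ≫ cap s U := by
  rw [← dag_cup, cup_nest]
  simp

theorem ConjugateEquations.nest {Y Z Yb Zb : C} {s : 𝟙_ C ⟶ Y ⊗ Yb} {t : 𝟙_ C ⟶ Yb ⊗ Y}
    {s' : 𝟙_ C ⟶ Z ⊗ Zb} {t' : 𝟙_ C ⟶ Zb ⊗ Z} (h : ConjugateEquations Y Yb s t)
    (h' : ConjugateEquations Z Zb s' t') :
    ConjugateEquations (Y ⊗ Z) (Zb ⊗ Yb) (nest s s') (nest t' t) := by
  have key : ∀ {Y Z Yb Zb : C} {s : 𝟙_ C ⟶ Y ⊗ Yb} {t : 𝟙_ C ⟶ Yb ⊗ Y}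
    {s' : 𝟙_ C ⟶ Z ⊗ Zb} {t' : 𝟙_ C ⟶ Zb ⊗ Z}, ConjugateEquations Y Yb s t →
    ConjugateEquations Z Zb s' t' →
    (Y ⊗ Z) ◁ cup (RigidCStar.nest t' t) (𝟙_ C) ≫
      cap (RigidCStar.nest s s') ((Y ⊗ Z) ⊗ 𝟙_ C) = 𝟙 _ := by
    intro Y Z Yb Zb s t s' t' h h'
    rw [cup_nest, cap_nest]
    calc _ = (α_ Y Z (𝟙_ C)).hom ≫ Y ◁ (Z ◁ cup t' (𝟙_ C) ≫ Z ◁ Zb ◁ cup t (Z ⊗ 𝟙_ C) ≫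
          cap s' (Yb ⊗ (Y ⊗ (Z ⊗ 𝟙_ C)))) ≫ cap s (Y ⊗ (Z ⊗ 𝟙_ C)) ≫ (α_ Y Z (𝟙_ C)).inv := by
          have h1 : cap s ((Y ⊗ Z) ⊗ 𝟙_ C) = Y ◁ Yb ◁ (α_ Y Z (𝟙_ C)).hom ≫
              cap s (Y ⊗ (Z ⊗ 𝟙_ C)) ≫ (α_ Y Z (𝟙_ C)).inv := by
            rw [cap_naturality_assoc, Iso.hom_inv_id, Category.comp_id]
          have h2 : cap s' (Yb ⊗ ((Y ⊗ Z) ⊗ 𝟙_ C)) = Z ◁ Zb ◁ Yb ◁ (α_ Y Z (𝟙_ C)).hom ≫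
              cap s' (Yb ⊗ (Y ⊗ (Z ⊗ 𝟙_ C))) ≫ Yb ◁ (α_ Y Z (𝟙_ C)).inv := by
            rw [cap_naturality_assoc, ← MonoidalCategory.whiskerLeft_comp, Iso.hom_inv_id,
              MonoidalCategory.whiskerLeft_id, Category.comp_id]
          rw [h1, h2]
          monoidal
      _ = 𝟙 _ := by
          rw [cap_naturality, h'.left_cup_cap_assoc, h.left_cup_cap_assoc]
          simp
  exact .of_cup_cap (key h h') (key h'.symm h.symm)

/-- The endomorphism `T ⊗ 1` of `y (z U)` given by an endomorphism `T` of `y z`. -/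
def nestMap {Y Z : C} (T : Y ⊗ Z ⟶ Y ⊗ Z) (U : C) : Y ⊗ (Z ⊗ U) ⟶ Y ⊗ (Z ⊗ U) :=
  (α_ Y Z U).inv ≫ T ▷ U ≫ (α_ Y Z U).hom

/-- Closing the string `z` of an endomorphism of `y z` gives a scalar if `y` is irreducible. -/
theorem right_partial_trace {Y Z : C} (hY : IsIrreducible Y) (τ : StandardSolution Z)
    (T : Y ⊗ Z ⟶ Y ⊗ Z) :
    ∃ c : ℂ, ∀ U : C, Y ◁ cup τ.s U ≫ nestMap T (τ.conj ⊗ U) ≫ Y ◁ cap τ.s U = c • 𝟙 _ := by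
  obtain ⟨c, hc⟩ := hY.2 (𝟙 Y ⊗≫ Y ◁ τ.s ⊗≫ T ▷ τ.conj ⊗≫ Y ◁ dag τ.s ⊗≫ 𝟙 Y)
  refine ⟨c, fun U => ?_⟩
  calc _ = 𝟙 _ ⊗≫ (𝟙 Y ⊗≫ Y ◁ τ.s ⊗≫ T ▷ τ.conj ⊗≫ Y ◁ dag τ.s ⊗≫ 𝟙 Y) ▷ U ⊗≫ 𝟙 _ := by
        simp only [cup, cap, nestMap]; monoidal
    _ = _ := by rw [hc]; simp [monoidalComp]

/-- Closing the string `y` of an endomorphism of `y z` gives a scalar if `z` is irreducible. -/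
theorem left_partial_trace {Y Z : C} (hZ : IsIrreducible Z) (σ : StandardSolution Y)
    (T : Y ⊗ Z ⟶ Y ⊗ Z) :
    ∃ c : ℂ, ∀ U : C, cup σ.t (Z ⊗ U) ≫ σ.conj ◁ nestMap T U ≫ cap σ.t (Z ⊗ U) = c • 𝟙 _ := by
  obtain ⟨c, hc⟩ := hZ.2 (𝟙 Z ⊗≫ σ.t ▷ Z ⊗≫ σ.conj ◁ T ⊗≫ dag σ.t ▷ Z ⊗≫ 𝟙 Z)
  refine ⟨c, fun U => ?_⟩
  calc _ = 𝟙 _ ⊗≫ (𝟙 Z ⊗≫ σ.t ▷ Z ⊗≫ σ.conj ◁ T ⊗≫ dag σ.t ▷ Z ⊗≫ 𝟙 Z) ▷ U ⊗≫ 𝟙 _ := by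
        simp only [cup, cap, nestMap]; monoidal
    _ = _ := by rw [hc]; simp [monoidalComp]

/-- The trace on the endomorphisms of `y z` that closes `y` on the left and `z` on the right. -/
def mixedTrace {Y Z : C} (σ : StandardSolution Y) (τ : StandardSolution Z) (T : Y ⊗ Z ⟶ Y ⊗ Z) :
    ℂ :=
  unitScalar (cup σ.t (𝟙_ C) ≫ σ.conj ◁ (Y ◁ cup τ.s (𝟙_ C) ≫ nestMap T (τ.conj ⊗ 𝟙_ C) ≫
    Y ◁ cap τ.s (𝟙_ C)) ≫ cap σ.t (𝟙_ C))

theorem StandardSolution.tr_id_smul {X : C} (σ : StandardSolution X) (c : ℂ) (U : C) :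
    cup σ.s U ≫ (c • 𝟙 (X ⊗ (σ.conj ⊗ U))) ≫ cap σ.s U = (c * σ.tr (𝟙 X)) • 𝟙 U := by
  have := σ.right_tr (c • 𝟙 X) U
  rw [map_smul, smul_eq_mul] at this
  rw [← this]
  simp

theorem StandardSolution.tr_id_smul' {X : C} (σ : StandardSolution X) (c : ℂ) (U : C) :
    cup σ.t U ≫ (c • 𝟙 (σ.conj ⊗ (X ⊗ U))) ≫ cap σ.t U = (c * σ.tr (𝟙 X)) • 𝟙 U := by
  have := σ.left_tr (c • 𝟙 X) U
  rw [map_smul, smul_eq_mul] at this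
  rw [← this]
  simp

/-- The full right closure agrees with the mixed trace: after `z` has been closed only a scalar on
`y` is left, whose left and right closures agree by standardness. -/
theorem tr_nest {Y Z : C} (hY : IsIrreducible Y) (σ : StandardSolution Y)
    (τ : StandardSolution Z) (T : Y ⊗ Z ⟶ Y ⊗ Z) :
    unitScalar (nest σ.s τ.s ≫ T ▷ (τ.conj ⊗ σ.conj) ≫ dag (nest σ.s τ.s)) =
      mixedTrace σ τ T := by
  obtain ⟨c, hc⟩ := right_partial_trace hY τ T
  have h1 : mixedTrace σ τ T = c * σ.tr (𝟙 Y) := by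
    rw [mixedTrace, hc, MonoidalLinear.whiskerLeft_smul, MonoidalCategory.whiskerLeft_id,
      σ.tr_id_smul', ← smul_unitScalar (_ • _), unitScalar_smul_id, unitScalar_smul_id]
  have h2 := comp_whiskerRight_cap (nest σ.s τ.s) (nest σ.s τ.s) T (𝟙_ C)
  apply smul_id_injective (CStarTensorCategory.unit_irreducible (C := C))
  rw [h1, ← h2, ← σ.tr_id_smul, ← hc, cup_nest, cap_nest, nestMap]
  monoidal

/-- The full left closure agrees with the mixed trace. -/
theorem tr_nest' {Y Z : C} (hZ : IsIrreducible Z) (σ : StandardSolution Y)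
    (τ : StandardSolution Z) (T : Y ⊗ Z ⟶ Y ⊗ Z) :
    unitScalar (nest τ.t σ.t ≫ (τ.conj ⊗ σ.conj) ◁ T ≫ dag (nest τ.t σ.t)) =
      mixedTrace σ τ T := by
  obtain ⟨c, hc⟩ := left_partial_trace hZ σ T
  have h1 : mixedTrace σ τ T = c * τ.tr (𝟙 Z) := by
    apply smul_id_injective (CStarTensorCategory.unit_irreducible (C := C))
    rw [mixedTrace, smul_unitScalar, ← τ.tr_id_smul, ← hc]
    simp only [MonoidalCategory.whiskerLeft_comp, Category.assoc]
    rw [← cup_naturality_assoc, cap_naturality]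
  have h2 := comp_whiskerLeft_cap (nest τ.t σ.t) (nest τ.t σ.t) T (𝟙_ C)
  apply smul_id_injective (CStarTensorCategory.unit_irreducible (C := C))
  rw [h1, ← h2, ← τ.tr_id_smul', ← MonoidalCategory.whiskerLeft_id,
    ← MonoidalLinear.whiskerLeft_smul, ← hc, cup_nest, cap_nest, nestMap]
  monoidal

/-- The nested solution for a product of irreducible objects, as a standard solution: its right and
left traces both agree with the mixed trace. -/
def StandardSolution.prod {Y Z : C} (hY : IsIrreducible Y) (hZ : IsIrreducible Z)
    (σ : StandardSolution Y) (τ : StandardSolution Z) : StandardSolution (Y ⊗ Z) where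
  conj := τ.conj ⊗ σ.conj
  s := nest σ.s τ.s
  t := nest τ.t σ.t
  conjugateEquations := σ.conjugateEquations.nest τ.conjugateEquations
  standard T := by
    rw [← smul_unitScalar (_ ≫ T ▷ _ ≫ _), tr_nest hY, ← tr_nest' hZ, smul_unitScalar]

theorem StandardSolution.tr_prod {Y Z : C} (hY : IsIrreducible Y) (hZ : IsIrreducible Z)
    (σ : StandardSolution Y) (τ : StandardSolution Z) (T : Y ⊗ Z ⟶ Y ⊗ Z) :
    (σ.prod hY hZ τ).tr T = mixedTrace σ τ T := tr_nest hY σ τ T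

/-- The standard solution for the conjugate of an irreducible object that exchanges `s` and `t`. -/
def StandardSolution.swap {X : C} (hX : IsIrreducible X) (σ : StandardSolution X) :
    StandardSolution σ.conj where
  conj := X
  s := σ.t
  t := σ.s
  conjugateEquations := σ.conjugateEquations.symm
  standard T := by
    obtain ⟨c, rfl⟩ := (hX.conj σ.conjugateEquations).2 T
    have := σ.standard (𝟙 X)
    simp only [id_whiskerRight, MonoidalCategory.whiskerLeft_id, Category.id_comp] at this
    simp [this]

variable (C) in
/-- The trivial standard solution for the unit object. -/
def StandardSolution.unit : StandardSolution (𝟙_ C) where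
  conj := 𝟙_ C
  s := (λ_ (𝟙_ C)).inv
  t := (λ_ (𝟙_ C)).inv
  conjugateEquations := by
    constructor <;> (simp only [dag_leftUnitor_inv]; monoidal)
  standard T := by
    obtain ⟨c, rfl⟩ := exists_scalar T
    simp

end Products

/-! ### The trace property -/

section TraceProperty

variable {C : Type u} [Category.{v} C] [CStarCategory C] [MonoidalCategory C]
  [CStarTensorCategory C]

/-- The transpose `c̄ → X̄` of `f : X → c` that is formed with `t_X` and `s_c*`. -/
def leftTranspose {X c Xb cb : C} (t : 𝟙_ C ⟶ Xb ⊗ X) (s : 𝟙_ C ⟶ c ⊗ cb) (f : X ⟶ c) : cb ⟶ Xb :=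
  𝟙 _ ⊗≫ t ▷ cb ⊗≫ Xb ◁ f ▷ cb ⊗≫ Xb ◁ dag s ⊗≫ 𝟙 _

theorem leftTranspose_whiskerRight {X c Xb cb : C} (t : 𝟙_ C ⟶ Xb ⊗ X) (s : 𝟙_ C ⟶ c ⊗ cb)
    (f : X ⟶ c) (U : C) :
    leftTranspose t s f ▷ U = cup t (cb ⊗ U) ≫ Xb ◁ f ▷ (cb ⊗ U) ≫ Xb ◁ cap s U := by
  simp only [leftTranspose, cup, cap]; monoidal

/-- The morphism `X → c` that is obtained from `g : c̄ → X̄` by bending the strings back with `s_c`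
and `t_X*`. -/
def rightTranspose {X c Xb cb : C} (t : 𝟙_ C ⟶ Xb ⊗ X) (s : 𝟙_ C ⟶ c ⊗ cb) (g : cb ⟶ Xb) : X ⟶ c :=
  𝟙 _ ⊗≫ s ▷ X ⊗≫ c ◁ g ▷ X ⊗≫ c ◁ dag t ⊗≫ 𝟙 _

theorem rightTranspose_whiskerRight {X c Xb cb : C} (t : 𝟙_ C ⟶ Xb ⊗ X) (s : 𝟙_ C ⟶ c ⊗ cb)
    (g : cb ⟶ Xb) (U : C) :
    rightTranspose t s g ▷ U = cup s (X ⊗ U) ≫ c ◁ g ▷ (X ⊗ U) ≫ c ◁ cap t U := by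
  simp only [rightTranspose, cup, cap]; monoidal

variable [IsRigid C] {X : C} (σ : StandardSolution X) (c : Irr C)

/-- The vector `(f* ⊗ 1) s_X` in the morphisms `1 → c X̄`. The trivial factor `1` keeps it in the
form of `cup`. -/
def rightVec (f : rep c ⟶ X) : 𝟙_ C ⟶ rep c ⊗ (σ.conj ⊗ 𝟙_ C) :=
  cup σ.s (𝟙_ C) ≫ dag f ▷ (σ.conj ⊗ 𝟙_ C)

/-- The vector in the morphisms `1 → c X̄` that is obtained from `s_c` by applying the left
transpose of `f*` to `c̄`. -/
def leftVec (f : rep c ⟶ X) : 𝟙_ C ⟶ rep c ⊗ (σ.conj ⊗ 𝟙_ C) :=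
  cup (std c).s (𝟙_ C) ≫ rep c ◁ leftTranspose σ.t (std c).s (dag f) ▷ 𝟙_ C

theorem rightVec_comp_dag (f : rep c ⟶ X) :
    unitScalar (rightVec σ c f ≫ dag (rightVec σ c f)) = σ.tr (dag f ≫ f) := by
  apply smul_id_injective (CStarTensorCategory.unit_irreducible (C := C))
  rw [smul_unitScalar, ← σ.right_tr]
  simp [rightVec]

theorem leftVec_comp_dag (f : rep c ⟶ X) :
    unitScalar (leftVec σ c f ≫ dag (leftVec σ c f)) = σ.tr (dag f ≫ f) := by
  set g := leftTranspose σ.t (std c).s (dag f) with hg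
  obtain ⟨e, he⟩ := ((rep_irreducible c).conj (std c).conjugateEquations).2 (g ≫ dag g)
  have h1 : unitScalar (leftVec σ c f ≫ dag (leftVec σ c f)) = e * dim c := by
    apply smul_id_injective (CStarTensorCategory.unit_irreducible (C := C))
    have h := (std c).tr_id_smul e (𝟙_ C)
    rw [smul_unitScalar, ← Tr_id]
    refine Eq.trans ?_ h
    have h2 : e • 𝟙 (rep c ⊗ (conj c ⊗ 𝟙_ C)) = rep c ◁ (g ≫ dag g) ▷ 𝟙_ C := by
      rw [he]; simp
    rw [h2]
    simp [leftVec, ← hg]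
  have h2 : σ.tr (dag f ≫ f) = e * dim c := by
    apply smul_id_injective (CStarTensorCategory.unit_irreducible (C := C))
    have h := (std c).tr_id_smul' e (𝟙_ C)
    rw [← Tr_id]
    refine Eq.trans ?_ h
    have h2 : e • 𝟙 (conj c ⊗ (rep c ⊗ 𝟙_ C)) = (g ≫ dag g) ▷ (rep c ⊗ 𝟙_ C) := by
      rw [he]; simp
    have h3 : cup (std c).t (𝟙_ C) ≫ g ▷ (rep c ⊗ 𝟙_ C) =
        cup σ.t (𝟙_ C) ≫ σ.conj ◁ dag f ▷ 𝟙_ C := by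
      rw [hg, leftTranspose_whiskerRight, cup_naturality_assoc,
        ← MonoidalCategory.whiskerLeft_comp_assoc, whisker_exchange]
      simp only [MonoidalCategory.whiskerLeft_comp, Category.assoc]
      rw [← MonoidalCategory.whiskerLeft_comp σ.conj (rep c ◁ _),
          (std c).conjugateEquations.left_cup_cap]
      simp
    have h4 := congrArg dag h3
    rw [h2, ← σ.left_tr]
    simp only [CStarCategory.dag_comp, dag_cup, CStarTensorCategory.dag_whiskerRight,
      CStarTensorCategory.dag_whiskerLeft, CStarCategory.dag_dag] at h4
    simp only [comp_whiskerRight, MonoidalCategory.whiskerLeft_comp, Category.assoc, h4,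
      reassoc_of% h3]
  rw [h1, h2]

theorem rightVec_comp_dag_leftVec (f g : rep c ⟶ X) :
    unitScalar (rightVec σ c f ≫ dag (leftVec σ c g)) = Tr c (g ≫ dag f) := by
  apply smul_id_injective (CStarTensorCategory.unit_irreducible (C := C))
  rw [smul_unitScalar]
  refine Eq.trans ?_ ((std c).right_tr (g ≫ dag f) (𝟙_ C))
  rw [rightVec, leftVec, leftTranspose_whiskerRight]
  simp only [CStarCategory.dag_comp, dag_cup, dag_cap, CStarTensorCategory.dag_whiskerRight,
      CStarTensorCategory.dag_whiskerLeft, CStarCategory.dag_dag, Category.assoc,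
      MonoidalCategory.whiskerLeft_comp, comp_whiskerRight]
  simp only [← whisker_exchange_assoc]
  rw [← cup_naturality_assoc, ← cup_naturality_assoc, σ.conjugateEquations.cup_left_cap_assoc]

theorem exists_rightVec_eq_leftVec (f : rep c ⟶ X) : ∃ g, rightVec σ c g = leftVec σ c f := by
  set h := leftTranspose σ.t (std c).s (dag f) with hg
  refine ⟨dag (rightTranspose σ.t (std c).s h), ?_⟩
  rw [rightVec, leftVec, ← hg, CStarCategory.dag_dag, rightTranspose_whiskerRight,
    cup_naturality_assoc, ← MonoidalCategory.whiskerLeft_comp_assoc, whisker_exchange]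
  simp only [MonoidalCategory.whiskerLeft_comp, Category.assoc]
  rw [← MonoidalCategory.whiskerLeft_comp (rep c) (σ.conj ◁ _), σ.conjugateEquations.right_cup_cap]
  simp

/-- The trace property on the diagonal. The vectors `rightVec f` and `leftVec f` both have squared
norm `Tr_X(f f*)`, while their inner product is `Tr_c(f* f)`. Cauchy-Schwarz gives one inequality;
writing `leftVec f = rightVec g` and applying Cauchy-Schwarz to `f` and `g` gives the other. -/
theorem StandardSolution.tr_dag_comp_self (f : rep c ⟶ X) :
    σ.tr (dag f ≫ f) = Tr c (f ≫ dag f) := by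
  obtain ⟨n, hn0, hn⟩ : ∃ n : (rep c ⟶ X) → ℝ, (∀ f, 0 ≤ n f) ∧ ∀ f, Tr c (f ≫ dag f) = n f := by
    choose n h0 h1 using fun f : rep c ⟶ X => exists_nonneg_scalar (rep_irreducible c) f
    refine ⟨fun f => n f * dim c, fun f => mul_nonneg (h0 f) (dim_pos c).le, fun f => ?_⟩
    rw [(h1 f).1, Tr_smul_id]
    push_cast
    rfl
  obtain ⟨m, hm0, hm⟩ : ∃ m : (rep c ⟶ X) → ℝ, (∀ f, 0 ≤ m f) ∧ ∀ f, σ.tr (dag f ≫ f) = m f := by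
    choose m h0 h1 using fun f : rep c ⟶ X => unitScalar_comp_dag_self (rightVec σ c f)
    exact ⟨m, h0, fun f => by rw [← (h1 f).1, rightVec_comp_dag]⟩
  obtain ⟨g, hg⟩ := exists_rightVec_eq_leftVec σ c f
  have hmg : m g = m f := by
    have := rightVec_comp_dag σ c g
    rw [hg, leftVec_comp_dag, hm, hm] at this
    exact_mod_cast this.symm
  have hnm : ∀ f, n f ≤ m f := by
    intro f
    have := norm_unitScalar_comp_dag_le (leftVec σ c f) (rightVec σ c f)
    rw [rightVec_comp_dag_leftVec, rightVec_comp_dag, leftVec_comp_dag, hm, hn, Complex.ofReal_re,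
      Complex.norm_real, Real.norm_of_nonneg (hn0 f), ← sq] at this
    exact abs_le_of_sq_le_sq' this (hm0 f) |>.2
  have h2 : m f ^ 2 ≤ n g * n f := by
    have e : (m f : ℂ) = homForm c X g f := by
      rw [← hm, ← leftVec_comp_dag, homForm_apply, ← rightVec_comp_dag_leftVec σ c g f, hg]
    have h := @InnerProductSpace.Core.inner_mul_inner_self_le ℂ (rep c ⟶ X) _ _ _
      (homCore c X).toCore g f
    have e' : homForm c X f g = m f := by
      rw [← homForm_conj_symm, ← e, Complex.conj_ofReal]
    change ‖homForm c X g f‖ * ‖homForm c X f g‖ ≤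
      (homForm c X g g).re * (homForm c X f f).re at h
    rw [← e, e', homForm_apply, homForm_apply, hn, hn, Complex.ofReal_re, Complex.ofReal_re,
      Complex.norm_real, Real.norm_of_nonneg (hm0 f), ← sq] at h
    exact h
  have h3 : m f ≤ n f := by
    have h4 : m f ^ 2 ≤ m f * n f :=
      h2.trans (mul_le_mul_of_nonneg_right ((hnm g).trans hmg.le) (hn0 f))
    rcases (hm0 f).eq_or_lt with h5 | h5
    · rw [← h5]; exact hn0 f
    · rw [sq] at h4
      exact le_of_mul_le_mul_left h4 h5
  rw [hm, hn, le_antisymm h3 (hnm f)]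

/-- The trace property: the trace of a standard solution on any object agrees with the trace on the
irreducible objects. It follows from `tr_dag_comp_self` by polarization. -/
theorem StandardSolution.tr_comp (f : rep c ⟶ X) (g : X ⟶ rep c) :
    σ.tr (g ≫ f) = Tr c (f ≫ g) := by
  have h1 := σ.tr_dag_comp_self c (f + dag g)
  have h2 := σ.tr_dag_comp_self c (f + Complex.I • dag g)
  have h3 := σ.tr_dag_comp_self c f
  have h4 := σ.tr_dag_comp_self c (dag g)
  simp only [CStarCategory.dag_add, CStarCategory.dag_smul, CStarCategory.dag_dag,
    Preadditive.add_comp, Preadditive.comp_add, Linear.smul_comp, Linear.comp_smul, map_add,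
    map_smul, smul_eq_mul, Complex.conj_I, smul_add] at h1 h2 h3 h4
  have hI := Complex.I_mul_I
  -- the polarization identity; the last summand removes the factor `I * I` that it produces
  have h5 : σ.tr (g ≫ f) - Tr c (f ≫ g) = 0 := by
    linear_combination (1 / 2 : ℂ) * (h1 - h3 - h4) + (1 / 2 : ℂ) * Complex.I * (h2 - h3 - h4) +
      (1 / 2 : ℂ) * (σ.tr (g ≫ f) - Tr c (f ≫ g) + Tr c (dag g ≫ dag f) - σ.tr (dag f ≫ dag g)
        + Complex.I * (σ.tr (g ≫ dag g) - Tr c (dag g ≫ g))) * hI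
  exact sub_eq_zero.mp h5

end TraceProperty

/-! ### Finite-dimensional inner product spaces and C*-algebras -/

section LinearAlgebra

/-- An inner product space whose finite orthonormal families have bounded size is
finite-dimensional. -/
theorem finiteDimensional_of_orthonormal_le {V : Type*} [AddCommGroup V] [Module ℂ V]
    (c : InnerProductSpace.Core ℂ V) (N : ℕ)
    (h : ∀ (n : ℕ) (e : Fin n → V), (∀ k l, c.inner (e k) (e l) = if k = l then 1 else 0) → n ≤ N) :
    FiniteDimensional ℂ V := by
  let _ : NormedAddCommGroup V := c.toNormedAddCommGroup
  let _ : InnerProductSpace ℂ V := InnerProductSpace.ofCore c.toCore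
  by_contra hV
  have h1 : ((N + 1 : ℕ) : Cardinal) ≤ Module.rank ℂ V := by
    by_contra h2
    exact hV (Module.rank_lt_aleph0_iff.mp ((not_le.mp h2).trans (Cardinal.natCast_lt_aleph0)))
  obtain ⟨s, hs, hli⟩ := le_rank_iff_exists_linearIndependent_finset.mp h1
  let f : Fin (N + 1) → V := fun k => (s.equivFinOfCardEq hs).symm k
  have hf : LinearIndependent ℂ f := hli.comp _ (s.equivFinOfCardEq hs).symm.injective
  have h3 := InnerProductSpace.gramSchmidtNormed_orthonormal hf
  have := h (N + 1) _ fun k l => (orthonormal_iff_ite.mp h3) k l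
  omega

theorem exists_orthonormal_spanning {V : Type*} [AddCommGroup V] [Module ℂ V]
    [FiniteDimensional ℂ V] (c : InnerProductSpace.Core ℂ V) :
    ∃ (n : ℕ) (e : Fin n → V), (∀ k l, c.inner (e k) (e l) = if k = l then 1 else 0) ∧
      Submodule.span ℂ (Set.range e) = ⊤ := by
  let _ : NormedAddCommGroup V := c.toNormedAddCommGroup
  let _ : InnerProductSpace ℂ V := InnerProductSpace.ofCore c.toCore
  refine ⟨_, stdOrthonormalBasis ℂ V, orthonormal_iff_ite.mp (stdOrthonormalBasis ℂ V).orthonormal,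
    ?_⟩
  rw [← OrthonormalBasis.coe_toBasis, Module.Basis.span_eq]

/-- A finite-dimensional C*-algebra other than the scalars contains a nontrivial projection. -/
theorem exists_nontrivial_projection {A : Type*} [CStarAlgebra A] [FiniteDimensional ℂ A]
    [Nontrivial A] (hA : ∃ a : A, ∀ z : ℂ, a ≠ algebraMap ℂ A z) :
    ∃ p : A, p * p = p ∧ star p = p ∧ p ≠ 0 ∧ p ≠ 1 := by
  obtain ⟨h, hh, hns⟩ : ∃ h : A, IsSelfAdjoint h ∧ ∀ z : ℂ, h ≠ algebraMap ℂ A z := by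
    obtain ⟨a, ha⟩ := hA
    by_contra! hcon
    obtain ⟨z, hz⟩ := hcon _ (realPart a).2
    obtain ⟨z', hz'⟩ := hcon _ (imaginaryPart a).2
    refine ha (z + Complex.I * z') ?_
    rw [map_add, ← hz, map_mul, ← hz', ← Algebra.smul_def]
    exact (realPart_add_I_smul_imaginaryPart a).symm
  have hn : IsStarNormal h := hh.isStarNormal
  have hfin : (spectrum ℂ h).Finite := by
    refine ((minpoly ℂ h).roots.toFinset.finite_toSet).subset fun z hz => ?_
    have h1 := spectrum.subset_polynomial_aeval h (minpoly ℂ h) ⟨z, hz, rfl⟩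
    rw [minpoly.aeval, spectrum.zero_eq] at h1
    simpa [minpoly.ne_zero (Algebra.IsIntegral.isIntegral (R := ℂ) h)] using h1
  have hcont : ∀ f : ℂ → ℂ, ContinuousOn f (spectrum ℂ h) := fun f => hfin.continuousOn f
  obtain ⟨z, hz⟩ := spectrum.nonempty h
  obtain ⟨z', hz', hne⟩ : ∃ z' ∈ spectrum ℂ h, z' ≠ z := by
    by_contra! hcon
    refine hns z ?_
    conv_lhs => rw [← cfc_id ℂ h]
    rw [← cfc_const z h]
    exact cfc_congr fun w hw => hcon w hw
  classical
  let f : ℂ → ℂ := fun w => if w = z then 1 else 0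
  have hsp : spectrum ℂ (cfc f h) = f '' spectrum ℂ h := cfc_map_spectrum f h hn (hcont f)
  refine ⟨cfc f h, ?_, ?_, fun h0 => ?_, fun h0 => ?_⟩
  · rw [← cfc_mul f f h (hcont f) (hcont f)]
    congr 1
    ext w
    by_cases hw : w = z <;> simp [f, hw]
  · rw [← cfc_star]
    congr 1
    ext w
    by_cases hw : w = z <;> simp [f, hw]
  · have : (1 : ℂ) ∈ spectrum ℂ (cfc f h) := hsp ▸ ⟨z, hz, by simp [f]⟩
    rw [h0, spectrum.zero_eq] at this
    simp at this
  · have : (0 : ℂ) ∈ spectrum ℂ (cfc f h) := hsp ▸ ⟨z', hz', by simp [f, hne]⟩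
    rw [h0, spectrum.one_eq] at this
    simp at this

end LinearAlgebra

/-! ### Projections in endomorphism algebras -/

section Endomorphisms

variable {C : Type u} [Category.{v} C] [CStarCategory C]

/-- The C*-algebra of endomorphisms of an object. The product of `End X` is `f * g = g ≫ f`. -/
@[reducible]
def endCStarAlgebra (X : C) : CStarAlgebra (End X) where
  __ := (inferInstance : Ring (End X))
  __ := CStarCategory.homNormed X X
  __ := CStarCategory.homComplete X X
  __ := (inferInstance : Algebra ℂ (End X))
  norm_mul_le f g := by
    rw [mul_comm]
    exact CStarCategory.norm_comp_le g f
  star f := dag (show X ⟶ X from f)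
  star_involutive f := CStarCategory.dag_dag _
  star_mul f g := CStarCategory.dag_comp _ _
  star_add f g := CStarCategory.dag_add _ _
  norm_mul_self_le f := (CStarCategory.norm_comp_dag (show X ⟶ X from f)).ge
  norm_smul_le c f := (norm_smul c (show X ⟶ X from f)).le
  star_smul c f := CStarCategory.dag_smul _ _

/-- An object that is neither zero nor irreducible has a nontrivial projection. -/
theorem exists_projection {X : C} [FiniteDimensional ℂ (X ⟶ X)] (h0 : 𝟙 X ≠ 0)
    (hX : ¬ IsIrreducible X) :
    ∃ p : X ⟶ X, p ≫ p = p ∧ dag p = p ∧ p ≠ 0 ∧ p ≠ 𝟙 X := by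
  let _ : CStarAlgebra (End X) := endCStarAlgebra X
  have : FiniteDimensional ℂ (End X) := inferInstanceAs (FiniteDimensional ℂ (X ⟶ X))
  have : Nontrivial (End X) := ⟨⟨𝟙 X, 0, h0⟩⟩
  simp only [IsIrreducible, not_and, not_forall, not_exists] at hX
  obtain ⟨f, hf⟩ := hX h0
  exact exists_nontrivial_projection (A := End X) ⟨f, fun z hz => hf z
    (hz.trans (Algebra.algebraMap_eq_smul_one z))⟩

end Endomorphisms

/-! ### Finite-dimensionality of the morphism spaces -/

section FiniteDimensionality

variable {C : Type u} [Category.{v} C] [CStarCategory C] [MonoidalCategory C]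
  [CStarTensorCategory C]

/-- A projection is at most the identity in the positive functional given by a morphism out of the
unit object. -/
theorem unitScalar_projection_le {X : C} (t : 𝟙_ C ⟶ X) (p : X ⟶ X) (h1 : p ≫ p = p)
    (h2 : dag p = p) : (unitScalar (t ≫ p ≫ dag t)).re ≤ (unitScalar (t ≫ dag t)).re := by
  obtain ⟨r, hr, h3, -⟩ := unitScalar_comp_dag_self (t ≫ (𝟙 X - p))
  have h4 : (t ≫ (𝟙 X - p)) ≫ dag (t ≫ (𝟙 X - p)) = t ≫ dag t - t ≫ p ≫ dag t := by
    simp only [CStarCategory.dag_comp, dag_sub, h2, Preadditive.comp_sub,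
      Preadditive.sub_comp, Category.comp_id, Category.assoc, reassoc_of% h1]
    abel
  rw [h4, map_sub] at h3
  have := congrArg Complex.re h3
  simp at this
  linarith

/-- The morphisms from the unit to an object with a conjugate form a finite-dimensional space: an
orthonormal family has at most `‖s‖² ‖t‖²` members. The transposes `g_k` of its members satisfy
`1 ≤ ‖g_k‖² ‖s‖²` by the conjugate equations, and `∑_k ‖g_k‖² ≤ ‖t‖²` because `∑_k f_k f_k^*` is a
projection. -/
theorem finiteDimensional_unit_hom {Z Zb : C} {s : 𝟙_ C ⟶ Z ⊗ Zb} {t : 𝟙_ C ⟶ Zb ⊗ Z}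
    (h : ConjugateEquations Z Zb s t) : FiniteDimensional ℂ (𝟙_ C ⟶ Z) := by
  set S := (unitScalar (s ≫ dag s)).re
  set T := (unitScalar (t ≫ dag t)).re
  have hS : 0 ≤ S := by
    obtain ⟨r, hr, h3, -⟩ := unitScalar_comp_dag_self s
    simpa [S, h3] using hr
  refine finiteDimensional_of_orthonormal_le (unitCore Z) ⌈S * T⌉₊ fun n f hf => ?_
  have hf' : ∀ k l, f k ≫ dag (f l) = if k = l then 𝟙 _ else 0 := by
    intro k l
    rw [← smul_unitScalar (f k ≫ dag (f l))]
    have := hf l k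
    change unitScalar (f k ≫ dag (f l)) = _ at this
    rw [this]
    by_cases hkl : k = l <;> simp [hkl, eq_comm]
  let g : Fin n → (𝟙_ C ⟶ Zb) := fun k => t ≫ Zb ◁ dag (f k) ≫ (ρ_ Zb).hom
  have hg : ∀ k, f k = s ≫ Z ◁ dag (g k) ≫ (ρ_ Z).hom := by
    intro k
    have e1 : s = cup s (𝟙_ C) ≫ Z ◁ (ρ_ Zb).hom := by simp only [cup]; monoidal
    have e2 : dag t = Zb ◁ (ρ_ Z).inv ≫ cap t (𝟙_ C) := by simp only [cap]; monoidal
    have e3 : s ≫ Z ◁ dag (g k) = f k ≫ (ρ_ Z).inv := by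
      rw [e1]
      simp only [g, CStarCategory.dag_comp, CStarTensorCategory.dag_whiskerLeft,
        CStarCategory.dag_dag, CStarTensorCategory.dag_rightUnitor,
        MonoidalCategory.whiskerLeft_comp, Category.assoc]
      rw [← MonoidalCategory.whiskerLeft_comp_assoc, Iso.hom_inv_id,
        MonoidalCategory.whiskerLeft_id, Category.id_comp, ← cup_naturality_assoc, e2,
        MonoidalCategory.whiskerLeft_comp, ← cup_naturality_assoc, h.cup_left_cap,
        Category.comp_id]
    rw [reassoc_of% e3]
    simp
  choose r hr0 hr1 hr2 using fun k => exists_nonneg_scalar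
    (CStarTensorCategory.unit_irreducible (C := C)) (g k)
  have hr2' : ∀ k, 0 < r k := by
    intro k
    refine lt_of_le_of_ne (hr0 k) fun h0 => ?_
    have h3 := hg k
    rw [hr2 k h0.symm, dag_zero] at h3
    have h4 := hf' k k
    rw [h3] at h4
    simp at h4
    exact (CStarTensorCategory.unit_irreducible (C := C)).1 h4.symm
  have h1 : ∀ k, 1 ≤ r k * S := by
    intro k
    have hp := unitScalar_projection_le s (Z ◁ ((r k : ℂ)⁻¹ • (dag (g k) ≫ g k))) ?_ ?_
    · have h3 : unitScalar (s ≫ Z ◁ (dag (g k) ≫ g k) ≫ dag s) = 1 := by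
        rw [← unitScalar_id (C := C)]
        congr 1
        have h4 := hf' k k
        rw [hg k, if_pos rfl] at h4
        simpa using h4
      simp only [MonoidalLinear.whiskerLeft_smul, Linear.smul_comp, Linear.comp_smul, map_smul,
        h3] at hp
      rw [smul_eq_mul, mul_one, ← Complex.ofReal_inv, Complex.ofReal_re] at hp
      rwa [inv_le_iff_one_le_mul₀' (hr2' k)] at hp
    · rw [← MonoidalCategory.whiskerLeft_comp]
      congr 1
      have hr2c : (r k : ℂ) ≠ 0 := by exact_mod_cast (hr2' k).ne'
      simp only [Linear.smul_comp, Linear.comp_smul, Category.assoc, smul_smul]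
      rw [← Category.assoc (g k), hr1 k, Linear.smul_comp, Linear.comp_smul, Category.id_comp,
        smul_smul, mul_assoc, inv_mul_cancel₀ hr2c, mul_one]
    · simp [CStarCategory.dag_smul]
  have h2 : ∑ k, r k ≤ T := by
    have hp := unitScalar_projection_le t (Zb ◁ ∑ k, dag (f k) ≫ f k) ?_ ?_
    · refine le_trans (le_of_eq ?_) hp
      have h3 : ∀ k, unitScalar (t ≫ Zb ◁ (dag (f k) ≫ f k) ≫ dag t) = r k := by
        intro k
        rw [← unitScalar_smul_id (C := C) (r k), ← hr1 k]
        congr 1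
        simp [g]
      simp only [whiskerLeft_sum, Preadditive.comp_sum, Preadditive.sum_comp, map_sum, h3]
      simp
    · rw [← MonoidalCategory.whiskerLeft_comp]
      congr 1
      simp only [Preadditive.comp_sum, Preadditive.sum_comp, Category.assoc]
      refine Finset.sum_congr rfl fun k _ => ?_
      rw [Finset.sum_eq_single k]
      · rw [← Category.assoc (f k), hf' k k, if_pos rfl, Category.id_comp]
      · intro l _ hl
        rw [← Category.assoc (f l), hf' l k, if_neg hl]
        simp
      · simp
    · simp [dag_sum]
  have h3 : (n : ℝ) ≤ S * T := by
    calc (n : ℝ) = ∑ k : Fin n, 1 := by simp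
      _ ≤ ∑ k, r k * S := Finset.sum_le_sum fun k _ => h1 k
      _ = S * ∑ k, r k := by rw [← Finset.sum_mul, mul_comm]
      _ ≤ S * T := mul_le_mul_of_nonneg_left h2 hS
  exact_mod_cast h3.trans (Nat.le_ceil _)

variable [IsRigid C]

/-- Frobenius reciprocity embeds the morphisms `X → Y` into those from the unit to `Y X̄`. -/
instance finiteDimensional_hom (X Y : C) : FiniteDimensional ℂ (X ⟶ Y) := by
  obtain ⟨Xb, s, t, h⟩ := IsRigid.exists_conjugate X
  obtain ⟨Zb, s', t', h'⟩ := IsRigid.exists_conjugate (Y ⊗ Xb)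
  have := finiteDimensional_unit_hom h'
  let φ : (X ⟶ Y) →ₗ[ℂ] (𝟙_ C ⟶ Y ⊗ Xb) :=
    { toFun := fun f => s ≫ f ▷ Xb
      map_add' := fun f g => by simp
      map_smul' := fun z f => by simp }
  refine FiniteDimensional.of_injective φ ((injective_iff_map_eq_zero φ).mpr fun f hf => ?_)
  have hf' : s ≫ f ▷ Xb = 0 := hf
  have h1 : cup s (X ⊗ 𝟙_ C) ≫ f ▷ (Xb ⊗ (X ⊗ 𝟙_ C)) = 0 := by
    calc _ = (λ_ _).inv ≫ (s ≫ f ▷ Xb) ▷ (X ⊗ 𝟙_ C) ≫ (α_ _ _ _).hom := by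
          simp only [cup]; monoidal
      _ = 0 := by rw [hf']; simp
  have h2 : f ▷ 𝟙_ C = 0 := by
    rw [← Category.id_comp (f ▷ 𝟙_ C), ← h.cup_left_cap, Category.assoc, whisker_exchange,
      ← Category.assoc, h1, Limits.zero_comp]
  have h3 : f = (ρ_ X).inv ≫ f ▷ 𝟙_ C ≫ (ρ_ Y).hom := by simp
  rw [h3, h2]
  simp

theorem isONB_onb (c : Irr C) (X : C) : IsONB c X (onb c X).2 := by
  have h : ∃ p : Σ n : ℕ, Fin n → (rep c ⟶ X), IsONB c X p.2 := by
    obtain ⟨n, e, h1, h2⟩ := exists_orthonormal_spanning (homCore c X)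
    exact ⟨⟨n, e⟩, h1, h2⟩
  rw [onb, dif_pos h]
  exact h.choose_spec

end FiniteDimensionality

/-! ### Decomposition into irreducible objects -/

section Decomposition

variable {C : Type u} [Category.{v} C] [CStarCategory C] [MonoidalCategory C]
  [CStarTensorCategory C] [IsRigid C]

theorem IsONB.eq_sum {c : Irr C} {X : C} {n : ℕ} {b : Fin n → (rep c ⟶ X)} (hb : IsONB c X b)
    (T : rep c ⟶ X) : T = ∑ k, homForm c X (b k) T • b k := by
  have hT : T ∈ Submodule.span ℂ (Set.range b) := hb.2 ▸ Submodule.mem_top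
  obtain ⟨z, rfl⟩ := (Submodule.mem_span_range_iff_exists_fun ℂ).mp hT
  refine Finset.sum_congr rfl fun k _ => ?_
  simp [map_sum, hb.1]

/-- The sum of a sesquilinear map over the diagonal of an orthonormal basis does not depend on the
basis. -/
theorem IsONB.sum_eq_sum {c : Irr C} {X : C} {n m : ℕ} {b : Fin n → (rep c ⟶ X)}
    {b' : Fin m → (rep c ⟶ X)} (hb : IsONB c X b) (hb' : IsONB c X b')
    {M : Type*} [AddCommGroup M] [Module ℂ M] (B : (rep c ⟶ X) →ₗ⋆[ℂ] (rep c ⟶ X) →ₗ[ℂ] M) :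
    ∑ k, B (b k) (b k) = ∑ l, B (b' l) (b' l) := by
  have h1 : ∀ k, B (b k) (b k) = ∑ l, homForm c X (b' l) (b k) • B (b k) (b' l) := by
    intro k
    calc B (b k) (b k) = B (b k) (∑ l, homForm c X (b' l) (b k) • b' l) := by
          rw [← hb'.eq_sum (b k)]
      _ = _ := by simp only [map_sum, map_smul]
  have h2 : ∀ l, B (b' l) (b' l) = ∑ k, homForm c X (b' l) (b k) • B (b k) (b' l) := by
    intro l
    have e := hb.eq_sum (b' l)
    calc B (b' l) (b' l) = B (∑ k, homForm c X (b k) (b' l) • b k) (b' l) := by rw [← e]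
      _ = _ := by
        rw [map_sum, LinearMap.sum_apply]
        refine Finset.sum_congr rfl fun k _ => ?_
        rw [LinearMap.map_smulₛₗ, LinearMap.smul_apply, homForm_conj_symm]
  simp only [h1, h2]
  exact Finset.sum_comm

/-- The projection of `X` onto its `c`-isotypic component. -/
def isotypic (c : Irr C) (X : C) : X ⟶ X :=
  (dim c : ℂ) • ∑ k, dag ((onb c X).2 k) ≫ (onb c X).2 k

theorem dag_isotypic (c : Irr C) (X : C) : dag (isotypic c X) = isotypic c X := by
  simp [isotypic, CStarCategory.dag_smul, dag_sum, -Complex.coe_smul]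

theorem comp_isotypic {c : Irr C} {X : C} (f : rep c ⟶ X) : f ≫ isotypic c X = f := by
  conv_rhs => rw [(isONB_onb c X).eq_sum f]
  simp only [isotypic, Linear.comp_smul, Preadditive.comp_sum, Finset.smul_sum]
  refine Finset.sum_congr rfl fun k _ => ?_
  rw [← Category.assoc, comp_dag_eq_homForm, Linear.smul_comp, Category.id_comp, smul_smul,
    mul_div_cancel₀ _ (dim_ne_zero c)]

theorem comp_isotypic_of_ne {c c' : Irr C} (h : c' ≠ c) {X : C} (f : rep c' ⟶ X) :
    f ≫ isotypic c X = 0 := by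
  simp only [isotypic, Linear.comp_smul, Preadditive.comp_sum]
  rw [Finset.sum_eq_zero, smul_zero]
  intro k _
  by_contra h0
  exact h (eq_of_hom_ne_zero (f ≫ dag ((onb c X).2 k)) fun h1 => h0 (by
    rw [← Category.assoc, h1, Limits.zero_comp]))

/-- Only finitely many irreducible objects appear in a given object, as their isotypic projections
are linearly independent endomorphisms. -/
theorem finite_components (X : C) : {c : Irr C | ∃ f : rep c ⟶ X, f ≠ 0}.Finite := by
  have hli : LinearIndependent ℂ
      fun c : {c : Irr C | ∃ f : rep c ⟶ X, f ≠ 0} => isotypic c.1 X := by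
    rw [linearIndependent_iff']
    intro s g hg c hc
    obtain ⟨f, hf⟩ := c.2
    have h1 := congrArg (fun T => f ≫ T) hg
    simp only [Preadditive.comp_sum, Linear.comp_smul, Limits.comp_zero] at h1
    rw [Finset.sum_eq_single c] at h1
    · rw [comp_isotypic] at h1
      exact (smul_eq_zero.mp h1).resolve_right hf
    · intro c' _ hc'
      rw [comp_isotypic_of_ne (fun h => hc' (Subtype.ext h.symm)), smul_zero]
    · exact fun h => absurd hc h
  have := hli.finite
  exact Set.toFinite _

/-- Every nonzero object has an irreducible subobject. The induction is on the dimension of the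
endomorphism algebra, which drops when a nontrivial projection is split. -/
theorem exists_hom_ne_zero (X : C) (hX : 𝟙 X ≠ 0) : ∃ (c : Irr C) (f : rep c ⟶ X), f ≠ 0 := by
  induction hn : Module.finrank ℂ (X ⟶ X) using Nat.strong_induction_on generalizing X with
  | _ n ih =>
    by_cases hirr : IsIrreducible X
    · obtain ⟨w, h1, h2⟩ := exists_unitary_irrOf hirr
      refine ⟨irrOf hirr, w, ?_⟩
      rintro rfl
      exact hX (by rw [← h2, Limits.comp_zero])
    · obtain ⟨p, hp1, hp2, hp3, hp4⟩ := exists_projection hX hirr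
      obtain ⟨Y, a, ha1, ha2⟩ := CStarTensorCategory.exists_subobject X p hp1 hp2
      let φ : (Y ⟶ Y) →ₗ[ℂ] (X ⟶ X) :=
        { toFun := fun T => dag a ≫ T ≫ a
          map_add' := fun f g => by simp
          map_smul' := fun z f => by simp }
      have hφ : Function.Injective φ := by
        refine (injective_iff_map_eq_zero φ).mpr fun T hT => ?_
        have h1 : a ≫ (dag a ≫ T ≫ a) ≫ dag a = 0 := by
          rw [show dag a ≫ T ≫ a = 0 from hT]; simp
        simpa [ha1, reassoc_of% ha1] using h1
      have hlt : Module.finrank ℂ (Y ⟶ Y) < n := by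
        rw [← hn, ← LinearMap.finrank_range_of_inj hφ]
        refine Submodule.finrank_lt fun h => ?_
        obtain ⟨T, hT⟩ := LinearMap.range_eq_top.mp h (𝟙 X)
        apply hp4
        calc p = p ≫ 𝟙 X := (Category.comp_id p).symm
          _ = p ≫ dag a ≫ T ≫ a := by rw [← hT]; rfl
          _ = dag a ≫ T ≫ a := by rw [← ha2, Category.assoc, reassoc_of% ha1]
          _ = 𝟙 X := hT
      obtain ⟨c, f, hf⟩ := ih _ hlt Y (fun h => hp3 (by
        rw [← ha2, ← Category.comp_id (dag a), h]; simp)) rfl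
      refine ⟨c, f ≫ a, fun h => hf ?_⟩
      rw [← Category.comp_id f, ← ha1, ← Category.assoc, h, Limits.zero_comp]

/-- Completeness: an object is the direct sum of its isotypic components. -/
theorem sum_isotypic (X : C) (s : Finset (Irr C))
    (hs : ∀ (c : Irr C) (f : rep c ⟶ X), f ≠ 0 → c ∈ s) : ∑ c ∈ s, isotypic c X = 𝟙 X := by
  classical
  set q := ∑ c ∈ s, isotypic c X with hq
  have hfq : ∀ (c : Irr C) (f : rep c ⟶ X), f ≫ q = f := by
    intro c f
    by_cases hf : f = 0
    · rw [hf, Limits.zero_comp]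
    rw [hq, Preadditive.comp_sum, Finset.sum_eq_single c, comp_isotypic]
    · exact fun c' _ hc' => comp_isotypic_of_ne hc'.symm f
    · exact fun h => absurd (hs c f hf) h
  have hqd : dag q = q := by simp [hq, dag_sum, dag_isotypic]
  have hqq : q ≫ q = q := by
    conv_lhs => enter [1]; rw [hq]
    simp only [isotypic, Preadditive.sum_comp, Linear.smul_comp, Category.assoc, hfq]
    rfl
  obtain ⟨Y, a, ha1, ha2⟩ := CStarTensorCategory.exists_subobject X (𝟙 X - q)
    (by simp [hqq]) (by rw [dag_sub, dag_id, hqd])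
  have ha3 : a ≫ q = 0 := by
    have h1 : a ≫ (𝟙 X - q) = a := by rw [← ha2, reassoc_of% ha1]
    rw [Preadditive.comp_sub, Category.comp_id, sub_eq_self] at h1
    exact h1
  have hY : 𝟙 Y = 0 := by
    by_contra h0
    obtain ⟨c, f, hf⟩ := exists_hom_ne_zero Y h0
    apply hf
    have h1 := hfq c (f ≫ a)
    rw [Category.assoc, ha3, Limits.comp_zero] at h1
    rw [← Category.comp_id f, ← ha1, ← Category.assoc, ← h1, Limits.zero_comp]
  have h2 : 𝟙 X - q = 0 := by
    rw [← ha2, ← Category.id_comp a, hY, Limits.zero_comp, Limits.comp_zero]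
  exact (sub_eq_zero.mp h2).symm

theorem onb_card_eq_mult (c : Irr C) (X : C) : (onb c X).1 = mult c X := by
  have hb := isONB_onb c X
  have hli : LinearIndependent ℂ (onb c X).2 := by
    rw [Fintype.linearIndependent_iff]
    intro g hg k
    have h1 := congrArg (homForm c X ((onb c X).2 k)) hg
    simpa [map_sum, hb.1] using h1
  have h2 := finrank_span_eq_card hli
  rw [hb.2, finrank_top, Fintype.card_fin] at h2
  exact h2.symm

end Decomposition

/-! ### The product of the tube algebra -/

section TubeAlgebra

variable {C : Type u} [Category.{v} C] [CStarCategory C] [MonoidalCategory C]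
  [CStarTensorCategory C] [IsRigid C]

/-- The finite set of irreducible components of an object. -/
def components (X : C) : Finset (Irr C) := (finite_components X).toFinset

theorem mem_components {X : C} {c : Irr C} {f : rep c ⟶ X} (hf : f ≠ 0) : c ∈ components X := by
  rw [components, Set.Finite.mem_toFinset]
  exact ⟨f, hf⟩

theorem onb_eq_zero {X : C} {c : Irr C} (h : ∀ f : rep c ⟶ X, f = 0) (k) : (onb c X).2 k = 0 := h _

open Classical in
/-- The inclusion of the summand `(i c, c j)` into the tube algebra. -/
def homog (i j c : Irr C) : (rep c ⊗ rep j ⟶ rep i ⊗ rep c) →ₗ[ℂ] Tube C :=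
  DirectSum.lof ℂ (Irr C × Irr C × Irr C) TubeHom (i, j, c)

/-- The `c`-component of the element of the tube algebra given by a morphism `X j → i X`. -/
def tubeTerm (i j c : Irr C) (X : C) :
    (X ⊗ rep j ⟶ rep i ⊗ X) →ₗ[ℂ] (rep c ⊗ rep j ⟶ rep i ⊗ rep c) where
  toFun V := (dim c : ℂ) • ∑ k, ((onb c X).2 k ▷ rep j) ≫ V ≫ (rep i ◁ dag ((onb c X).2 k))
  map_add' V W := by simp [Finset.sum_add_distrib, -Complex.coe_smul]
  map_smul' z V := by
    simp [← Finset.smul_sum, smul_smul, mul_comm, -Complex.coe_smul]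

theorem tubeTerm_apply (i j c : Irr C) (X : C) (V : X ⊗ rep j ⟶ rep i ⊗ X) :
    tubeTerm i j c X V =
      (dim c : ℂ) • ∑ k, ((onb c X).2 k ▷ rep j) ≫ V ≫ (rep i ◁ dag ((onb c X).2 k)) := rfl

theorem toTube_eq_sum (i j : Irr C) (X : C) (V : X ⊗ rep j ⟶ rep i ⊗ X) (s : Finset (Irr C))
    (hs : components X ⊆ s) : toTube i j X V = ∑ c ∈ s, homog i j c (tubeTerm i j c X V) := by
  refine finsum_eq_sum_of_support_subset _ fun c hc => hs ?_
  by_contra h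
  apply hc
  have h0 : ∀ f : rep c ⟶ X, f = 0 := fun f => by
    by_contra hf
    exact h (mem_components hf)
  simp [onb_eq_zero h0]

/-- `toTube` as a linear map. -/
def toTubeₗ (i j : Irr C) (X : C) : (X ⊗ rep j ⟶ rep i ⊗ X) →ₗ[ℂ] Tube C :=
  ∑ c ∈ components X, homog i j c ∘ₗ tubeTerm i j c X

theorem toTubeₗ_apply (i j : Irr C) (X : C) (V : X ⊗ rep j ⟶ rep i ⊗ X) :
    toTubeₗ i j X V = toTube i j X V := by
  rw [toTube_eq_sum i j X V _ subset_rfl, toTubeₗ, LinearMap.sum_apply]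
  rfl

theorem toTube_add (i j : Irr C) (X : C) (V W : X ⊗ rep j ⟶ rep i ⊗ X) :
    toTube i j X (V + W) = toTube i j X V + toTube i j X W := by
  simp only [← toTubeₗ_apply, map_add]

theorem toTube_smul (i j : Irr C) (X : C) (z : ℂ) (V : X ⊗ rep j ⟶ rep i ⊗ X) :
    toTube i j X (z • V) = z • toTube i j X V := by
  simp only [← toTubeₗ_apply, map_smul]

theorem toTube_sum (i j : Irr C) (X : C) {ι : Type*} (s : Finset ι)
    (V : ι → (X ⊗ rep j ⟶ rep i ⊗ X)) :
    toTube i j X (∑ k ∈ s, V k) = ∑ k ∈ s, toTube i j X (V k) := by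
  simp only [← toTubeₗ_apply, map_sum]

theorem toTube_zero (i j : Irr C) (X : C) : toTube i j X 0 = 0 := by
  rw [← toTubeₗ_apply, map_zero]

/-- The trace relation of the tube algebra: a morphism `f : X → Y` can be moved around the tube. -/
theorem toTube_cyclic (i j : Irr C) {X Y : C} (f : X ⟶ Y) (V : Y ⊗ rep j ⟶ rep i ⊗ X) :
    toTube i j X (f ▷ rep j ≫ V) = toTube i j Y (V ≫ rep i ◁ f) := by
  classical
  rw [toTube_eq_sum i j X _ (components X ∪ components Y) Finset.subset_union_left,
    toTube_eq_sum i j Y _ (components X ∪ components Y) Finset.subset_union_right]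
  refine Finset.sum_congr rfl fun c _ => ?_
  congr 1
  rw [tubeTerm_apply, tubeTerm_apply]
  congr 1
  set b := (onb c X).2
  set b' := (onb c Y).2
  have h1 : ∀ k, b k ≫ f = ∑ l, homForm c Y (b' l) (b k ≫ f) • b' l :=
    fun k => (isONB_onb c Y).eq_sum _
  have h2 : ∀ l, f ≫ dag (b' l) = ∑ k, homForm c Y (b' l) (b k ≫ f) • dag (b k) := by
    intro l
    have h3 := congrArg dag ((isONB_onb c X).eq_sum (b' l ≫ dag f))
    rw [dag_sum] at h3
    simp only [CStarCategory.dag_comp, CStarCategory.dag_dag, CStarCategory.dag_smul,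
      homForm_conj_symm] at h3
    rw [h3]
    refine Finset.sum_congr rfl fun k _ => ?_
    congr 1
    simp [homForm_apply, b]
  calc ∑ k, b k ▷ rep j ≫ (f ▷ rep j ≫ V) ≫ rep i ◁ dag (b k)
      = ∑ k, ∑ l, homForm c Y (b' l) (b k ≫ f) • (b' l ▷ rep j ≫ V ≫ rep i ◁ dag (b k)) := by
        refine Finset.sum_congr rfl fun k _ => ?_
        rw [Category.assoc, ← comp_whiskerRight_assoc, h1]
        simp only [sum_whiskerRight, MonoidalLinear.smul_whiskerRight, Preadditive.sum_comp,
          Linear.smul_comp]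
        rw [← h1]
    _ = ∑ l, ∑ k, homForm c Y (b' l) (b k ≫ f) • (b' l ▷ rep j ≫ V ≫ rep i ◁ dag (b k)) :=
        Finset.sum_comm
    _ = _ := by
        refine Finset.sum_congr rfl fun l _ => ?_
        rw [Category.assoc, ← MonoidalCategory.whiskerLeft_comp, h2]
        simp only [whiskerLeft_sum, MonoidalLinear.whiskerLeft_smul, Preadditive.comp_sum,
          Linear.comp_smul]

/-- For an irreducible object nothing is changed by the sum over its decomposition, as the factor
`d(c)` compensates the normalization of the orthonormal basis. -/
theorem toTube_rep (i j c : Irr C) (V : rep c ⊗ rep j ⟶ rep i ⊗ rep c) :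
    toTube i j (rep c) V = homog i j c V := by
  have hs : components (rep c) ⊆ {c} := by
    intro c' hc'
    rw [components, Set.Finite.mem_toFinset] at hc'
    obtain ⟨f, hf⟩ := hc'
    exact Finset.mem_singleton.mpr (eq_of_hom_ne_zero f hf)
  rw [toTube_eq_sum i j _ _ _ hs, Finset.sum_singleton, tubeTerm_apply]
  congr 1
  have h1 := comp_isotypic (𝟙 (rep c))
  choose z hz using fun k => (rep_irreducible c).2 ((onb c (rep c)).2 k)
  rw [Category.id_comp, isotypic] at h1
  simp only [hz, CStarCategory.dag_smul, dag_id, Linear.smul_comp, Linear.comp_smul,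
    Category.id_comp, smul_smul, MonoidalLinear.smul_whiskerRight, id_whiskerRight,
    MonoidalLinear.whiskerLeft_smul, MonoidalCategory.whiskerLeft_id, Category.comp_id,
    ← Finset.sum_smul] at h1 ⊢
  have h2 := smul_id_injective (rep_irreducible c) (h1.trans (one_smul ℂ _).symm)
  have h3 : (dim c : ℂ) * ∑ k, starRingEnd ℂ (z k) * z k = 1 := by
    rw [← h2]
    congr 1
    exact Finset.sum_congr rfl fun k _ => mul_comm _ _
  rw [h3, one_smul]

/-- The morphism `(V ⊗ 1)(1 ⊗ W)` whose class is the product of the classes of `V` and `W`. -/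
def tubeComp {I J K X Y : C} (V : X ⊗ J ⟶ I ⊗ X) (W : Y ⊗ K ⟶ J ⊗ Y) :
    (X ⊗ Y) ⊗ K ⟶ I ⊗ (X ⊗ Y) :=
  (α_ X Y K).hom ≫ X ◁ W ≫ (α_ X J Y).inv ≫ V ▷ Y ≫ (α_ I X Y).hom

theorem tubeMulHom_homog (i j k c c' : Irr C) (V : rep c ⊗ rep j ⟶ rep i ⊗ rep c)
    (W : rep c' ⊗ rep k ⟶ rep j ⊗ rep c') :
    tubeMulHom (i, j, c) (j, k, c') V W = toTube i k (rep c ⊗ rep c') (tubeComp V W) := by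
  rw [tubeMulHom, dif_pos rfl]
  congr 1
  simp only [tubeComp, eqToHom_refl]
  monoidal

theorem tubeMulHom_add_left (p q : Irr C × Irr C × Irr C) (V V' : TubeHom p) (W : TubeHom q) :
    tubeMulHom p q (V + V') W = tubeMulHom p q V W + tubeMulHom p q V' W := by
  unfold tubeMulHom
  split_ifs
  · rw [← toTube_add]
    simp [monoidalComp]
  · simp

theorem tubeMulHom_add_right (p q : Irr C × Irr C × Irr C) (V : TubeHom p) (W W' : TubeHom q) :
    tubeMulHom p q V (W + W') = tubeMulHom p q V W + tubeMulHom p q V W' := by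
  unfold tubeMulHom
  split_ifs
  · rw [← toTube_add]
    simp [monoidalComp]
  · simp

theorem tubeMulHom_zero_left (p q : Irr C × Irr C × Irr C) (W : TubeHom q) :
    tubeMulHom p q 0 W = 0 := by
  have := tubeMulHom_add_left p q 0 0 W
  simpa using this

theorem tubeMulHom_zero_right (p q : Irr C × Irr C × Irr C) (V : TubeHom p) :
    tubeMulHom p q V 0 = 0 := by
  have := tubeMulHom_add_right p q V 0 0
  simpa using this

theorem tubeMul_add_left (x x' y : Tube C) :
    tubeMul (x + x') y = tubeMul x y + tubeMul x' y := by
  classical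
  refine DFinsupp.sum_add_index (fun p => ?_) fun p V V' => ?_
  · simp only [tubeMulHom_zero_left]
    exact Finset.sum_const_zero
  · simp only [tubeMulHom_add_left]
    exact Finset.sum_add_distrib

theorem tubeMul_add_right (x y y' : Tube C) :
    tubeMul x (y + y') = tubeMul x y + tubeMul x y' := by
  classical
  unfold tubeMul
  rw [← DFinsupp.sum_add]
  congr 1
  ext p V : 2
  exact DFinsupp.sum_add_index (fun q => tubeMulHom_zero_right p q V)
    fun q W W' => tubeMulHom_add_right p q V W W'

theorem tubeMul_homog (i j k c c' : Irr C) (V : rep c ⊗ rep j ⟶ rep i ⊗ rep c)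
    (W : rep c' ⊗ rep k ⟶ rep j ⊗ rep c') :
    tubeMul (homog i j c V) (homog j k c' W) =
      toTube i k (rep c ⊗ rep c') (tubeComp V W) := by
  classical
  rw [← tubeMulHom_homog]
  unfold tubeMul
  refine (DFinsupp.sum_single_index ?_).trans (DFinsupp.sum_single_index ?_)
  · simp only [tubeMulHom_zero_left]
    exact Finset.sum_const_zero
  · exact tubeMulHom_zero_right _ _ _

theorem tubeMul_sum_left {ι : Type*} (s : Finset ι) (x : ι → Tube C) (y : Tube C) :
    tubeMul (∑ k ∈ s, x k) y = ∑ k ∈ s, tubeMul (x k) y :=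
  map_sum (AddMonoidHom.mk' (fun x => tubeMul x y) fun _ _ => tubeMul_add_left _ _ y) x s

theorem tubeMul_sum_right {ι : Type*} (s : Finset ι) (x : Tube C) (y : ι → Tube C) :
    tubeMul x (∑ k ∈ s, y k) = ∑ k ∈ s, tubeMul x (y k) :=
  map_sum (AddMonoidHom.mk' (fun y => tubeMul x y) fun _ _ => tubeMul_add_right x _ _) y s

omit [CStarCategory C] [CStarTensorCategory C] [IsRigid C] in
theorem tubeComp_conj {I J K X X' X'' Y Y' Y'' : C} (V : X ⊗ J ⟶ I ⊗ X) (W : Y ⊗ K ⟶ J ⊗ Y)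
    (f : X' ⟶ X) (f' : X ⟶ X'') (g : Y' ⟶ Y) (g' : Y ⟶ Y'') :
    (α_ X' Y' K).hom ≫ X' ◁ (g ▷ K ≫ W ≫ J ◁ g') ≫ (α_ X' J Y'').inv ≫
        (f ▷ J ≫ V ≫ I ◁ f') ▷ Y'' ≫ (α_ I X'' Y'').hom =
      (f ▷ Y' ≫ X ◁ g) ▷ K ≫ tubeComp V W ≫ I ◁ (X ◁ g' ≫ f' ▷ Y'') := by
  calc _ = (α_ X' Y' K).hom ≫ (X' ◁ (g ▷ K ≫ W ≫ J ◁ g') ≫ f ▷ (J ⊗ Y'')) ≫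
        (α_ X J Y'').inv ≫ (V ≫ I ◁ f') ▷ Y'' ≫ (α_ I X'' Y'').hom := by monoidal
    _ = (α_ X' Y' K).hom ≫ f ▷ (Y' ⊗ K) ≫ X ◁ (g ▷ K ≫ W) ≫ (α_ X J Y).inv ≫
        ((X ⊗ J) ◁ g' ≫ V ▷ Y'') ≫ (I ◁ f') ▷ Y'' ≫ (α_ I X'' Y'').hom := by
        rw [whisker_exchange]; monoidal
    _ = _ := by rw [whisker_exchange, tubeComp]; monoidal

/-- The product of two components, by the trace relation: it is the class of `(V ⊗ 1)(1 ⊗ W)` cut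
down by the isotypic projections. Summing these over all components gives `tubeMul_toTube`. -/
theorem tubeComp_tubeTerm (i j k c c' : Irr C) {X Y : C} (V : X ⊗ rep j ⟶ rep i ⊗ X)
    (W : Y ⊗ rep k ⟶ rep j ⊗ Y) :
    toTube i k (rep c ⊗ rep c') (tubeComp (tubeTerm i j c X V) (tubeTerm j k c' Y W)) =
      toTube i k (X ⊗ Y) (tubeComp V W ≫ rep i ◁ (isotypic c X ▷ Y ≫ X ◁ isotypic c' Y)) := by
  set b := (onb c X).2
  set b' := (onb c' Y).2
  have h1 : tubeComp (tubeTerm i j c X V) (tubeTerm j k c' Y W) =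
      (dim c : ℂ) • (dim c' : ℂ) • ∑ m, ∑ l, (b m ▷ rep c' ≫ X ◁ b' l) ▷ rep k ≫
        tubeComp V W ≫ rep i ◁ (X ◁ dag (b' l) ≫ dag (b m) ▷ rep c') := by
    simp only [← tubeComp_conj]
    rw [tubeComp, tubeTerm_apply, tubeTerm_apply]
    simp only [MonoidalLinear.smul_whiskerRight, MonoidalLinear.whiskerLeft_smul, sum_whiskerRight,
      whiskerLeft_sum, Preadditive.sum_comp, Preadditive.comp_sum, Linear.comp_smul,
      Linear.smul_comp, Finset.smul_sum, b, b']
  have h2 : ∀ m l, toTube i k (rep c ⊗ rep c') ((b m ▷ rep c' ≫ X ◁ b' l) ▷ rep k ≫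
        tubeComp V W ≫ rep i ◁ (X ◁ dag (b' l) ≫ dag (b m) ▷ rep c')) =
      toTube i k (X ⊗ Y) (tubeComp V W ≫
        rep i ◁ ((dag (b m) ≫ b m) ▷ Y ≫ X ◁ (dag (b' l) ≫ b' l))) := by
    intro m l
    rw [toTube_cyclic, Category.assoc, ← MonoidalCategory.whiskerLeft_comp]
    congr 3
    simp only [comp_whiskerRight, MonoidalCategory.whiskerLeft_comp, Category.assoc]
    rw [← whisker_exchange_assoc, ← whisker_exchange_assoc]
  rw [h1, toTube_smul, toTube_smul, toTube_sum]
  simp only [toTube_sum, h2]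
  simp only [← toTube_sum, ← toTube_smul]
  congr 1
  simp only [isotypic, MonoidalLinear.smul_whiskerRight, MonoidalLinear.whiskerLeft_smul,
    sum_whiskerRight, whiskerLeft_sum, Preadditive.sum_comp, Preadditive.comp_sum, Linear.comp_smul,
    Linear.smul_comp, b, b', Finset.smul_sum]
  rw [Finset.sum_comm]
  simp only [smul_comm (dim c' : ℂ) (dim c : ℂ)]

/-- The product of the tube algebra in terms of arbitrary objects. -/
theorem tubeMul_toTube (i j k : Irr C) {X Y : C} (V : X ⊗ rep j ⟶ rep i ⊗ X)
    (W : Y ⊗ rep k ⟶ rep j ⊗ Y) :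
    tubeMul (toTube i j X V) (toTube j k Y W) = toTube i k (X ⊗ Y) (tubeComp V W) := by
  rw [toTube_eq_sum i j X V _ subset_rfl, toTube_eq_sum j k Y W _ subset_rfl, tubeMul_sum_left]
  simp only [tubeMul_sum_right, tubeMul_homog, tubeComp_tubeTerm]
  simp only [← toTube_sum]
  congr 1
  simp only [← Preadditive.comp_sum, ← whiskerLeft_sum, ← sum_whiskerRight, ← Preadditive.sum_comp]
  rw [sum_isotypic X _ fun c f hf => mem_components hf,
    sum_isotypic Y _ fun c f hf => mem_components hf]
  simp

end TubeAlgebra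

/-! ### The corner of the unit object in the tube algebra -/

section Corner

variable {C : Type u} [Category.{v} C] [CStarCategory C] [MonoidalCategory C]
  [CStarTensorCategory C]

variable (C) in
theorem exists_unitUnitary : ∃ w : rep (unitIrr C) ⟶ 𝟙_ C, w ≫ dag w = 𝟙 _ ∧ dag w ≫ w = 𝟙 _ ∧
    ∃ r : ℂ, r ≠ 0 ∧ (unitRepIso C).hom = r • w ∧ (unitRepIso C).inv = r⁻¹ • dag w := by
  obtain ⟨r, w, h0, h1, h2, h3⟩ := exists_unitary_of_ne_zero (rep_irreducible (unitIrr C))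
    CStarTensorCategory.unit_irreducible (unitRepIso C).hom fun h =>
      (rep_irreducible (unitIrr C)).1 (by rw [← (unitRepIso C).hom_inv_id, h, Limits.zero_comp])
  have hr : (r : ℂ) ≠ 0 := by exact_mod_cast h0.ne'
  refine ⟨w, h1, h2, r, hr, h3, ?_⟩
  calc (unitRepIso C).inv = ((r : ℂ)⁻¹ • dag w) ≫ (unitRepIso C).hom ≫ (unitRepIso C).inv := by
        rw [h3, Linear.smul_comp, Linear.smul_comp, Linear.comp_smul, smul_smul,
          inv_mul_cancel₀ hr, one_smul, reassoc_of% h2]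
    _ = (r : ℂ)⁻¹ • dag w := by rw [Iso.hom_inv_id, Category.comp_id]

variable (C) in
/-- A unitary from the representative of the unit class to the unit object, proportional to
`unitRepIso`. Unlike that isomorphism it is compatible with the involution. -/
def unitUnitary : rep (unitIrr C) ⟶ 𝟙_ C := (exists_unitUnitary C).choose

@[simp]
theorem unitUnitary_comp_dag : unitUnitary C ≫ dag (unitUnitary C) = 𝟙 _ :=
  (exists_unitUnitary C).choose_spec.1

@[simp]
theorem dag_comp_unitUnitary : dag (unitUnitary C) ≫ unitUnitary C = 𝟙 _ :=
  (exists_unitUnitary C).choose_spec.2.1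

variable (C) in
theorem unitRepIso_eq : ∃ r : ℂ, r ≠ 0 ∧ (unitRepIso C).hom = r • unitUnitary C ∧
    (unitRepIso C).inv = r⁻¹ • dag (unitUnitary C) := (exists_unitUnitary C).choose_spec.2.2

/-- The morphism `X ε → i X` given by `V : X → i X`. -/
def fromUnit {I X : C} (V : X ⟶ I ⊗ X) : X ⊗ rep (unitIrr C) ⟶ I ⊗ X :=
  X ◁ unitUnitary C ≫ (ρ_ X).hom ≫ V

/-- The morphism `X i → ε X` given by `V : X i → X`. -/
def toUnit {I X : C} (V : X ⊗ I ⟶ X) : X ⊗ I ⟶ rep (unitIrr C) ⊗ X :=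
  V ≫ (λ_ X).inv ≫ dag (unitUnitary C) ▷ X

/-- The morphism `X ε → ε X` given by `T : X → X`. -/
def corner {X : C} (T : X ⟶ X) : X ⊗ rep (unitIrr C) ⟶ rep (unitIrr C) ⊗ X :=
  X ◁ unitUnitary C ≫ (ρ_ X).hom ≫ T ≫ (λ_ X).inv ≫ dag (unitUnitary C) ▷ X

theorem tubeComp_toUnit_fromUnit {I X Y : C} (V : X ⊗ I ⟶ X) (W : Y ⟶ I ⊗ Y) :
    tubeComp (toUnit V) (fromUnit W) = corner (X ◁ W ≫ (α_ X I Y).inv ≫ V ▷ Y) := by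
  simp only [tubeComp, toUnit, fromUnit, corner]; monoidal

theorem tubeComp_corner {X Y : C} (T : X ⟶ X) (U : Y ⟶ Y) :
    tubeComp (corner T) (corner U) = corner (X ◁ U ≫ T ▷ Y) := by
  calc _ = (α_ X Y _).hom ≫ X ◁ (Y ◁ unitUnitary C ≫ (ρ_ Y).hom ≫ U ≫ (λ_ Y).inv ≫
        (dag (unitUnitary C) ≫ unitUnitary C) ▷ Y) ≫ (α_ _ _ _).inv ≫
        ((ρ_ X).hom ≫ T ≫ (λ_ X).inv ≫ dag (unitUnitary C) ▷ X) ▷ Y ≫ (α_ _ _ _).hom := by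
        simp only [tubeComp, corner]; monoidal
    _ = _ := by
        rw [dag_comp_unitUnitary]
        simp only [corner]; monoidal

variable [IsRigid C]

theorem tubeOne_eq (a : Irr C) : tubeOne a = homog _ _ a (corner (𝟙 (rep a))) := by
  obtain ⟨r, hr, h1, h2⟩ := unitRepIso_eq C
  rw [tubeOne]
  change homog _ _ a _ = _
  congr 1
  rw [h1, h2]
  simp only [MonoidalLinear.smul_whiskerRight, MonoidalLinear.whiskerLeft_smul, Linear.smul_comp,
    Linear.comp_smul, smul_smul, inv_mul_cancel₀ hr, one_smul]
  simp [corner]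

theorem tubeProj_unit_eq : tubeProj (unitIrr C) = toTube _ _ (𝟙_ C) (corner (𝟙 (𝟙_ C))) := by
  rw [tubeProj]
  congr 1
  calc _ = (λ_ _).hom ≫ (unitUnitary C ≫ dag (unitUnitary C)) ≫ (ρ_ _).inv := by simp
    _ = _ := by simp only [corner]; monoidal

theorem toTube_corner_cyclic {X Y : C} (f : X ⟶ Y) (T : Y ⟶ X) :
    toTube _ _ X (corner (f ≫ T)) = toTube _ _ Y (corner (T ≫ f)) := by
  have h := toTube_cyclic (unitIrr C) (unitIrr C) f
    (Y ◁ unitUnitary C ≫ (ρ_ Y).hom ≫ T ≫ (λ_ X).inv ≫ dag (unitUnitary C) ▷ X)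
  convert h using 2
  · rw [corner, ← whisker_exchange_assoc]
    simp
  · simp only [corner, Category.assoc, ← whisker_exchange]
    simp

theorem tubeStar_homog (i j a : Irr C) (V : rep a ⊗ rep j ⟶ rep i ⊗ rep a) :
    tubeStar (homog i j a V) = tubeStarHom (i, j, a) V := by
  classical
  refine DFinsupp.sum_single_index ?_
  simp only [tubeStarHom, dag_zero]
  rw [← toTube_zero]
  congr 1
  simp [monoidalComp]

theorem tubeStar_fromUnit (i a : Irr C) (V : rep a ⟶ rep i ⊗ rep a) :
    tubeStar (homog i (unitIrr C) a (fromUnit V)) =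
      toTube (unitIrr C) i (conj a) (toUnit (dag (tilde i a V))) := by
  rw [tubeStar_homog, tubeStarHom]
  congr 1
  have h1 : dag (tilde i a V) = 𝟙 _ ⊗≫ (conj a ⊗ rep i) ◁ (std a).s ⊗≫
      conj a ◁ dag V ▷ conj a ⊗≫ dag (std a).t ▷ conj a ⊗≫ 𝟙 _ := by
    simp only [tilde, LinearMap.coe_mk, AddHom.coe_mk, monoidalComp, CStarCategory.dag_comp]
    simp
  rw [toUnit, h1]
  simp only [fromUnit, CStarCategory.dag_comp, CStarTensorCategory.dag_whiskerLeft,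
    CStarTensorCategory.dag_rightUnitor]
  calc _ = 𝟙 _ ⊗≫ (conj a ⊗ rep i) ◁ (std a).s ⊗≫ conj a ◁ dag V ▷ conj a ⊗≫
        ((conj a ⊗ rep a) ◁ (dag (unitUnitary C) ▷ conj a) ≫
          dag (std a).t ▷ (rep (unitIrr C) ⊗ conj a)) ⊗≫ 𝟙 _ := by monoidal
    _ = _ := by rw [whisker_exchange]; monoidal

end Corner

/-! ### Operators on a Hilbert module -/

section Modules

variable {C : Type u} [Category.{v} C] [CStarCategory C] [MonoidalCategory C]
  [CStarTensorCategory C] [IsRigid C]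
variable {H : Type w} [NormedAddCommGroup H] [InnerProductSpace ℂ H] (M : HilbertModule C H)

/-- The operator on the corner `H · p_ε` of the unit object given by an endomorphism of `X`. -/
def cornerOp (X : C) : (X ⟶ X) →ₗ[ℂ] (H →L[ℂ] H) where
  toFun T := M.act (toTube _ _ X (corner T))
  map_add' T U := by
    rw [← map_add, ← toTube_add]
    simp [corner]
  map_smul' z T := by
    rw [RingHom.id_apply, ← map_smul, ← toTube_smul]
    simp [corner]

/-- The operator `H · p_i → H · p_ε` given by `V : X → i X`. -/
def fromUnitOp (i : Irr C) (X : C) : (X ⟶ rep i ⊗ X) →ₗ[ℂ] (H →L[ℂ] H) where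
  toFun V := M.act (toTube _ _ X (fromUnit V))
  map_add' T U := by
    rw [← map_add, ← toTube_add]
    simp [fromUnit]
  map_smul' z T := by
    rw [RingHom.id_apply, ← map_smul, ← toTube_smul]
    simp [fromUnit]

/-- The operator `H · p_ε → H · p_i` given by `V : a → i a`, the adjoint of `fromUnitOp`
(see `inner_fromUnitOp`). It is conjugate-linear in `V`. -/
def toUnitOp (i : Irr C) (a : Irr C) : (rep a ⟶ rep i ⊗ rep a) →ₗ⋆[ℂ] (H →L[ℂ] H) where
  toFun V := M.act (toTube _ _ (conj a) (toUnit (dag (tilde i a V))))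
  map_add' T U := by
    rw [← map_add, ← toTube_add, map_add, CStarCategory.dag_add]
    simp [toUnit]
  map_smul' z T := by
    rw [← map_smul, ← toTube_smul, map_smul, CStarCategory.dag_smul]
    simp [toUnit]

/-- The endomorphism of `ā b` obtained by contracting `V : a → i a` and `W : b → i b` along `i`. -/
def contract (i a b : Irr C) (V : rep a ⟶ rep i ⊗ rep a) (W : rep b ⟶ rep i ⊗ rep b) :
    conj a ⊗ rep b ⟶ conj a ⊗ rep b :=
  conj a ◁ W ≫ (α_ _ _ _).inv ≫ dag (tilde i a V) ▷ rep b

theorem fromUnitOp_toUnitOp (i a b : Irr C) (V : rep a ⟶ rep i ⊗ rep a)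
    (W : rep b ⟶ rep i ⊗ rep b) (ξ : H) :
    fromUnitOp M i (rep b) W (toUnitOp M i a V ξ) = cornerOp M _ (contract i a b V W) ξ := by
  change M.act _ (M.act _ ξ) = M.act _ ξ
  rw [← M.act_mul, tubeMul_toTube, tubeComp_toUnit_fromUnit]
  rfl

theorem inner_fromUnitOp (i a : Irr C) (V : rep a ⟶ rep i ⊗ rep a) (ξ η : H) :
    inner ℂ (fromUnitOp M i (rep a) V ξ) η = inner ℂ ξ (toUnitOp M i a V η) := by
  change inner ℂ (M.act _ ξ) η = inner ℂ ξ (M.act _ η)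
  rw [toTube_rep, M.act_star, tubeStar_fromUnit]

theorem cornerOp_cyclic {X Y : C} (f : X ⟶ Y) (T : Y ⟶ X) :
    cornerOp M X (f ≫ T) = cornerOp M Y (T ≫ f) := congrArg M.act (toTube_corner_cyclic f T)

theorem cornerOp_cornerOp {X Y : C} (T : X ⟶ X) (U : Y ⟶ Y) (ξ : H) :
    cornerOp M Y U (cornerOp M X T ξ) = cornerOp M (X ⊗ Y) (X ◁ U ≫ T ▷ Y) ξ := by
  change M.act _ (M.act _ ξ) = M.act _ ξ
  rw [← M.act_mul, tubeMul_toTube, tubeComp_corner]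

theorem cornerOp_id_eq_of_iso {X Y : C} (e : X ≅ Y) : cornerOp M X (𝟙 X) = cornerOp M Y (𝟙 Y) := by
  rw [← e.hom_inv_id, cornerOp_cyclic, e.inv_hom_id]

theorem act_tubeOne (a : Irr C) : M.act (tubeOne a) = cornerOp M (rep a) (𝟙 _) := by
  rw [tubeOne_eq, ← toTube_rep]
  rfl

theorem act_tubeProj_unit : M.act (tubeProj (unitIrr C)) = cornerOp M (𝟙_ C) (𝟙 _) := by
  rw [tubeProj_unit_eq]
  rfl

theorem cornerOp_tubeProj {X : C} (T : X ⟶ X) (ξ : H) :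
    cornerOp M X T (M.act (tubeProj (unitIrr C)) ξ) = cornerOp M X T ξ := by
  rw [act_tubeProj_unit, cornerOp_cornerOp]
  have h : 𝟙_ C ◁ T ≫ 𝟙 (𝟙_ C) ▷ X = (λ_ X).hom ≫ T ≫ (λ_ X).inv := by simp
  rw [h, cornerOp_cyclic, Category.assoc, Iso.inv_hom_id, Category.comp_id]

theorem tubeProj_cornerOp {X : C} (T : X ⟶ X) (ξ : H) :
    M.act (tubeProj (unitIrr C)) (cornerOp M X T ξ) = cornerOp M X T ξ := by
  rw [act_tubeProj_unit, cornerOp_cornerOp]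
  have h : X ◁ 𝟙 (𝟙_ C) ≫ T ▷ 𝟙_ C = (ρ_ X).hom ≫ T ≫ (ρ_ X).inv := by simp
  rw [h, cornerOp_cyclic, Category.assoc, Iso.inv_hom_id, Category.comp_id]

end Modules

/-! ### Frobenius reciprocity and contractions -/

section Frobenius

variable {C : Type u} [Category.{v} C] [CStarCategory C] [MonoidalCategory C]
  [CStarTensorCategory C]

/-- The morphism `f ⊗ 1 : X U → Y (Z U)` given by `f : X → Y Z`. -/
def split {X Y Z : C} (f : X ⟶ Y ⊗ Z) (U : C) : X ⊗ U ⟶ Y ⊗ (Z ⊗ U) :=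
  f ▷ U ≫ (α_ Y Z U).hom

variable {X Y Z : C} (f : X ⟶ Y ⊗ Z)

theorem split_naturality {U V : C} (g : U ⟶ V) :
    X ◁ g ≫ split f V = split f U ≫ Y ◁ Z ◁ g := by
  simp only [split, whisker_exchange_assoc]
  simp

theorem split_naturality_assoc {U V W : C} (g : U ⟶ V) (h : Y ⊗ (Z ⊗ V) ⟶ W) :
    X ◁ g ≫ split f V ≫ h = split f U ≫ Y ◁ Z ◁ g ≫ h := by
  rw [← Category.assoc, split_naturality, Category.assoc]

theorem dag_split_naturality {U V : C} (g : U ⟶ V) :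
    Y ◁ Z ◁ g ≫ dag (split f V) = dag (split f U) ≫ X ◁ g := by
  have := congrArg dag (split_naturality f (dag g))
  simpa using this.symm

theorem dag_split_naturality_assoc {U V W : C} (g : U ⟶ V) (h : X ⊗ V ⟶ W) :
    Y ◁ Z ◁ g ≫ dag (split f V) ≫ h = dag (split f U) ≫ X ◁ g ≫ h := by
  rw [← Category.assoc, dag_split_naturality, Category.assoc]

theorem split_injective {f g : X ⟶ Y ⊗ Z} (h : split f (𝟙_ C) = split g (𝟙_ C)) : f = g := by
  rw [split, split, cancel_mono] at h
  exact (MonoidalCategory.whiskerRight_iff f g).mp h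

theorem split_comp_dag_split (f g : X ⟶ Y ⊗ Z) (U : C) :
    split f U ≫ dag (split g U) = (f ≫ dag g) ▷ U := by
  simp [split]

theorem dag_split_comp_split (f g : X ⟶ Y ⊗ Z) (U : C) :
    dag (split f U) ≫ split g U = nestMap (dag f ≫ g) U := by
  simp [split, nestMap]

theorem nestMap_comp (f g : Y ⊗ Z ⟶ Y ⊗ Z) (U : C) :
    nestMap (f ≫ g) U = nestMap f U ≫ nestMap g U := by
  simp [nestMap]

theorem nestMap_injective {f g : Y ⊗ Z ⟶ Y ⊗ Z} (h : nestMap f (𝟙_ C) = nestMap g (𝟙_ C)) :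
    f = g := by
  rw [nestMap, nestMap, cancel_epi, cancel_mono] at h
  exact (MonoidalCategory.whiskerRight_iff f g).mp h

/-- `nestMap` as a linear map. -/
def nestMapₗ (Y Z U : C) : (Y ⊗ Z ⟶ Y ⊗ Z) →ₗ[ℂ] (Y ⊗ (Z ⊗ U) ⟶ Y ⊗ (Z ⊗ U)) where
  toFun T := nestMap T U
  map_add' T T' := by simp [nestMap]
  map_smul' z T := by simp [nestMap]

theorem cup_comp_cap_eq_nestMap (t : 𝟙_ C ⟶ Y ⊗ Z) (U : C) :
    cap t U ≫ cup t U = nestMap (dag t ≫ t) U := by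
  simp [cap, cup, nestMap]

variable [IsRigid C]

theorem split_tilde (i a : Irr C) (V : rep a ⟶ rep i ⊗ rep a) (U : C) :
    split (tilde i a V) U = cup (std a).t (conj a ⊗ U) ≫ conj a ◁ split V (conj a ⊗ U) ≫
      conj a ◁ rep i ◁ cap (std a).s U := by
  simp only [split, cup, cap, tilde, LinearMap.coe_mk, AddHom.coe_mk]; monoidal

theorem dag_split_tilde (i a : Irr C) (V : rep a ⟶ rep i ⊗ rep a) (U : C) :
    dag (split (tilde i a V) U) = conj a ◁ rep i ◁ cup (std a).s U ≫
      conj a ◁ dag (split V (conj a ⊗ U)) ≫ cap (std a).t (conj a ⊗ U) := by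
  rw [split_tilde]
  simp

theorem nestMap_contract (i a b : Irr C) (V : rep a ⟶ rep i ⊗ rep a)
    (W : rep b ⟶ rep i ⊗ rep b) (U : C) :
    nestMap (contract i a b V W) U =
      conj a ◁ split W U ≫ dag (split (tilde i a V) (rep b ⊗ U)) := by
  simp only [nestMap, contract, split, CStarCategory.dag_comp, CStarTensorCategory.dag_whiskerRight,
    CStarTensorCategory.dag_associator]
  monoidal

/-- The morphism `b → i b` obtained from `Q : i → b b̄` by Frobenius reciprocity. -/
def frobenius (i b : Irr C) : (rep i ⟶ rep b ⊗ conj b) →ₗ⋆[ℂ] (rep b ⟶ rep i ⊗ rep b) where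
  toFun Q := (ρ_ _).inv ≫ rep b ◁ (std b).t ≫ (α_ _ _ _).inv ≫ dag Q ▷ rep b
  map_add' Q R := by simp [CStarCategory.dag_add]
  map_smul' z Q := by simp [CStarCategory.dag_smul]

theorem split_frobenius (i b : Irr C) (Q : rep i ⟶ rep b ⊗ conj b) (U : C) :
    split (frobenius i b Q) U = rep b ◁ cup (std b).t U ≫ dag (split Q (rep b ⊗ U)) := by
  simp only [split, frobenius, cup, LinearMap.coe_mk, AddHom.coe_mk, CStarCategory.dag_comp,
    CStarTensorCategory.dag_whiskerRight, CStarTensorCategory.dag_associator]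
  monoidal

theorem exists_frobenius_eq (i b : Irr C) (V : rep b ⟶ rep i ⊗ rep b) :
    ∃ Q, frobenius i b Q = V := by
  refine ⟨dag (V ▷ conj b ≫ (α_ _ _ _).hom ≫ rep i ◁ dag (std b).s ≫ (ρ_ _).hom), ?_⟩
  have hQ : ∀ U, dag (split (dag (V ▷ conj b ≫ (α_ _ _ _).hom ≫ rep i ◁ dag (std b).s ≫
      (ρ_ _).hom)) U) = split V (conj b ⊗ U) ≫ rep i ◁ cap (std b).s U := by
    intro U
    simp only [split, cap, CStarCategory.dag_comp, CStarTensorCategory.dag_whiskerRight,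
      CStarTensorCategory.dag_associator, CStarCategory.dag_dag]
    simp only [dag_associator_inv]
    monoidal
  apply split_injective
  rw [split_frobenius, hQ, split_naturality_assoc, ← MonoidalCategory.whiskerLeft_comp,
    (std b).conjugateEquations.left_cup_cap, MonoidalCategory.whiskerLeft_id, Category.comp_id]

/-- Frobenius reciprocity is anti-unitary. -/
theorem homForm_frobenius (i b : Irr C) (Q R : rep i ⟶ rep b ⊗ conj b) :
    homForm b _ (frobenius i b Q) (frobenius i b R) = homForm i _ R Q := by
  have hb := (rep_irreducible b).conj (std b).conjugateEquations
  rw [homForm_apply, homForm_apply,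
    ← ((std b).prod (rep_irreducible b) hb ((std b).swap (rep_irreducible b))).tr_comp i Q (dag R),
    StandardSolution.tr_prod]
  apply smul_id_injective (CStarTensorCategory.unit_irreducible (C := C))
  rw [mixedTrace, smul_unitScalar]
  refine ((std b).left_tr (frobenius i b R ≫ dag (frobenius i b Q)) (𝟙_ C)).symm.trans ?_
  rw [← split_comp_dag_split, split_frobenius, split_frobenius]
  change _ = cup (std b).t (𝟙_ C) ≫ conj b ◁ (rep b ◁ cup (std b).t (𝟙_ C) ≫
    nestMap (dag R ≫ Q) _ ≫ rep b ◁ cap (std b).t (𝟙_ C)) ≫ cap (std b).t (𝟙_ C)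
  rw [← dag_split_comp_split]
  simp

theorem isONB_frobenius {i b : Irr C} {n : ℕ} {Q : Fin n → (rep i ⟶ rep b ⊗ conj b)}
    (hQ : IsONB i _ Q) : IsONB b _ fun k => frobenius i b (Q k) := by
  refine ⟨fun k l => ?_, ?_⟩
  · rw [homForm_frobenius, hQ.1]
    exact if_congr eq_comm rfl rfl
  · refine Submodule.eq_top_iff'.mpr fun V => ?_
    obtain ⟨R, rfl⟩ := exists_frobenius_eq i b V
    rw [hQ.eq_sum R, map_sum]
    refine Submodule.sum_mem _ fun k _ => ?_
    rw [LinearMap.map_smulₛₗ]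
    exact Submodule.smul_mem _ _ (Submodule.subset_span ⟨k, rfl⟩)

theorem split_tilde_frobenius (i b : Irr C) (Q : rep i ⟶ rep b ⊗ conj b) (U : C) :
    split (tilde i b (frobenius i b Q)) U =
      cup (std b).t (conj b ⊗ U) ≫ conj b ◁ dag (split Q U) := by
  rw [split_tilde, split_frobenius, MonoidalCategory.whiskerLeft_comp, Category.assoc,
    ← MonoidalCategory.whiskerLeft_comp (conj b) (dag _), ← dag_split_naturality,
    ← MonoidalCategory.whiskerLeft_comp, ← MonoidalCategory.whiskerLeft_comp_assoc,
    (std b).conjugateEquations.cup_right_cap]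
  simp

theorem contract_frobenius (i b : Irr C) (Q : rep i ⟶ rep b ⊗ conj b) (U : C) :
    nestMap (contract i b b (frobenius i b Q) (frobenius i b Q)) U =
      conj b ◁ rep b ◁ cup (std b).t U ≫ conj b ◁ nestMap (dag Q ≫ Q) (rep b ⊗ U) ≫
        cap (std b).t (conj b ⊗ (rep b ⊗ U)) := by
  rw [nestMap_contract, split_tilde_frobenius, split_frobenius, ← dag_split_comp_split]
  simp

/-- `contract` as a sesquilinear map, conjugate-linear in its first morphism. -/
def contractₗ (i a b : Irr C) : (rep a ⟶ rep i ⊗ rep a) →ₗ⋆[ℂ] (rep b ⟶ rep i ⊗ rep b) →ₗ[ℂ]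
    (conj a ⊗ rep b ⟶ conj a ⊗ rep b) :=
  LinearMap.mk₂'ₛₗ (starRingEnd ℂ) (RingHom.id ℂ) (contract i a b)
    (fun S S' T => by simp [contract, CStarCategory.dag_add])
    (fun z S T => by simp [contract, CStarCategory.dag_smul])
    (fun S T T' => by simp [contract])
    (fun z S T => by simp [contract])

end Frobenius

/-! ### Sums of contractions over orthonormal bases -/

section Diagrams

variable {C : Type u} [Category.{v} C] [CStarCategory C] [MonoidalCategory C]
  [CStarTensorCategory C] [IsRigid C]

theorem nestMap_sum_smul_sum {Y Z : C} {ι : Type*} (s : Finset ι) (z : ι → ℂ) (n : ι → ℕ)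
    (f : ∀ i, Fin (n i) → (Y ⊗ Z ⟶ Y ⊗ Z)) (U : C) :
    nestMap (∑ i ∈ s, z i • ∑ k, f i k) U = ∑ i ∈ s, z i • ∑ k, nestMap (f i k) U := by
  change nestMapₗ Y Z U _ = ∑ i ∈ s, z i • ∑ k, nestMapₗ Y Z U (f i k)
  simp only [map_sum, map_smul]

/-- Summing the contractions of an orthonormal basis with itself closes up the string `b`: the basis
may be taken to be a Frobenius transform of orthonormal bases of the morphisms `i → b b̄`, whose
weighted sums are the isotypic projections of `b b̄`. -/
theorem sum_contract_self (b : Irr C) (s : Finset (Irr C))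
    (hs : ∀ (i : Irr C) (V : rep b ⟶ rep i ⊗ rep b), V ≠ 0 → i ∈ s) :
    ∑ i ∈ s, (dim i : ℂ) • ∑ k, contract i b b ((onb b (rep i ⊗ rep b)).2 k)
      ((onb b (rep i ⊗ rep b)).2 k) = dag (std b).t ≫ (std b).t := by
  have h1 : ∀ i, ∑ k, contract i b b ((onb b (rep i ⊗ rep b)).2 k) ((onb b (rep i ⊗ rep b)).2 k) =
      ∑ k, contract i b b (frobenius i b ((onb i (rep b ⊗ conj b)).2 k))
        (frobenius i b ((onb i (rep b ⊗ conj b)).2 k)) := fun i =>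
    (isONB_onb b _).sum_eq_sum (isONB_frobenius (isONB_onb i _)) (contractₗ i b b)
  simp only [h1]
  apply nestMap_injective
  have h2 := sum_isotypic (rep b ⊗ conj b) s fun i Q hQ => hs i (frobenius i b Q) fun h => hQ <|
    homForm_self_eq_zero (by rw [← homForm_frobenius, h, map_zero])
  simp only [nestMap_sum_smul_sum, contract_frobenius]
  calc _ = conj b ◁ rep b ◁ cup (std b).t (𝟙_ C) ≫ conj b ◁ nestMap (∑ i ∈ s, isotypic i _)
        (rep b ⊗ 𝟙_ C) ≫ cap (std b).t (conj b ⊗ (rep b ⊗ 𝟙_ C)) := by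
        simp only [isotypic, nestMap_sum_smul_sum, whiskerLeft_sum,
          MonoidalLinear.whiskerLeft_smul, Preadditive.comp_sum, Preadditive.sum_comp,
          Linear.comp_smul, Linear.smul_comp]
    _ = _ := by
        rw [h2, ← cup_comp_cap_eq_nestMap, ← cap_naturality]
        simp [nestMap]

/-- The morphism representing `V ↦ Tr_c(W* (contract V' V) W)` for `W : c → b̄ a`. -/
def link {i a b c : Irr C} (W : rep c ⟶ conj b ⊗ rep a) (V' : rep b ⟶ rep i ⊗ rep b) :
    rep a ⟶ rep i ⊗ rep a :=
  dag (cup (std b).s (rep i ⊗ rep a) ≫ rep b ◁ (α_ _ _ _).inv ≫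
    rep b ◁ dag (tilde i b V') ▷ rep a ≫ rep b ◁ (dag W ≫ W) ≫ cap (std b).s (rep a))

variable {i a b c : Irr C} (W : rep c ⟶ conj b ⊗ rep a)

theorem dag_split_link (V' : rep b ⟶ rep i ⊗ rep b) (U : C) :
    dag (split (link W V') U) = cup (std b).s (rep i ⊗ (rep a ⊗ U)) ≫
      rep b ◁ dag (split (tilde i b V') (rep a ⊗ U)) ≫ rep b ◁ nestMap (dag W ≫ W) U ≫
        cap (std b).s (rep a ⊗ U) := by
  simp only [split, CStarCategory.dag_comp, CStarTensorCategory.dag_whiskerRight,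
    CStarTensorCategory.dag_associator]
  rw [link, CStarCategory.dag_dag]
  simp only [cup, cap, nestMap]
  monoidal

/-- The defining property of `link`. Both sides are the mixed trace on `b̄ a`, by the trace
property. -/
theorem homForm_link (V' : rep b ⟶ rep i ⊗ rep b) (V : rep a ⟶ rep i ⊗ rep a) :
    homForm a _ (link W V') V = Tr c (W ≫ contract i b a V' V ≫ dag W) := by
  have hb := rep_irreducible b
  have hb' := hb.conj (std b).conjugateEquations
  rw [homForm_apply, ← (((std b).swap hb).prod hb' (rep_irreducible a) (std a)).tr_comp c W
    (contract i b a V' V ≫ dag W), StandardSolution.tr_prod]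
  apply smul_id_injective (CStarTensorCategory.unit_irreducible (C := C))
  rw [mixedTrace, smul_unitScalar]
  refine ((std a).right_tr (V ≫ dag (link W V')) (𝟙_ C)).symm.trans ?_
  rw [← split_comp_dag_split, dag_split_link]
  change _ = cup (std b).s (𝟙_ C) ≫ rep b ◁ (conj b ◁ cup (std a).s (𝟙_ C) ≫
    nestMap _ (conj a ⊗ 𝟙_ C) ≫ conj b ◁ cap (std a).s (𝟙_ C)) ≫ cap (std b).s (𝟙_ C)
  rw [Category.assoc (contract i b a V' V), nestMap_comp, nestMap_contract]
  simp only [MonoidalCategory.whiskerLeft_comp, Category.assoc]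
  rw [cap_naturality]
  simp only [← cup_naturality_assoc]

theorem nestMap_contract_link (V' : rep b ⟶ rep i ⊗ rep b) (U : C) :
    nestMap (contract i a b (link W V') V') U =
      conj a ◁ cup (std b).s (rep b ⊗ U) ≫ conj a ◁ rep b ◁ nestMap (contract i b b V' V') U ≫
        conj a ◁ rep b ◁ conj b ◁ cup (std a).s (rep b ⊗ U) ≫
          conj a ◁ rep b ◁ nestMap (dag W ≫ W) (conj a ⊗ (rep b ⊗ U)) ≫
            conj a ◁ cap (std b).s (rep a ⊗ (conj a ⊗ (rep b ⊗ U))) ≫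
              cap (std a).t (conj a ⊗ (rep b ⊗ U)) := by
  rw [nestMap_contract, dag_split_tilde, dag_split_link]
  simp only [MonoidalCategory.whiskerLeft_comp, Category.assoc]
  rw [nestMap_contract]
  simp only [MonoidalCategory.whiskerLeft_comp, Category.assoc]
  simp only [← MonoidalCategory.whiskerLeft_comp_assoc]
  congr 2
  simp only [MonoidalCategory.whiskerLeft_comp, Category.assoc, ← cup_naturality_assoc]
  simp only [← MonoidalCategory.whiskerLeft_comp_assoc]
  rw [← dag_split_naturality_assoc]
  simp only [MonoidalCategory.whiskerLeft_comp, Category.assoc, ← cup_naturality_assoc]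

theorem nestMap_sum_contract_link (s : Finset (Irr C))
    (hs : ∀ (i : Irr C) (V : rep b ⟶ rep i ⊗ rep b), V ≠ 0 → i ∈ s) (U : C) :
    nestMap (∑ i ∈ s, (dim i : ℂ) • ∑ k, contract i a b
      (link W ((onb b (rep i ⊗ rep b)).2 k)) ((onb b (rep i ⊗ rep b)).2 k)) U =
      conj a ◁ rep b ◁ (cup (std b).t U ≫ conj b ◁ cup (std a).s (rep b ⊗ U) ≫
          dag (split W (conj a ⊗ (rep b ⊗ U)))) ≫
        (conj a ◁ rep b ◁ split W (conj a ⊗ (rep b ⊗ U)) ≫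
          conj a ◁ cap (std b).s (rep a ⊗ (conj a ⊗ (rep b ⊗ U))) ≫
            cap (std a).t (conj a ⊗ (rep b ⊗ U))) := by
  simp only [nestMap_sum_smul_sum, nestMap_contract_link]
  calc _ = conj a ◁ cup (std b).s (rep b ⊗ U) ≫ conj a ◁ rep b ◁ nestMap
        (∑ i ∈ s, (dim i : ℂ) • ∑ k, contract i b b ((onb b (rep i ⊗ rep b)).2 k)
          ((onb b (rep i ⊗ rep b)).2 k)) U ≫
        conj a ◁ rep b ◁ conj b ◁ cup (std a).s (rep b ⊗ U) ≫
          conj a ◁ rep b ◁ nestMap (dag W ≫ W) (conj a ⊗ (rep b ⊗ U)) ≫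
            conj a ◁ cap (std b).s (rep a ⊗ (conj a ⊗ (rep b ⊗ U))) ≫
              cap (std a).t (conj a ⊗ (rep b ⊗ U)) := by
        simp only [nestMap_sum_smul_sum, whiskerLeft_sum, MonoidalLinear.whiskerLeft_smul,
          Preadditive.comp_sum, Preadditive.sum_comp, Linear.comp_smul, Linear.smul_comp]
    _ = _ := by
        rw [sum_contract_self b s hs, ← cup_comp_cap_eq_nestMap, ← dag_split_comp_split]
        simp only [MonoidalCategory.whiskerLeft_comp, Category.assoc]
        rw [← MonoidalCategory.whiskerLeft_comp_assoc (conj a) (cup _ _),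
          (std b).conjugateEquations.cup_left_cap]
        simp

/-- After the string `b` has been closed up by `sum_contract_self`, the sum factors through `c̄` as
`ā b → c̄ → ā b`, with factors built from `W` and `W*`. By the trace relation the factors can be
composed in the other order, which gives `d(c)⁻¹` times the identity of `c̄`. -/
theorem cornerOp_sum_contract_link {H : Type w} [NormedAddCommGroup H] [InnerProductSpace ℂ H]
    (M : HilbertModule C H) (s : Finset (Irr C))
    (hs : ∀ (i : Irr C) (V : rep b ⟶ rep i ⊗ rep b), V ≠ 0 → i ∈ s)
    (hW : homForm c _ W W = 1) :
    cornerOp M _ (∑ i ∈ s, (dim i : ℂ) • ∑ k, contract i a b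
      (link W ((onb b (rep i ⊗ rep b)).2 k)) ((onb b (rep i ⊗ rep b)).2 k)) =
      (dim c : ℂ)⁻¹ • cornerOp M (conj c) (𝟙 _) := by
  set F := ∑ i ∈ s, (dim i : ℂ) • ∑ k, contract i a b
      (link W ((onb b (rep i ⊗ rep b)).2 k)) ((onb b (rep i ⊗ rep b)).2 k) with hF
  let R : ∀ U, U ⟶ rep c ⊗ (conj a ⊗ (rep b ⊗ U)) := fun U => cup (std b).t U ≫
    conj b ◁ cup (std a).s (rep b ⊗ U) ≫ dag (split W (conj a ⊗ (rep b ⊗ U)))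
  let L : ∀ U, conj a ⊗ (rep b ⊗ (rep c ⊗ U)) ⟶ U := fun U =>
    conj a ◁ rep b ◁ split W U ≫ conj a ◁ cap (std b).s (rep a ⊗ U) ≫ cap (std a).t U
  have hRnat : ∀ {U V : C} (g : U ⟶ V), g ≫ R V = R U ≫ rep c ◁ conj a ◁ rep b ◁ g := by
    intro U V g
    simp only [R, Category.assoc]
    rw [← dag_split_naturality, ← MonoidalCategory.whiskerLeft_comp_assoc, ← cup_naturality,
      MonoidalCategory.whiskerLeft_comp_assoc, ← cup_naturality_assoc]
  have hLnat : ∀ {U V : C} (g : U ⟶ V), conj a ◁ rep b ◁ rep c ◁ g ≫ L V = L U ≫ g := by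
    intro U V g
    simp only [L, Category.assoc]
    rw [← cap_naturality, ← MonoidalCategory.whiskerLeft_comp_assoc (conj a) (cap _ _),
      ← cap_naturality, MonoidalCategory.whiskerLeft_comp_assoc,
      ← MonoidalCategory.whiskerLeft_comp_assoc (conj a) (rep b ◁ split W U),
      ← MonoidalCategory.whiskerLeft_comp (rep b), ← split_naturality,
      MonoidalCategory.whiskerLeft_comp (rep b), MonoidalCategory.whiskerLeft_comp_assoc]
  have hRL : ∀ U, R (rep c ⊗ U) ≫ rep c ◁ L U = (dim c : ℂ)⁻¹ • 𝟙 _ := by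
    intro U
    have h1 : cup (std b).t (rep c ⊗ U) ≫ conj b ◁ cup (std a).s (rep b ⊗ (rep c ⊗ U)) ≫
        conj b ◁ rep a ◁ L U = split W U := by
      calc _ = cup (std b).t (rep c ⊗ U) ≫ conj b ◁ (cup (std a).s (rep b ⊗ (rep c ⊗ U)) ≫
            rep a ◁ conj a ◁ (rep b ◁ split W U ≫ cap (std b).s (rep a ⊗ U)) ≫
              rep a ◁ cap (std a).t U) := by simp only [L]; simp
        _ = _ := by
          rw [← cup_naturality_assoc, (std a).conjugateEquations.cup_left_cap, Category.comp_id,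
            MonoidalCategory.whiskerLeft_comp, ← cup_naturality_assoc,
            (std b).conjugateEquations.cup_right_cap, Category.comp_id]
    simp only [R, Category.assoc]
    rw [← dag_split_naturality, reassoc_of% h1, split_comp_dag_split, comp_dag_eq_homForm, hW]
    simp
  let P : conj c ⊗ 𝟙_ C ⟶ conj a ⊗ (rep b ⊗ 𝟙_ C) :=
    conj c ◁ R (𝟙_ C) ≫ cap (std c).t (conj a ⊗ (rep b ⊗ 𝟙_ C))
  let Q : conj a ⊗ (rep b ⊗ 𝟙_ C) ⟶ conj c ⊗ 𝟙_ C :=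
    conj a ◁ rep b ◁ cup (std c).s (𝟙_ C) ≫ L _
  have hQP : nestMap F (𝟙_ C) = Q ≫ P := by
    rw [hF, nestMap_sum_contract_link W s hs]
    change conj a ◁ rep b ◁ R _ ≫ L _ = (conj a ◁ rep b ◁ cup (std c).s (𝟙_ C) ≫ L _) ≫ P
    have h1 : R (𝟙_ C) = cup (std c).s (𝟙_ C) ≫ rep c ◁ P := by
      simp only [P, MonoidalCategory.whiskerLeft_comp]
      rw [← cup_naturality_assoc, (std c).conjugateEquations.cup_left_cap, Category.comp_id]
    rw [h1, Category.assoc, ← hLnat]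
    simp
  have hPQ : P ≫ Q = (dim c : ℂ)⁻¹ • 𝟙 _ := by
    simp only [P, Category.assoc]
    rw [← cap_naturality]
    calc _ = conj c ◁ (cup (std c).s (𝟙_ C) ≫ R _ ≫ rep c ◁ L _) ≫ cap (std c).t _ := by
          simp only [reassoc_of% (hRnat), Q]
          simp
      _ = _ := by
          rw [hRL, Linear.comp_smul, Category.comp_id, MonoidalLinear.whiskerLeft_smul,
            Linear.smul_comp, (std c).conjugateEquations.right_cup_cap]
  let e := whiskerLeftIso (conj a) (ρ_ (rep b))
  have h1 : F = e.inv ≫ nestMap F (𝟙_ C) ≫ e.hom := by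
    simp only [nestMap, e, whiskerLeftIso_hom, whiskerLeftIso_inv]; monoidal
  rw [h1, cornerOp_cyclic, Category.assoc, Iso.hom_inv_id, Category.comp_id, hQP, cornerOp_cyclic,
    hPQ, map_smul, cornerOp_id_eq_of_iso M (ρ_ (conj c))]

end Diagrams

/-! ### Conjugates and multiplicities -/

section Duality

variable {C : Type u} [Category.{v} C] [CStarCategory C] [MonoidalCategory C]
  [CStarTensorCategory C]

theorem finrank_hom_swap (X Y : C) : Module.finrank ℂ (X ⟶ Y) = Module.finrank ℂ (Y ⟶ X) := by
  let j : (X ⟶ Y) ≃+ (Y ⟶ X) :=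
    { toFun := dag
      invFun := dag
      left_inv := CStarCategory.dag_dag
      right_inv := CStarCategory.dag_dag
      map_add' := CStarCategory.dag_add }
  exact congrArg Cardinal.toNat (rank_eq_of_equiv_equiv (starRingEnd ℂ) j
    (starRingAut (R := ℂ)).bijective CStarCategory.dag_smul)

/-- Frobenius reciprocity for a conjugate on the left: the morphisms `X → ȳ Z` are those `y X → Z`.
-/
def leftDuality {Y Yb : C} {s : 𝟙_ C ⟶ Y ⊗ Yb} {t : 𝟙_ C ⟶ Yb ⊗ Y}
    (h : ConjugateEquations Y Yb s t) (X Z : C) : (X ⟶ Yb ⊗ Z) ≃ₗ[ℂ] (Y ⊗ X ⟶ Z) where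
  toFun f := Y ◁ f ≫ cap s Z
  invFun g := cup t X ≫ Yb ◁ g
  map_add' f g := by simp
  map_smul' z f := by simp
  left_inv f := by
    simp only [MonoidalCategory.whiskerLeft_comp]
    rw [← cup_naturality_assoc, h.cup_right_cap, Category.comp_id]
  right_inv g := by
    simp only [MonoidalCategory.whiskerLeft_comp, Category.assoc]
    rw [cap_naturality, h.left_cup_cap_assoc]

/-- Frobenius reciprocity on the right: the morphisms `X → Z y` are those `X ȳ → Z`. -/
def rightDuality {Y Yb : C} {s : 𝟙_ C ⟶ Y ⊗ Yb} {t : 𝟙_ C ⟶ Yb ⊗ Y}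
    (h : ConjugateEquations Y Yb s t) (X Z : C) : (X ⟶ Z ⊗ Y) ≃ₗ[ℂ] (X ⊗ Yb ⟶ Z) where
  toFun f := f ▷ Yb ≫ (α_ _ _ _).hom ≫ Z ◁ dag s ≫ (ρ_ Z).hom
  invFun g := (ρ_ X).inv ≫ X ◁ t ≫ (α_ _ _ _).inv ≫ g ▷ Y
  map_add' f g := by simp
  map_smul' z f := by simp
  left_inv f := by
    apply split_injective
    calc _ = X ◁ cup t (𝟙_ C) ≫ split f (Yb ⊗ (Y ⊗ 𝟙_ C)) ≫ Z ◁ cap s (Y ⊗ 𝟙_ C) := by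
          simp only [split, cup, cap]; monoidal
      _ = _ := by
          rw [split_naturality_assoc, ← MonoidalCategory.whiskerLeft_comp, h.left_cup_cap,
            MonoidalCategory.whiskerLeft_id, Category.comp_id]
  right_inv g := by
    apply (MonoidalCategory.whiskerRight_iff _ _).mp
    calc _ = (α_ _ _ _).hom ≫ X ◁ cup t (Yb ⊗ 𝟙_ C) ≫ ((α_ X Yb _).inv ≫ g ▷ (Y ⊗ (Yb ⊗ 𝟙_ C))) ≫
          Z ◁ cap s (𝟙_ C) := by
          simp only [cup, cap]; monoidal
      _ = (α_ _ _ _).hom ≫ X ◁ (cup t (Yb ⊗ 𝟙_ C) ≫ Yb ◁ cap s (𝟙_ C)) ≫ (α_ _ _ _).inv ≫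
          g ▷ 𝟙_ C := by
          rw [Category.assoc, ← whisker_exchange]
          simp
      _ = _ := by
          rw [h.cup_right_cap]
          simp

variable [IsRigid C]

theorem conj_irreducible (a : Irr C) : IsIrreducible (conj a) :=
  (rep_irreducible a).conj (std a).conjugateEquations

/-- The class of the conjugate of an irreducible object. -/
def bar (a : Irr C) : Irr C := irrOf (conj_irreducible a)

theorem exists_barUnitary (a : Irr C) : ∃ w : rep (bar a) ⟶ conj a,
    w ≫ dag w = 𝟙 _ ∧ dag w ≫ w = 𝟙 _ := exists_unitary_irrOf (conj_irreducible a)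

theorem nonempty_bar_iso (a : Irr C) : Nonempty (rep (bar a) ≅ conj a) :=
  rep_irrOf_iso (conj_irreducible a)

theorem nonempty_conj_bar_iso (a : Irr C) : Nonempty (rep a ≅ conj (bar a)) := by
  obtain ⟨e⟩ := nonempty_bar_iso a
  have ht : (std a).t ≠ 0 := ((std a).swap (rep_irreducible a)).s_ne_zero (conj_irreducible a).1
  let g : rep (bar a) ⊗ rep a ⟶ 𝟙_ C := e.hom ▷ rep a ≫ dag (std a).t
  have hg : g ≠ 0 := by
    intro h
    apply ht
    apply dag_injective
    rw [dag_zero, ← Category.id_comp (dag (std a).t), ← id_whiskerRight, ← e.inv_hom_id,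
      comp_whiskerRight, Category.assoc, show e.hom ▷ rep a ≫ dag (std a).t = 0 from h,
      Limits.comp_zero]
  let f : rep a ⟶ conj (bar a) :=
    (leftDuality (std (bar a)).conjugateEquations (rep a) (𝟙_ C)).symm g ≫ (ρ_ _).hom
  have hf : f ≠ 0 := by
    intro h
    apply hg
    have h1 : (leftDuality (std (bar a)).conjugateEquations (rep a) (𝟙_ C)).symm g = 0 := by
      rw [← cancel_mono (ρ_ _).hom]
      exact h.trans Limits.zero_comp.symm
    simpa using h1
  obtain ⟨-, w, -, h1, h2, -⟩ :=
    exists_unitary_of_ne_zero (rep_irreducible a) (conj_irreducible (bar a)) f hf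
  exact ⟨⟨w, dag w, h1, h2⟩⟩

theorem eq_of_iso {a b : Irr C} (e : rep a ≅ rep b) : a = b :=
  eq_of_hom_ne_zero e.hom fun h => (rep_irreducible a).1 (by
    rw [← e.hom_inv_id, h, Limits.zero_comp])

theorem bar_bar (a : Irr C) : bar (bar a) = a := by
  obtain ⟨e⟩ := nonempty_conj_bar_iso a
  obtain ⟨f⟩ := nonempty_bar_iso (bar a)
  exact eq_of_iso (f ≪≫ e.symm)

theorem IsSymmetricSet.bar_mem {S : Finset (Irr C)} (h : IsSymmetricSet S) {a : Irr C}
    (ha : a ∈ S) : bar a ∈ S := by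
  obtain ⟨b, hb, ⟨e⟩⟩ := h a ha
  obtain ⟨f⟩ := nonempty_bar_iso a
  rwa [eq_of_iso (f ≪≫ e.symm)]

theorem finrank_hom_congr {X X' Y Y' : C} (e : X ≅ X') (f : Y ≅ Y') :
    Module.finrank ℂ (X ⟶ Y) = Module.finrank ℂ (X' ⟶ Y') :=
  (Linear.homCongr ℂ e f).finrank_eq

/-- `mult(c, b̄ a) = mult(a, b c)`. -/
theorem mult_conj_rotate (a b c : Irr C) :
    mult c (conj b ⊗ rep a) = mult a (conj (bar b) ⊗ rep c) := by
  obtain ⟨e⟩ := nonempty_conj_bar_iso b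
  rw [mult, mult, (leftDuality (std b).conjugateEquations _ _).finrank_eq, finrank_hom_swap]
  exact finrank_hom_congr (Iso.refl _) (whiskerRightIso e _)

/-- `mult(c, b̄ a) = mult(c̄, ā b)`. -/
theorem mult_conj_reflect (a b c : Irr C) :
    mult c (conj b ⊗ rep a) = mult (bar c) (conj a ⊗ rep b) := by
  obtain ⟨e⟩ := nonempty_bar_iso c
  rw [mult, mult, (leftDuality (std b).conjugateEquations _ _).finrank_eq, finrank_hom_swap,
    (rightDuality (std c).conjugateEquations _ _).finrank_eq,
    finrank_hom_congr e (Iso.refl (conj a ⊗ rep b)),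
    (leftDuality (std a).conjugateEquations _ _).finrank_eq]

theorem dim_bar (a : Irr C) : dim (bar a) = dim a := by
  obtain ⟨w, h1, h2⟩ := exists_barUnitary a
  have h := ((std a).swap (rep_irreducible a)).tr_comp (bar a) w (dag w)
  rw [h1, Tr_id] at h
  have h3 : ((std a).swap (rep_irreducible a)).tr (dag w ≫ w) = dim a := by
    rw [← Tr_id, h2]
    change unitScalar ((std a).t ≫ 𝟙 (conj a) ▷ rep a ≫ dag (std a).t) = unitScalar _
    rw [(std a).standard]
    simp
  exact_mod_cast h.symm.trans h3

variable (C) in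
theorem dim_unitIrr : dim (unitIrr C) = 1 := by
  have h := (StandardSolution.unit C).tr_comp (unitIrr C) (unitUnitary C) (dag (unitUnitary C))
  rw [unitUnitary_comp_dag, Tr_id, dag_comp_unitUnitary] at h
  have h3 : (StandardSolution.unit C).tr (𝟙 (𝟙_ C)) = 1 := by
    change unitScalar ((λ_ (𝟙_ C)).inv ≫ 𝟙 (𝟙_ C) ▷ (𝟙_ C) ≫ dag (λ_ (𝟙_ C)).inv) = 1
    simp
  exact_mod_cast h.symm.trans h3

theorem tr_prod_id (a b : Irr C) :
    ((std a).prod (rep_irreducible a) (rep_irreducible b) (std b)).tr (𝟙 _) = dim a * dim b := by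
  rw [StandardSolution.tr_prod, mixedTrace]
  have h1 : ∀ U, nestMap (𝟙 (rep a ⊗ rep b)) U = rep a ◁ 𝟙 (rep b) ▷ U := by
    intro U; simp [nestMap]
  rw [h1, ← MonoidalCategory.whiskerLeft_comp, ← MonoidalCategory.whiskerLeft_comp,
    (std b).right_tr]
  have h2 := (std a).tr_id_smul' ((std b).tr (𝟙 _)) (𝟙_ C)
  have h3 : ∀ c : Irr C, (std c).tr (𝟙 _) = dim c := Tr_id
  simp only [MonoidalLinear.whiskerLeft_smul, MonoidalCategory.whiskerLeft_id]
  rw [h2, h3, h3, unitScalar_smul_id, mul_comm]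

/-- The dimension is multiplicative on decompositions of `a b` into irreducible objects. -/
theorem dim_mul_dim (a b : Irr C) (s : Finset (Irr C))
    (hs : ∀ (c : Irr C) (f : rep c ⟶ rep a ⊗ rep b), f ≠ 0 → c ∈ s) :
    dim a * dim b = ∑ c ∈ s, (mult c (rep a ⊗ rep b) : ℝ) * dim c := by
  have h1 := tr_prod_id a b
  rw [← sum_isotypic _ s hs] at h1
  simp only [isotypic, map_sum, map_smul, StandardSolution.tr_comp] at h1
  have h2 : ∀ c k, Tr c ((onb c (rep a ⊗ rep b)).2 k ≫ dag ((onb c (rep a ⊗ rep b)).2 k)) = 1 := by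
    intro c k
    have := (isONB_onb c (rep a ⊗ rep b)).1 k k
    rwa [if_pos rfl, homForm_apply] at this
  simp only [h2, Finset.sum_const, Finset.card_univ, Fintype.card_fin, onb_card_eq_mult,
    nsmul_eq_mul, mul_one, smul_eq_mul] at h1
  rw [← Complex.ofReal_inj, Complex.ofReal_mul, ← h1]
  push_cast
  exact Finset.sum_congr rfl fun c _ => mul_comm _ _

/-- The degree `∑_{β, γ ∈ S} mult(γ, β̄ α) = ν(α) d(α)` of a vertex of the link. For symmetric `S`
it is also the sum of the same multiplicities with `α` in either of the other two places. -/
def linkDegree (S : Finset (Irr C)) (a : Irr C) : ℕ := ∑ b ∈ S, ∑ c ∈ S, mult c (conj b ⊗ rep a)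

theorem weight_mul_dim (S : Finset (Irr C)) (a : Irr C) : weight S a * dim a = linkDegree S a := by
  rw [weight, linkDegree, Finset.sum_mul]
  push_cast
  rw [← Finset.sum_coe_sort S]
  refine Finset.sum_congr rfl fun b _ => ?_
  rw [← Finset.sum_coe_sort S, Finset.sum_mul]
  exact Finset.sum_congr rfl fun c _ => div_mul_cancel₀ _ (dim_pos a).ne'

theorem sum_bar {S : Finset (Irr C)} (h : IsSymmetricSet S) {M : Type*} [AddCommMonoid M]
    (f : Irr C → M) : ∑ a ∈ S, f (bar a) = ∑ a ∈ S, f a :=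
  Finset.sum_nbij' bar bar (fun _ => h.bar_mem) (fun _ => h.bar_mem) (fun _ _ => bar_bar _)
    (fun _ _ => bar_bar _) fun _ _ => rfl

theorem sum_mult_source {S : Finset (Irr C)} (h : IsSymmetricSet S) (b : Irr C) :
    ∑ a ∈ S, ∑ c ∈ S, mult c (conj b ⊗ rep a) = linkDegree S b := by
  refine Finset.sum_congr rfl fun a _ => ?_
  rw [← sum_bar h]
  refine Finset.sum_congr rfl fun c _ => ?_
  rw [mult_conj_reflect, bar_bar]

theorem sum_mult_target {S : Finset (Irr C)} (h : IsSymmetricSet S) (c : Irr C) :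
    ∑ a ∈ S, ∑ b ∈ S, mult c (conj b ⊗ rep a) = linkDegree S c := by
  rw [Finset.sum_comm, linkDegree, ← sum_bar h]
  refine Finset.sum_congr rfl fun b _ => Finset.sum_congr rfl fun a _ => ?_
  rw [mult_conj_rotate, bar_bar]

theorem linkDegree_bar {S : Finset (Irr C)} (h : IsSymmetricSet S) (a : Irr C) :
    linkDegree S (bar a) = linkDegree S a := by
  rw [← sum_mult_target h, ← sum_mult_target h, Finset.sum_comm]
  refine Finset.sum_congr rfl fun b _ => Finset.sum_congr rfl fun c _ => ?_
  rw [mult_conj_reflect, bar_bar]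

end Duality

/-! ### Identities and norm bounds in a Hilbert module -/

section ModuleIdentities

variable {C : Type u} [Category.{v} C] [CStarCategory C] [MonoidalCategory C]
  [CStarTensorCategory C] [IsRigid C]

variable (C) in
theorem bar_unitIrr : bar (unitIrr C) = unitIrr C := by
  set w := unitUnitary C
  have hs := (std (unitIrr C)).s_ne_zero (rep_irreducible (unitIrr C)).1
  let f : 𝟙_ C ⟶ conj (unitIrr C) := (std (unitIrr C)).s ≫ w ▷ _ ≫ (λ_ _).hom
  have hf : w ≫ f ≠ 0 := by
    intro h
    apply hs
    calc (std (unitIrr C)).s = dag w ≫ (w ≫ f) ≫ (λ_ _).inv ≫ dag w ▷ _ := by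
          simp only [f, w, Category.assoc, Iso.hom_inv_id_assoc, ← comp_whiskerRight,
            unitUnitary_comp_dag, id_whiskerRight, Category.comp_id]
          rw [← Category.assoc, dag_comp_unitUnitary, Category.id_comp]
      _ = 0 := by rw [h]; simp
  exact (irrOf_eq_of_hom_ne_zero (conj_irreducible (unitIrr C)) (w ≫ f) hf).symm

/-- The identity of `a`, as a morphism `a → ε a`. -/
def unitVec (a : Irr C) : rep a ⟶ rep (unitIrr C) ⊗ rep a :=
  (λ_ (rep a)).inv ≫ dag (unitUnitary C) ▷ rep a

theorem homForm_unitVec (a : Irr C) : homForm a _ (unitVec a) (unitVec a) = dim a := by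
  rw [homForm_apply, ← Tr_id, unitVec]
  congr 1
  simp only [CStarCategory.dag_comp, CStarTensorCategory.dag_whiskerRight, CStarCategory.dag_dag,
    dag_leftUnitor_inv, Category.assoc, ← comp_whiskerRight_assoc, dag_comp_unitUnitary]
  simp

theorem tilde_unitVec (a : Irr C) :
    tilde (unitIrr C) a (unitVec a) = (ρ_ _).inv ≫ conj a ◁ dag (unitUnitary C) := by
  apply split_injective
  rw [split_tilde]
  have h1 : ∀ U, split (unitVec a) U = (λ_ _).inv ≫ dag (unitUnitary C) ▷ (rep a ⊗ U) := by
    intro U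
    simp only [split, unitVec]; monoidal
  rw [h1, ← MonoidalCategory.whiskerLeft_comp, Category.assoc, ← whisker_exchange,
    ← leftUnitor_inv_naturality_assoc, MonoidalCategory.whiskerLeft_comp,
    (std a).conjugateEquations.cup_right_cap_assoc]
  simp only [split]; monoidal

theorem dag_tilde_unitVec (a : Irr C) :
    dag (tilde (unitIrr C) a (unitVec a)) = conj a ◁ unitUnitary C ≫ (ρ_ _).hom := by
  rw [tilde_unitVec]
  simp

theorem inner_self_eq_ofReal {H : Type w} [NormedAddCommGroup H] [InnerProductSpace ℂ H] (x : H) :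
    inner ℂ x x = ((‖x‖ ^ 2 : ℝ) : ℂ) := by
  rw [inner_self_eq_norm_sq_to_K]
  simp

variable {H : Type w} [NormedAddCommGroup H] [InnerProductSpace ℂ H] (M : HilbertModule C H)

theorem act_tubeOne_bar (a : Irr C) : M.act (tubeOne (bar a)) = cornerOp M (conj a) (𝟙 _) := by
  obtain ⟨e⟩ := nonempty_bar_iso a
  rw [act_tubeOne, cornerOp_id_eq_of_iso M e]

variable (C) in
theorem act_tubeOne_unitIrr : M.act (tubeOne (unitIrr C)) = M.act (tubeProj (unitIrr C)) := by
  rw [act_tubeOne, act_tubeProj_unit, cornerOp_id_eq_of_iso M (unitRepIso C)]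

theorem fromUnitOp_unitVec (a : Irr C) :
    fromUnitOp M (unitIrr C) (rep a) (unitVec a) = M.act (tubeOne a) := by
  rw [act_tubeOne]
  change M.act _ = M.act _
  congr 2
  simp [fromUnit, corner, unitVec]

theorem toUnitOp_unitVec (a : Irr C) :
    toUnitOp M (unitIrr C) a (unitVec a) = M.act (tubeOne (bar a)) := by
  rw [act_tubeOne_bar]
  change M.act _ = M.act _
  rw [dag_tilde_unitVec]
  congr 2
  simp [toUnit, corner]

theorem inner_tubeOne (a : Irr C) (ξ η : H) :
    inner ℂ (M.act (tubeOne a) ξ) η = inner ℂ ξ (M.act (tubeOne (bar a)) η) := by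
  rw [← fromUnitOp_unitVec, inner_fromUnitOp, toUnitOp_unitVec]

theorem inner_tubeProj (ξ η : H) :
    inner ℂ (M.act (tubeProj (unitIrr C)) ξ) η = inner ℂ ξ (M.act (tubeProj (unitIrr C)) η) := by
  rw [← act_tubeOne_unitIrr, inner_tubeOne, bar_unitIrr]

theorem tubeProj_tubeProj (ξ : H) : M.act (tubeProj (unitIrr C)) (M.act (tubeProj (unitIrr C)) ξ) =
    M.act (tubeProj (unitIrr C)) ξ := by
  have h := tubeProj_cornerOp M (𝟙 (𝟙_ C)) ξ
  rwa [← act_tubeProj_unit] at h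

theorem tubeProj_tubeOne (a : Irr C) (ξ : H) :
    M.act (tubeProj (unitIrr C)) (M.act (tubeOne a) ξ) = M.act (tubeOne a) ξ := by
  rw [act_tubeOne, tubeProj_cornerOp]

theorem tubeOne_tubeProj (a : Irr C) (ξ : H) :
    M.act (tubeOne a) (M.act (tubeProj (unitIrr C)) ξ) = M.act (tubeOne a) ξ := by
  rw [act_tubeOne, cornerOp_tubeProj]

theorem inner_toUnitOp (i a b : Irr C) (V : rep a ⟶ rep i ⊗ rep a) (W : rep b ⟶ rep i ⊗ rep b)
    (ξ η : H) : inner ℂ (toUnitOp M i b W ξ) (toUnitOp M i a V η) =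
      inner ℂ ξ (cornerOp M _ (contract i a b V W) η) := by
  have h := inner_fromUnitOp M i b W (toUnitOp M i a V η) ξ
  rw [fromUnitOp_toUnitOp] at h
  rw [← inner_conj_symm, ← h, inner_conj_symm]

theorem cornerOp_dag_t_comp_t (b : Irr C) :
    cornerOp M _ (dag (std b).t ≫ (std b).t) = (dim b : ℂ) • M.act (tubeProj (unitIrr C)) := by
  have h : (std b).t ≫ dag (std b).t = (dim b : ℂ) • 𝟙 _ := by
    have := (std b).standard (𝟙 _)
    simp only [MonoidalCategory.whiskerLeft_id, id_whiskerRight, Category.id_comp] at this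
    rw [← this, ← smul_unitScalar (_ ≫ _), ← Tr_id, Tr_apply]
    simp
  rw [cornerOp_cyclic, h, map_smul, act_tubeProj_unit]

/-- The components of a vector of the corner along `b` recover `d(b)` times the inner product. -/
theorem sum_inner_toUnitOp (b : Irr C) (s : Finset (Irr C))
    (hs : ∀ (i : Irr C) (V : rep b ⟶ rep i ⊗ rep b), V ≠ 0 → i ∈ s) (ξ η : H) :
    ∑ i ∈ s, (dim i : ℂ) * ∑ k, inner ℂ (toUnitOp M i b ((onb b (rep i ⊗ rep b)).2 k) ξ)
      (toUnitOp M i b ((onb b (rep i ⊗ rep b)).2 k) η) =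
      dim b * inner ℂ ξ (M.act (tubeProj (unitIrr C)) η) := by
  simp only [inner_toUnitOp, ← inner_sum, ← inner_smul_right]
  rw [← smul_apply, ← cornerOp_dag_t_comp_t, ← sum_contract_self b s hs]
  simp only [map_sum, map_smul, sum_apply, smul_apply]

theorem sum_norm_toUnitOp (b : Irr C) (s : Finset (Irr C))
    (hs : ∀ (i : Irr C) (V : rep b ⟶ rep i ⊗ rep b), V ≠ 0 → i ∈ s) (ξ : H) :
    ∑ i ∈ s, dim i * ∑ k, ‖toUnitOp M i b ((onb b (rep i ⊗ rep b)).2 k) ξ‖ ^ 2 =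
      dim b * ‖M.act (tubeProj (unitIrr C)) ξ‖ ^ 2 := by
  have h := sum_inner_toUnitOp M b s hs ξ ξ
  rw [← tubeProj_tubeProj, ← inner_tubeProj] at h
  simp only [inner_self_eq_ofReal] at h
  exact_mod_cast h

theorem norm_tubeProj_le (ξ : H) : ‖M.act (tubeProj (unitIrr C)) ξ‖ ≤ ‖ξ‖ := by
  rcases (norm_nonneg (M.act (tubeProj (unitIrr C)) ξ)).eq_or_lt with h | h
  · rw [← h]; exact norm_nonneg _
  · have h1 : ‖M.act (tubeProj (unitIrr C)) ξ‖ * ‖M.act (tubeProj (unitIrr C)) ξ‖ ≤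
        ‖M.act (tubeProj (unitIrr C)) ξ‖ * ‖ξ‖ := by
      have := norm_inner_le_norm (𝕜 := ℂ) (M.act (tubeProj (unitIrr C)) ξ) ξ
      rw [← tubeProj_tubeProj, inner_tubeProj, tubeProj_tubeProj,
        inner_self_eq_norm_sq_to_K] at this
      simpa [sq] using this
    exact le_of_mul_le_mul_left h1 h

theorem toUnitOp_eq_sum (i a : Irr C) (V : rep a ⟶ rep i ⊗ rep a) (ξ : H) :
    toUnitOp M i a V ξ = ∑ k, homForm a _ V ((onb a (rep i ⊗ rep a)).2 k) •
      toUnitOp M i a ((onb a (rep i ⊗ rep a)).2 k) ξ := by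
  conv_lhs => rw [(isONB_onb a _).eq_sum V]
  simp only [map_sum, LinearMap.map_smulₛₗ, homForm_conj_symm, sum_apply,
    smul_apply]

theorem sum_norm_homForm (c : Irr C) {X : C} (V : rep c ⟶ X) :
    ∑ k, ‖homForm c X V ((onb c X).2 k)‖ ^ 2 = (homForm c X V V).re := by
  have h : homForm c X V V = ∑ k, homForm c X V ((onb c X).2 k) *
      starRingEnd ℂ (homForm c X V ((onb c X).2 k)) := by
    calc homForm c X V V = homForm c X V (∑ k, homForm c X ((onb c X).2 k) V • (onb c X).2 k) := by
          rw [← (isONB_onb c X).eq_sum V]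
      _ = _ := by
          simp only [map_sum, map_smul, smul_eq_mul, homForm_conj_symm]
          exact Finset.sum_congr rfl fun k _ => mul_comm _ _
  rw [h, Complex.re_sum]
  refine Finset.sum_congr rfl fun k _ => ?_
  rw [Complex.mul_conj, Complex.normSq_eq_norm_sq, Complex.ofReal_re]

/-- The operator of `1_α` has norm at most `d(α)`; the definition of a module provides no explicit
bound. The vector `ξ · 1_ā` is the component of `ξ` that belongs to `unitVec a`, and the sizes of
the components are controlled by `sum_norm_toUnitOp`. -/
theorem norm_tubeOne_le (a : Irr C) (ξ : H) : ‖M.act (tubeOne a) ξ‖ ≤ dim a * ‖ξ‖ := by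
  suffices h : ∀ b, ‖M.act (tubeOne (bar b)) ξ‖ ≤ dim b * ‖ξ‖ by
    have := h (bar a)
    rwa [bar_bar, dim_bar] at this
  intro b
  set s := components (rep b ⊗ conj b) with hs
  have hs : ∀ (i : Irr C) (V : rep b ⟶ rep i ⊗ rep b), V ≠ 0 → i ∈ s := by
    intro i V hV
    obtain ⟨Q, rfl⟩ := exists_frobenius_eq i b V
    exact mem_components (f := Q) (fun h => hV (by rw [h, map_zero]))
  have h1 := sum_norm_toUnitOp M b s hs ξ
  set N := ∑ k, ‖toUnitOp M (unitIrr C) b ((onb b (rep (unitIrr C) ⊗ rep b)).2 k) ξ‖ ^ 2 with hN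
  -- only the component of the unit object is kept
  have h2 : N ≤ dim b * ‖ξ‖ ^ 2 := by
    calc N = dim (unitIrr C) * N := by rw [dim_unitIrr, one_mul]
      _ ≤ _ := Finset.single_le_sum (f := fun i => dim i * ∑ k,
            ‖toUnitOp M i b ((onb b (rep i ⊗ rep b)).2 k) ξ‖ ^ 2)
          (fun i _ => mul_nonneg (dim_pos i).le (Finset.sum_nonneg fun k _ => sq_nonneg _))
          (hs _ (unitVec b) fun h => dim_ne_zero b (by rw [← homForm_unitVec, h, map_zero]))
      _ = _ := h1
      _ ≤ _ := mul_le_mul_of_nonneg_left (pow_le_pow_left₀ (norm_nonneg _)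
          (norm_tubeProj_le M ξ) 2) (dim_pos b).le
  have h3 : ‖M.act (tubeOne (bar b)) ξ‖ ^ 2 ≤ dim b * N := by
    have h4 := sum_norm_homForm b (unitVec b)
    rw [homForm_unitVec, Complex.ofReal_re] at h4
    rw [← toUnitOp_unitVec, toUnitOp_eq_sum, hN, ← h4]
    refine le_trans (pow_le_pow_left₀ (norm_nonneg _) (norm_sum_le _ _) 2) ?_
    simp only [norm_smul]
    exact Finset.sum_mul_sq_le_sq_mul_sq _ _ _
  refine abs_le_of_sq_le_sq' ?_ (mul_nonneg (dim_pos b).le (norm_nonneg _)) |>.2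
  calc _ ≤ dim b * N := h3
    _ ≤ dim b * (dim b * ‖ξ‖ ^ 2) := mul_le_mul_of_nonneg_left h2 (dim_pos b).le
    _ = _ := by ring

/-- The components of `ξ` along `b`, paired with the components along `a` that correspond to them
under `link W`, recover the action of the conjugate of `c`. -/
theorem sum_inner_toUnitOp_link {a b c : Irr C} (W : rep c ⟶ conj b ⊗ rep a) (s : Finset (Irr C))
    (hs : ∀ (i : Irr C) (V : rep b ⟶ rep i ⊗ rep b), V ≠ 0 → i ∈ s) (hW : homForm c _ W W = 1)
    (ξ η : H) :
    ∑ i ∈ s, (dim i : ℂ) * ∑ k, inner ℂ (toUnitOp M i b ((onb b (rep i ⊗ rep b)).2 k) ξ)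
      (toUnitOp M i a (link W ((onb b (rep i ⊗ rep b)).2 k)) η) =
      (dim c : ℂ)⁻¹ * inner ℂ ξ (M.act (tubeOne (bar c)) η) := by
  simp only [inner_toUnitOp, ← inner_sum, ← inner_smul_right]
  rw [← smul_apply, act_tubeOne_bar, ← cornerOp_sum_contract_link W M s hs hW]
  simp only [map_sum, map_smul, sum_apply, smul_apply]

end ModuleIdentities

/-! ### Gaps of positive and of symmetric operators -/

section HilbertSpace

variable {H : Type w} [NormedAddCommGroup H] [InnerProductSpace ℂ H]

/-- Equality in the Cauchy-Schwarz inequality. -/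
theorem eq_smul_of_norm_le_of_le_inner {x y : H} {d : ℝ} (hd : 0 ≤ d) (h1 : ‖y‖ ≤ d * ‖x‖)
    (h2 : d * ‖x‖ ^ 2 ≤ (inner ℂ x y).re) : y = (d : ℂ) • x := by
  have h3 : ‖y - (d : ℂ) • x‖ ^ 2 = ‖y‖ ^ 2 - 2 * (d * (inner ℂ x y).re) + (d * ‖x‖) ^ 2 := by
    have := norm_sub_sq (𝕜 := ℂ) y ((d : ℂ) • x)
    rw [this, inner_smul_right, norm_smul, Complex.norm_real, Real.norm_of_nonneg hd]
    have h4 : RCLike.re ((d : ℂ) * inner ℂ y x) = d * (inner ℂ x y).re := by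
      rw [← inner_conj_symm y x]
      change ((d : ℂ) * starRingEnd ℂ (inner ℂ x y)).re = _
      rw [Complex.re_ofReal_mul, Complex.conj_re]
    rw [h4]
  have h5 : ‖y‖ ^ 2 ≤ (d * ‖x‖) ^ 2 := pow_le_pow_left₀ (norm_nonneg _) h1 2
  have h6 : ‖y - (d : ℂ) • x‖ ^ 2 ≤ 0 := by
    rw [h3]
    nlinarith [mul_le_mul_of_nonneg_left h2 hd]
  have h7 : ‖y - (d : ℂ) • x‖ = 0 := by
    nlinarith [norm_nonneg (y - (d : ℂ) • x)]
  exact sub_eq_zero.mp (norm_eq_zero.mp h7)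

/-- The Cauchy-Schwarz inequality for the form of a positive operator. -/
theorem norm_inner_sq_le_of_positive {B : H →L[ℂ] H}
    (hB : ∀ x y, inner ℂ (B x) y = inner ℂ x (B y)) (hpos : ∀ x, 0 ≤ (inner ℂ (B x) x).re)
    (x y : H) : ‖inner ℂ (B x) y‖ ^ 2 ≤ (inner ℂ (B x) x).re * (inner ℂ (B y) y).re := by
  let c : PreInnerProductSpace.Core ℂ H :=
    { inner := fun x y => inner ℂ (B x) y
      conj_inner_symm := fun x y => by rw [inner_conj_symm, hB]
      re_inner_nonneg := hpos
      add_left := fun x y z => by rw [map_add, inner_add_left]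
      smul_left := fun x y r => by rw [map_smul, inner_smul_left] }
  have h := @InnerProductSpace.Core.inner_mul_inner_self_le ℂ H _ _ _ c x y
  refine le_trans (le_of_eq ?_) h
  rw [sq]
  congr 1
  change ‖inner ℂ (B x) y‖ = ‖inner ℂ (B y) x‖
  rw [hB y x, ← inner_conj_symm, RCLike.norm_conj]

/-- A positive operator with `B² ≥ δ B` is bounded below by `δ` on the orthogonal complement of its
kernel: `⟨B y, y⟩ ≥ δ ‖y‖²` holds on the range of `B` by Cauchy-Schwarz for the form of `B`, and
extends to the closure of the range. -/
theorem mul_norm_le_of_orthogonal_ker [CompleteSpace H] {B : H →L[ℂ] H} {δ : ℝ} (hδ : 0 < δ)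
    (hB : ∀ x y, inner ℂ (B x) y = inner ℂ x (B y)) (hpos : ∀ x, 0 ≤ (inner ℂ (B x) x).re)
    (hgap : ∀ x, δ * (inner ℂ (B x) x).re ≤ ‖B x‖ ^ 2) {v : H}
    (hv : ∀ z, B z = 0 → inner ℂ z v = 0) : δ * ‖v‖ ≤ ‖B v‖ := by
  have h1 : ∀ x, δ * ‖B x‖ ^ 2 ≤ (inner ℂ (B (B x)) (B x)).re := by
    intro x
    rcases (sq_nonneg ‖B x‖).eq_or_lt with h0 | h0
    · rw [← h0, mul_zero]; exact hpos _
    have h2 := norm_inner_sq_le_of_positive hB hpos x (B x)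
    rw [inner_self_eq_ofReal, Complex.norm_real, Real.norm_of_nonneg (sq_nonneg _)] at h2
    have h3 := mul_le_mul_of_nonneg_right (hgap x) (hpos (B x))
    have h4 : ‖B x‖ ^ 2 * (δ * ‖B x‖ ^ 2) ≤ ‖B x‖ ^ 2 * (inner ℂ (B (B x)) (B x)).re := by
      nlinarith
    exact le_of_mul_le_mul_left h4 h0
  have h2 : v ∈ B.range.topologicalClosure := by
    rw [← Submodule.orthogonal_orthogonal_eq_closure]
    refine (Submodule.mem_orthogonal _ _).mpr fun z hz => hv z ?_
    have h3 := (Submodule.mem_orthogonal _ _).mp hz (B (B z)) ⟨B z, rfl⟩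
    rw [hB] at h3
    exact inner_self_eq_zero.mp h3
  have h3 : δ * ‖v‖ ^ 2 ≤ (inner ℂ (B v) v).re := by
    have hclosed : IsClosed {x : H | δ * ‖x‖ ^ 2 ≤ (inner ℂ (B x) x).re} :=
      isClosed_le (by fun_prop) (Complex.continuous_re.comp (by fun_prop))
    refine closure_minimal (s := (B.range : Set H)) ?_ hclosed h2
    rintro _ ⟨x, rfl⟩
    exact h1 x
  rcases (norm_nonneg v).eq_or_lt with h0 | h0
  · rw [← h0, mul_zero]; exact norm_nonneg _
  · have h4 : (inner ℂ (B v) v).re ≤ ‖B v‖ * ‖v‖ := re_inner_le_norm (𝕜 := ℂ) (B v) v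
    refine le_of_mul_le_mul_right ?_ h0
    calc δ * ‖v‖ * ‖v‖ = δ * ‖v‖ ^ 2 := by ring
      _ ≤ _ := h3.trans h4

/-- The spectral gap of a symmetric operator with one-dimensional kernel, spanned by `e`: the left
side is `lam` times the squared norm of the component of `v` orthogonal to `e`. -/
theorem spectral_gap {V : Type*} [AddCommGroup V] [Module ℂ V] [FiniteDimensional ℂ V]
    (c : InnerProductSpace.Core ℂ V) (T : Module.End ℂ V)
    (hT : ∀ x y, c.inner (T x) y = c.inner x (T y)) {e : V} (he0 : e ≠ 0) (he : T e = 0)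
    (hsimple : Module.finrank ℂ (Module.End.eigenspace T 0) = 1) {lam : ℝ}
    (hlam : ∀ μ : ℝ, μ ≠ 0 → Module.End.HasEigenvalue T (μ : ℂ) → lam ≤ μ) (v : V) :
    lam * ((c.inner v v).re - ‖c.inner e v‖ ^ 2 / (c.inner e e).re) ≤ (c.inner v (T v)).re := by
  let : NormedAddCommGroup V := c.toNormedAddCommGroup
  let : InnerProductSpace ℂ V := InnerProductSpace.ofCore c.toCore
  have hsym : T.IsSymmetric := hT
  have hker : ∀ x, T x = 0 → ∃ z : ℂ, x = z • e := by
    intro x hx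
    have hmem : ∀ y, T y = 0 → y ∈ Module.End.eigenspace T 0 := fun y hy => by
      rw [Module.End.mem_eigenspace_iff, hy, zero_smul]
    obtain ⟨z, hz⟩ := (finrank_eq_one_iff_of_nonzero' (⟨e, hmem e he⟩ : Module.End.eigenspace T 0)
      (fun h => he0 (congrArg Subtype.val h))).mp hsimple ⟨x, hmem x hx⟩
    exact ⟨z, (congrArg Subtype.val hz).symm⟩
  have hee : (inner ℂ e e : ℂ) ≠ 0 := fun h => he0 (inner_self_eq_zero.mp h)
  set w := v - (inner ℂ e v / inner ℂ e e : ℂ) • e with hw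
  have hew : inner ℂ e w = 0 := by
    rw [hw, inner_sub_right, inner_smul_right, div_mul_cancel₀ _ hee, sub_self]
  have hTw : T w = T v := by rw [hw, map_sub, map_smul, he, smul_zero, sub_zero]
  have h1 : inner ℂ v (T v) = inner ℂ w (T w) := by
    rw [hTw]
    conv_rhs => rw [hw, inner_sub_left, inner_smul_left, ← hsym e v, he, inner_zero_left, mul_zero,
      sub_zero]
  have h2 : (inner ℂ v v).re - ‖(inner ℂ e v : ℂ)‖ ^ 2 / (inner ℂ e e).re = ‖w‖ ^ 2 := by
    have h3 : inner ℂ w w = inner ℂ v v - ((‖(inner ℂ e v : ℂ)‖ ^ 2 / ‖e‖ ^ 2 : ℝ) : ℂ) := by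
      calc inner ℂ w w = inner ℂ v w := by
            nth_rw 1 [hw]
            rw [inner_sub_left, inner_smul_left, hew, mul_zero, sub_zero]
        _ = inner ℂ v v - inner ℂ e v * starRingEnd ℂ (inner ℂ e v) / inner ℂ e e := by
            rw [hw, inner_sub_right, inner_smul_right, inner_conj_symm]
            ring
        _ = _ := by
            rw [Complex.mul_conj, Complex.normSq_eq_norm_sq, inner_self_eq_ofReal e]
            push_cast
            rfl
    rw [inner_self_eq_ofReal, inner_self_eq_ofReal v, ← Complex.ofReal_sub,
      Complex.ofReal_inj] at h3
    rw [inner_self_eq_ofReal, inner_self_eq_ofReal, Complex.ofReal_re, Complex.ofReal_re, h3]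
  let b := hsym.eigenvectorBasis rfl
  have h3 : ∀ j, b.repr (T w) j = (hsym.eigenvalues rfl j : ℂ) * b.repr w j :=
    fun j => hsym.eigenvectorBasis_apply_self_apply rfl w j
  change lam * ((inner ℂ v v).re - ‖(inner ℂ e v : ℂ)‖ ^ 2 / (inner ℂ e e).re) ≤
    (inner ℂ v (T v)).re
  rw [h1, h2]
  have h4 : inner ℂ w (T w) = ((∑ j, hsym.eigenvalues rfl j * ‖b.repr w j‖ ^ 2 : ℝ) : ℂ) := by
    rw [← b.repr.inner_map_map, PiLp.inner_apply]
    push_cast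
    refine Finset.sum_congr rfl fun j _ => ?_
    rw [h3]
    simp only [RCLike.inner_apply]
    rw [mul_assoc, Complex.mul_conj, Complex.normSq_eq_norm_sq]
    push_cast
    rfl
  rw [h4, Complex.ofReal_re, ← b.repr.norm_map w, EuclideanSpace.norm_sq_eq, Finset.mul_sum]
  refine Finset.sum_le_sum fun j _ => ?_
  by_cases hj : hsym.eigenvalues rfl j = 0
  · have h5 : T (b j) = 0 := by
      rw [hsym.apply_eigenvectorBasis rfl j, hj]; simp
    obtain ⟨z, hz⟩ := hker _ h5
    have h6 : b.repr w j = 0 := by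
      rw [b.repr_apply_apply, hz, inner_smul_left, hew, mul_zero]
    rw [h6]; simp
  · exact mul_le_mul_of_nonneg_right (hlam _ hj (hsym.hasEigenvalue_eigenvalues rfl j))
      (sq_nonneg _)

end HilbertSpace

/-! ### Invariant vectors and the averaging operator -/

section Invariance

variable {C : Type u} [Category.{v} C] [CStarCategory C] [MonoidalCategory C]
  [CStarTensorCategory C] [IsRigid C]
variable {H : Type w} [NormedAddCommGroup H] [InnerProductSpace ℂ H] (M : HilbertModule C H)

/-- The operator of `X` is the sum of the operators of its irreducible components, with
multiplicity. -/
theorem cornerOp_id_eq_sum (X : C) (s : Finset (Irr C))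
    (hs : ∀ (c : Irr C) (f : rep c ⟶ X), f ≠ 0 → c ∈ s) :
    cornerOp M X (𝟙 X) = ∑ c ∈ s, (mult c X : ℂ) • M.act (tubeOne c) := by
  rw [← sum_isotypic X s hs, map_sum]
  refine Finset.sum_congr rfl fun c _ => ?_
  have h : ∀ k, cornerOp M X (dag ((onb c X).2 k) ≫ (onb c X).2 k) =
      (dim c : ℂ)⁻¹ • M.act (tubeOne c) := by
    intro k
    rw [cornerOp_cyclic, comp_dag_eq_homForm, (isONB_onb c X).1, if_pos rfl, map_smul, act_tubeOne,
      one_div]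
  simp only [isotypic, map_smul, map_sum, h, Finset.sum_const, Finset.card_univ, Fintype.card_fin,
    onb_card_eq_mult]
  rw [smul_comm, smul_smul, mul_inv_cancel₀ (dim_ne_zero c), one_smul, Nat.cast_smul_eq_nsmul]

/-- A vector that is invariant under `a` and `e` is invariant under the components of `a e`:
the bounds `‖ξ 1_c‖ ≤ d(c) ‖ξ‖` add up to an equality. -/
theorem tubeOne_eq_of_hom {a e c : Irr C} {ξ : H} (ha : M.act (tubeOne a) ξ = (dim a : ℂ) • ξ)
    (he : M.act (tubeOne e) ξ = (dim e : ℂ) • ξ) (f : rep c ⟶ rep a ⊗ rep e) (hf : f ≠ 0) :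
    M.act (tubeOne c) ξ = (dim c : ℂ) • ξ := by
  have hs : ∀ (c : Irr C) (f : rep c ⟶ rep a ⊗ rep e), f ≠ 0 → c ∈ components (rep a ⊗ rep e) :=
    fun c f hf => mem_components hf
  have h1 : ∑ c ∈ components (rep a ⊗ rep e), (mult c (rep a ⊗ rep e) : ℂ) • M.act (tubeOne c) ξ =
      ((dim a * dim e : ℝ) : ℂ) • ξ := by
    have h2 := cornerOp_cornerOp M (𝟙 (rep a)) (𝟙 (rep e)) ξ
    rw [← act_tubeOne, ← act_tubeOne, ha, map_smul, he, smul_smul] at h2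
    have h3 : rep a ◁ 𝟙 (rep e) ≫ 𝟙 (rep a) ▷ rep e = 𝟙 _ := by simp
    rw [h3, cornerOp_id_eq_sum M _ _ hs] at h2
    simp only [sum_apply, smul_apply] at h2
    rw [← h2]
    push_cast
    rfl
  have hnn : ∀ c, 0 ≤ dim c * ‖ξ‖ ^ 2 - (inner ℂ ξ (M.act (tubeOne c) ξ)).re := by
    intro c
    have h2 : (inner ℂ ξ (M.act (tubeOne c) ξ)).re ≤ ‖ξ‖ * ‖M.act (tubeOne c) ξ‖ :=
      re_inner_le_norm (𝕜 := ℂ) _ _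
    have h3 := mul_le_mul_of_nonneg_left (norm_tubeOne_le M c ξ) (norm_nonneg ξ)
    rw [sub_nonneg]
    calc _ ≤ _ := h2.trans h3
      _ = _ := by ring
  have h2 : ∑ c ∈ components (rep a ⊗ rep e), (mult c (rep a ⊗ rep e) : ℝ) *
      (dim c * ‖ξ‖ ^ 2 - (inner ℂ ξ (M.act (tubeOne c) ξ)).re) = 0 := by
    have h3 := congrArg (fun η => (inner ℂ ξ η).re) h1
    simp only [inner_sum, inner_smul_right, inner_self_eq_ofReal] at h3
    rw [Complex.re_sum, ← Complex.ofReal_mul, Complex.ofReal_re] at h3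
    simp only [← Complex.ofReal_natCast, Complex.re_ofReal_mul] at h3
    simp only [mul_sub, Finset.sum_sub_distrib, h3, dim_mul_dim a e _ hs, Finset.sum_mul, mul_assoc,
      sub_self]
  have h3 := (Finset.sum_eq_zero_iff_of_nonneg fun c _ =>
    mul_nonneg (Nat.cast_nonneg _) (hnn c)).mp h2 c (hs c f hf)
  have h4 : (mult c (rep a ⊗ rep e) : ℝ) ≠ 0 := by
    have : Nontrivial (rep c ⟶ rep a ⊗ rep e) := ⟨f, 0, hf⟩
    exact_mod_cast (Module.finrank_pos (R := ℂ) (M := rep c ⟶ rep a ⊗ rep e)).ne'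
  refine eq_smul_of_norm_le_of_le_inner (dim_pos c).le (norm_tubeOne_le M c ξ) ?_
  linarith [(mul_eq_zero.mp h3).resolve_left h4]

/-- A vector of the corner that is invariant under a generating set is invariant, by induction on
the length of a tensor product of generators. -/
theorem isInvariant_of_generates {S : Finset (Irr C)} (hgen : Generates S) {ξ : H}
    (hp : M.act (tubeProj (unitIrr C)) ξ = ξ)
    (hS : ∀ a ∈ S, M.act (tubeOne a) ξ = (dim a : ℂ) • ξ) : IsInvariant M ξ := by
  have key : ∀ l : List (Irr C), (∀ a ∈ l, a ∈ S) → ∀ (c : Irr C) (f : rep c ⟶ tensorList l),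
      f ≠ 0 → M.act (tubeOne c) ξ = (dim c : ℂ) • ξ := by
    intro l
    induction l with
    | nil =>
      intro _ c f hf
      have hc : c = unitIrr C := irrOf_eq_of_hom_ne_zero CStarTensorCategory.unit_irreducible f hf
      rw [hc, act_tubeOne_unitIrr, hp, dim_unitIrr, Complex.ofReal_one, one_smul]
    | cons a l ih =>
      intro hl c f hf
      change rep c ⟶ rep a ⊗ tensorList l at f
      obtain ⟨e, W, hW⟩ : ∃ (e : Irr C) (W : rep e ⟶ tensorList l), f ≫ rep a ◁ dag W ≠ 0 := by
        by_contra hcon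
        push Not at hcon
        apply hf
        have h1 : f ≫ rep a ◁ ∑ e ∈ components (tensorList l), isotypic e (tensorList l) = 0 := by
          simp only [isotypic, whiskerLeft_sum, MonoidalLinear.whiskerLeft_smul,
            Preadditive.comp_sum, Linear.comp_smul, MonoidalCategory.whiskerLeft_comp]
          simp only [← Category.assoc, hcon, Limits.zero_comp, Finset.sum_const_zero, smul_zero]
        rwa [sum_isotypic _ _ fun c f hf => mem_components hf, MonoidalCategory.whiskerLeft_id,
          Category.comp_id] at h1
      refine tubeOne_eq_of_hom M (hS a (hl a List.mem_cons_self))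
        (ih (fun b hb => hl b (List.mem_cons_of_mem a hb)) e W ?_) _ hW
      rintro rfl
      exact hW (by rw [dag_zero]; simp)
  intro c
  obtain ⟨l, hl, f, hf⟩ := hgen c
  exact key l hl c f hf

/-- The total weight `∑_{α ∈ S} ν(α) d(α)`, which normalizes the average. -/
def totalWeight (S : Finset (Irr C)) : ℝ := ∑ a ∈ S, weight S a * dim a

/-- The average of the operators `1_α`, `α ∈ S`, with the weights `ν(α)`. -/
def averaging (S : Finset (Irr C)) : H →L[ℂ] H :=
  ((totalWeight S)⁻¹ : ℂ) • ∑ a ∈ S, (weight S a : ℂ) • M.act (tubeOne a)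

theorem weight_bar {S : Finset (Irr C)} (h : IsSymmetricSet S) (a : Irr C) :
    weight S (bar a) = weight S a := by
  have h1 := weight_mul_dim S (bar a)
  rw [dim_bar, linkDegree_bar h, ← weight_mul_dim] at h1
  exact mul_right_cancel₀ (dim_pos a).ne' h1

theorem inner_averaging {S : Finset (Irr C)} (h : IsSymmetricSet S) (ξ η : H) :
    inner ℂ (averaging M S ξ) η = inner ℂ ξ (averaging M S η) := by
  simp only [averaging, sum_apply, smul_apply, inner_smul_left, inner_smul_right, sum_inner,
    inner_sum, inner_tubeOne, map_inv₀, Complex.conj_ofReal]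
  congr 1
  rw [← sum_bar h]
  simp only [bar_bar, weight_bar h]

theorem tubeProj_averaging (S : Finset (Irr C)) (ξ : H) :
    M.act (tubeProj (unitIrr C)) (averaging M S ξ) = averaging M S ξ := by
  simp only [averaging, sum_apply, smul_apply, map_smul, map_sum, tubeProj_tubeOne]

theorem averaging_tubeProj (S : Finset (Irr C)) (ξ : H) :
    averaging M S (M.act (tubeProj (unitIrr C)) ξ) = averaging M S ξ := by
  simp only [averaging, sum_apply, smul_apply, tubeOne_tubeProj]

variable {S : Finset (Irr C)} (hweight : ∀ a ∈ S, 0 < weight S a) (hne : S.Nonempty)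
include hweight hne

theorem totalWeight_pos : 0 < totalWeight S :=
  Finset.sum_pos (fun a ha => mul_pos (hweight a ha) (dim_pos a)) hne

theorem sub_averaging (ξ : H) : ξ - averaging M S ξ = ((totalWeight S)⁻¹ : ℂ) •
    ∑ a ∈ S, (weight S a : ℂ) • ((dim a : ℂ) • ξ - M.act (tubeOne a) ξ) := by
  have h : (totalWeight S : ℂ) ≠ 0 := by exact_mod_cast (totalWeight_pos hweight hne).ne'
  simp only [smul_sub, Finset.sum_sub_distrib, averaging, sum_apply, smul_apply]
  congr 1
  simp only [smul_smul, ← Finset.sum_smul]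
  have h2 : ∑ a ∈ S, (weight S a : ℂ) * (dim a : ℂ) = totalWeight S := by
    rw [totalWeight]; push_cast; rfl
  rw [h2, inv_mul_cancel₀ h, one_smul]

theorem norm_averaging_le (ξ : H) : ‖averaging M S ξ‖ ≤ ‖ξ‖ := by
  have h := totalWeight_pos hweight hne
  rw [averaging, smul_apply, norm_smul, norm_inv, Complex.norm_real, Real.norm_of_nonneg h.le,
    inv_mul_le_iff₀ h, sum_apply, totalWeight, Finset.sum_mul]
  refine (norm_sum_le _ _).trans (Finset.sum_le_sum fun a ha => ?_)
  rw [smul_apply, norm_smul, Complex.norm_real, Real.norm_of_nonneg (hweight a ha).le, mul_assoc]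
  exact mul_le_mul_of_nonneg_left (norm_tubeOne_le M a ξ) (hweight a ha).le

/-- A vector that is fixed by the average is fixed by each term, up to the factor `d(α)`: the terms
are bounded by `ν(α) d(α) ‖ξ‖`, so that the triangle inequality is an equality. -/
theorem tubeOne_eq_of_averaging_eq {ξ : H} (hξ : averaging M S ξ = ξ) (a : Irr C) (ha : a ∈ S) :
    M.act (tubeOne a) ξ = (dim a : ℂ) • ξ := by
  have h := totalWeight_pos hweight hne
  have hnn : ∀ c, 0 ≤ dim c * ‖ξ‖ ^ 2 - (inner ℂ ξ (M.act (tubeOne c) ξ)).re := by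
    intro c
    have h2 : (inner ℂ ξ (M.act (tubeOne c) ξ)).re ≤ ‖ξ‖ * ‖M.act (tubeOne c) ξ‖ :=
      re_inner_le_norm (𝕜 := ℂ) _ _
    have h3 := mul_le_mul_of_nonneg_left (norm_tubeOne_le M c ξ) (norm_nonneg ξ)
    rw [sub_nonneg]
    calc _ ≤ _ := h2.trans h3
      _ = _ := by ring
  have h1 := sub_averaging M hweight hne ξ
  rw [hξ, sub_self, eq_comm, smul_eq_zero] at h1
  have h2 := h1.resolve_left (inv_ne_zero (by exact_mod_cast h.ne'))
  have h3 : ∑ c ∈ S, weight S c * (dim c * ‖ξ‖ ^ 2 - (inner ℂ ξ (M.act (tubeOne c) ξ)).re) = 0 := by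
    have h4 := congrArg (fun η => (inner ℂ ξ η).re) h2
    simp only [inner_sum, inner_smul_right, inner_sub_right, inner_self_eq_ofReal, inner_zero_right,
      Complex.re_sum, Complex.re_ofReal_mul, Complex.sub_re, Complex.zero_re,
      Complex.ofReal_re] at h4
    exact h4
  have h4 := (Finset.sum_eq_zero_iff_of_nonneg fun c hc =>
    mul_nonneg (hweight c hc).le (hnn c)).mp h3 a ha
  refine eq_smul_of_norm_le_of_le_inner (dim_pos a).le (norm_tubeOne_le M a ξ) ?_
  linarith [(mul_eq_zero.mp h4).resolve_left (hweight a ha).ne']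

/-- An almost invariant vector is almost fixed by the average. -/
theorem norm_sub_averaging_lt {δ : ℝ} {ξ : H} (hξ : IsAlmostInvariant M S δ ξ) :
    ‖ξ - averaging M S ξ‖ < δ * ‖ξ‖ := by
  have h := totalWeight_pos hweight hne
  rw [sub_averaging M hweight hne, norm_smul, norm_inv, Complex.norm_real, Real.norm_of_nonneg h.le,
    inv_mul_lt_iff₀ h, totalWeight, Finset.sum_mul]
  refine lt_of_le_of_lt (norm_sum_le _ _) (Finset.sum_lt_sum_of_nonempty hne fun a ha => ?_)
  rw [norm_smul, Complex.norm_real, Real.norm_of_nonneg (hweight a ha).le, norm_sub_rev, mul_assoc]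
  refine mul_lt_mul_of_pos_left ?_ (hweight a ha)
  rw [← mul_assoc]
  exact hξ a ha

/-- A spectral gap of the average yields invariant vectors: `B = p - A`, with `p` the projection
onto the corner, satisfies `B² ≥ (2 - lam⁻¹) B`, and its kernel on the corner consists of the
invariant vectors. If there were no nonzero ones, `ξ` would be orthogonal to the kernel, so that `‖ξ
- A ξ‖ ≥ (2 - lam⁻¹) ‖ξ‖`. -/
theorem exists_invariant_of_gap [CompleteSpace H] (hsymm : IsSymmetricSet S) (hgen : Generates S)
    {lam : ℝ} (hlam : 1 / 2 < lam)
    (hgap : ∀ ξ : H, M.act (tubeProj (unitIrr C)) ξ = ξ →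
      lam * (‖ξ‖ ^ 2 - ‖averaging M S ξ‖ ^ 2) ≤ ‖ξ‖ ^ 2 - (inner ℂ ξ (averaging M S ξ)).re)
    {ξ : H} (hpξ : M.act (tubeProj (unitIrr C)) ξ = ξ)
    (hξ : IsAlmostInvariant M S (2 - lam⁻¹) ξ) : ∃ η : H, η ≠ 0 ∧ IsInvariant M η := by
  set p := M.act (tubeProj (unitIrr C)) with hp
  set A := averaging M S with hA
  let B : H →L[ℂ] H := p - A
  have hlam0 : 0 < lam := by linarith
  have hBp : ∀ x, B x = p x - A (p x) := fun x => by
    rw [hA, hp, averaging_tubeProj]; rfl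
  have hpp : ∀ x, p (p x) = p x := tubeProj_tubeProj M
  have hre : ∀ x, (inner ℂ (B x) x).re = ‖p x‖ ^ 2 - (inner ℂ (p x) (A (p x))).re := by
    intro x
    have h1 : p (B x) = B x := by
      rw [hBp, map_sub, hpp, hA, hp, tubeProj_averaging]
    rw [← h1, hp, inner_tubeProj, ← hp, hBp, inner_sub_left, inner_self_eq_ofReal,
      Complex.sub_re, Complex.ofReal_re, hA, inner_averaging M hsymm]
  have hnorm : ∀ x, ‖B x‖ ^ 2 = ‖p x‖ ^ 2 - 2 * (inner ℂ (p x) (A (p x))).re + ‖A (p x)‖ ^ 2 := by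
    intro x
    rw [hBp]
    exact norm_sub_sq (𝕜 := ℂ) _ _
  have hB : ∀ x y, inner ℂ (B x) y = inner ℂ x (B y) := by
    intro x y
    change inner ℂ (p x - A x) y = inner ℂ x (p y - A y)
    rw [inner_sub_left, inner_sub_right, hp, inner_tubeProj, hA, inner_averaging M hsymm]
  have hpos : ∀ x, 0 ≤ (inner ℂ (B x) x).re := by
    intro x
    rw [hre, sub_nonneg]
    have h1 : (inner ℂ (p x) (A (p x))).re ≤ ‖p x‖ * ‖A (p x)‖ := re_inner_le_norm (𝕜 := ℂ) _ _
    have h2 := mul_le_mul_of_nonneg_left (norm_averaging_le M hweight hne (p x))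
      (norm_nonneg (p x))
    rw [sq]
    exact h1.trans h2
  have hδ : 0 < 2 - lam⁻¹ := by
    have : lam⁻¹ < 2 := by
      rw [inv_lt_comm₀ hlam0 two_pos]
      linarith
    linarith
  have hBgap : ∀ x, (2 - lam⁻¹) * (inner ℂ (B x) x).re ≤ ‖B x‖ ^ 2 := by
    intro x
    have h1 := hgap (p x) (hpp x)
    have h2 : lam * ((2 - lam⁻¹) * (inner ℂ (B x) x).re) ≤ lam * ‖B x‖ ^ 2 := by
      rw [← mul_assoc, mul_sub, mul_inv_cancel₀ hlam0.ne', hre, hnorm]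
      linarith
    exact le_of_mul_le_mul_left h2 hlam0
  by_contra hcon
  push Not at hcon
  refine absurd (norm_sub_averaging_lt M hweight hne hξ) (not_lt.mpr ?_)
  have h1 := mul_norm_le_of_orthogonal_ker hδ hB hpos hBgap (v := ξ) fun z hz => ?_
  · rwa [hBp, hpξ] at h1
  · -- `p z` is fixed by the average, hence invariant
    have h2 : A (p z) = p z := by
      rw [hBp, sub_eq_zero] at hz
      exact hz.symm
    have h3 : p z = 0 := by
      by_contra h0
      exact hcon (p z) h0 (isInvariant_of_generates M hgen (hpp z)
        (tubeOne_eq_of_averaging_eq M hweight hne h2))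
    rw [← hpξ, hp, ← inner_tubeProj, ← hp, h3, inner_zero_left]

omit hweight hne in
/-- For `δ ≤ 1` the projection `p` onto the corner of the unit object preserves almost invariance:
on the component `ξ - p ξ`, which all `1_α` annihilate, the defect is exactly `d(α) ‖ξ - p ξ‖`. -/
theorem isAlmostInvariant_tubeProj {δ : ℝ} (h0 : 0 ≤ δ) (h1 : δ ≤ 1) {ξ : H}
    (hξ : IsAlmostInvariant M S δ ξ) :
    IsAlmostInvariant M S δ (M.act (tubeProj (unitIrr C)) ξ) := by
  intro a ha
  have h := hξ a ha
  set p := M.act (tubeProj (unitIrr C)) with hp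
  have hpp : ∀ x, p (p x) = p x := tubeProj_tubeProj M
  have horth : ∀ x, inner ℂ (p x) (ξ - p ξ) = 0 := by
    intro x
    rw [hp, inner_tubeProj, ← hp, map_sub, hpp, sub_self, inner_zero_right]
  have hpyth : ∀ (x : H) (r : ℝ), ‖p x - (r : ℂ) • (ξ - p ξ)‖ ^ 2 =
      ‖p x‖ ^ 2 + r ^ 2 * ‖ξ - p ξ‖ ^ 2 := by
    intro x r
    rw [norm_sub_sq (𝕜 := ℂ), inner_smul_right, horth, norm_smul, Complex.norm_real, mul_pow,
      Real.norm_eq_abs, sq_abs]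
    simp
  rw [hp, tubeOne_tubeProj, ← hp]
  have e1 : M.act (tubeOne a) ξ - (dim a : ℂ) • ξ =
      p (M.act (tubeOne a) ξ - (dim a : ℂ) • ξ) - (dim a : ℂ) • (ξ - p ξ) := by
    rw [map_sub, map_smul, hp, tubeProj_tubeOne, smul_sub]
    abel
  have e2 : ‖M.act (tubeOne a) ξ - (dim a : ℂ) • p ξ‖ =
      ‖p (M.act (tubeOne a) ξ - (dim a : ℂ) • ξ)‖ := by
    rw [map_sub, map_smul, hp, tubeProj_tubeOne]
  have e3 : ‖ξ‖ ^ 2 = ‖p ξ‖ ^ 2 + ‖ξ - p ξ‖ ^ 2 := by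
    have := hpyth ξ (-1)
    have h2 : p ξ - ((-1 : ℝ) : ℂ) • (ξ - p ξ) = ξ := by simp
    rw [h2] at this
    linarith
  have e4 := hpyth (M.act (tubeOne a) ξ - (dim a : ℂ) • ξ) (dim a)
  rw [← e1, ← e2] at e4
  have h2 : ‖M.act (tubeOne a) ξ - (dim a : ℂ) • ξ‖ ^ 2 < (dim a * δ * ‖ξ‖) ^ 2 :=
    pow_lt_pow_left₀ h (norm_nonneg _) two_ne_zero
  rw [e4, mul_pow, e3] at h2
  have h3 : (dim a * δ) ^ 2 * ‖ξ - p ξ‖ ^ 2 ≤ dim a ^ 2 * ‖ξ - p ξ‖ ^ 2 := by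
    refine mul_le_mul_of_nonneg_right ?_ (sq_nonneg _)
    exact pow_le_pow_left₀ (mul_nonneg (dim_pos a).le h0)
      (mul_le_of_le_one_right (dim_pos a).le h1) 2
  refine lt_of_pow_lt_pow_left₀ 2 (mul_nonneg (mul_nonneg (dim_pos a).le h0) (norm_nonneg _)) ?_
  rw [mul_pow]
  linarith

omit hweight hne in
theorem IsCornerKazhdanPair.isKazhdanPair {δ ε : ℝ} (h : IsCornerKazhdanPair.{w} S δ) (hε : 0 < ε)
    (h1 : ε ≤ 1) (hδ : ε ≤ δ) : IsKazhdanPair.{w} S ε := by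
  refine ⟨hε, fun H _ _ _ M ⟨ξ, hξ⟩ => h.2 H M ⟨_, tubeProj_tubeProj M ξ, fun a ha => ?_⟩⟩
  refine lt_of_lt_of_le (isAlmostInvariant_tubeProj M hε.le h1 hξ a ha) ?_
  exact mul_le_mul_of_nonneg_right (mul_le_mul_of_nonneg_left hδ (dim_pos a).le) (norm_nonneg _)

end Invariance

/-! ### The form of the Laplacian -/

section Forms

variable {C : Type u} [Category.{v} C] [CStarCategory C] [MonoidalCategory C]
  [CStarTensorCategory C] [IsRigid C]

/-- The transform `tilde` preserves inner products, up to the normalization of the trace. -/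
theorem tilde_comp_dag_tilde (i b : Irr C) (V V' : rep b ⟶ rep i ⊗ rep b) :
    tilde i b V' ≫ dag (tilde i b V) = (homForm b _ V V' / dim b) • 𝟙 _ := by
  obtain ⟨z, hz⟩ := (conj_irreducible b).2 (tilde i b V' ≫ dag (tilde i b V))
  obtain ⟨Q, rfl⟩ := exists_frobenius_eq i b V
  obtain ⟨R, rfl⟩ := exists_frobenius_eq i b V'
  rw [hz]
  congr 1
  have hb := rep_irreducible b
  rw [eq_div_iff (dim_ne_zero b), homForm_frobenius, homForm_apply,
    ← ((std b).prod hb (conj_irreducible b) ((std b).swap hb)).tr_comp i Q (dag R),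
    StandardSolution.tr_prod]
  have h1 : cup (std b).t (conj b ⊗ (rep b ⊗ 𝟙_ C)) ≫ conj b ◁ nestMap (dag R ≫ Q) (rep b ⊗ 𝟙_ C) ≫
      cap (std b).t (conj b ⊗ (rep b ⊗ 𝟙_ C)) = z • 𝟙 _ := by
    have h2 : split (tilde i b (frobenius i b R)) (rep b ⊗ 𝟙_ C) ≫
        dag (split (tilde i b (frobenius i b Q)) (rep b ⊗ 𝟙_ C)) = z • 𝟙 _ := by
      rw [split_comp_dag_split, hz]
      simp
    rw [← h2, split_tilde_frobenius, split_tilde_frobenius, ← dag_split_comp_split]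
    simp
  apply smul_id_injective (CStarTensorCategory.unit_irreducible (C := C))
  rw [mixedTrace, smul_unitScalar]
  have h3 := (std b).tr_id_smul' z (𝟙_ C)
  rw [← h1, show (std b).tr (𝟙 _) = dim b from Tr_id b] at h3
  rw [← h3]
  change _ = cup (std b).t (𝟙_ C) ≫ conj b ◁ (rep b ◁ cup (std b).t (𝟙_ C) ≫
    nestMap (dag R ≫ Q) _ ≫ rep b ◁ cap (std b).t (𝟙_ C)) ≫ cap (std b).t (𝟙_ C)
  simp only [MonoidalCategory.whiskerLeft_comp, Category.assoc]
  rw [cap_naturality, ← cup_naturality_assoc]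

/-- The irreducible objects that contribute to the vertex space. -/
def linkIndex (S : Finset (Irr C)) : Finset (Irr C) := by
  classical exact S.biUnion fun a => components (rep a ⊗ conj a)

theorem mem_linkIndex {S : Finset (Irr C)} {a i : Irr C} (ha : a ∈ S) {V : rep a ⟶ rep i ⊗ rep a}
    (hV : V ≠ 0) : i ∈ linkIndex S := by
  classical
  obtain ⟨Q, rfl⟩ := exists_frobenius_eq i a V
  exact Finset.mem_biUnion.mpr ⟨a, ha,
    mem_components (f := Q) fun h => hV (by rw [h, map_zero])⟩

variable (S : Finset (Irr C))

theorem vertexInner_eq_sum (x y : VertexSpace S) : vertexInner S x y = ∑ a : S,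
    ∑ i ∈ linkIndex S, (weight S a.1 : ℂ) * homForm a.1 _ (x (a, i)) (y (a, i)) := by
  refine Finset.sum_congr rfl fun a _ => finsum_eq_sum_of_support_subset _ fun i hi => ?_
  refine mem_linkIndex a.2 (V := x (a, i)) fun h => hi ?_
  simp only [h, map_zero, LinearMap.zero_apply, mul_zero]

variable {S} in
/-- The inner product of the vertex space. It is definite because the weight is positive. -/
@[reducible]
def vertexCore (hweight : ∀ a ∈ S, 0 < weight S a) :
    InnerProductSpace.Core ℂ (VertexSpace S) where
  inner := vertexInner S
  conj_inner_symm x y := by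
    simp only [vertexInner_eq_sum, map_sum, map_mul, Complex.conj_ofReal, homForm_conj_symm]
  re_inner_nonneg x := by
    simp only [vertexInner_eq_sum, map_sum]
    refine Finset.sum_nonneg fun a _ => Finset.sum_nonneg fun i _ => ?_
    change 0 ≤ ((weight S a.1 : ℂ) * _).re
    rw [Complex.re_ofReal_mul]
    exact mul_nonneg (hweight a.1 a.2).le ((homCore a.1 _).re_inner_nonneg _)
  add_left x y z := by
    simp only [vertexInner_eq_sum, Pi.add_apply, map_add, LinearMap.add_apply, mul_add,
      Finset.sum_add_distrib]
  smul_left x y r := by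
    simp only [vertexInner_eq_sum, Pi.smul_apply, LinearMap.map_smulₛₗ, LinearMap.smul_apply,
      smul_eq_mul, Finset.mul_sum]
    exact Finset.sum_congr rfl fun a _ => Finset.sum_congr rfl fun i _ => mul_left_comm _ _ _
  definite x hx := by
    have hnn : ∀ (a : S) (i : Irr C), 0 ≤ weight S a.1 * (homForm a.1 _ (x (a, i)) (x (a, i))).re :=
      fun a i => mul_nonneg (hweight a.1 a.2).le ((homCore a.1 _).re_inner_nonneg _)
    change vertexInner S x x = 0 at hx
    rw [vertexInner_eq_sum] at hx
    have h1 := congrArg Complex.re hx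
    simp only [Complex.re_sum, Complex.re_ofReal_mul, Complex.zero_re] at h1
    rw [Finset.sum_eq_zero_iff_of_nonneg fun a _ => Finset.sum_nonneg fun i _ => hnn a i] at h1
    funext ⟨a, i⟩
    by_contra h0
    have h2 := (Finset.sum_eq_zero_iff_of_nonneg fun i _ => hnn a i).mp
      (h1 a (Finset.mem_univ a)) i (mem_linkIndex a.2 h0)
    have h3 := (mul_eq_zero.mp h2).resolve_left (hweight a.1 a.2).ne'
    refine h0 (homForm_self_eq_zero (Complex.ext h3 ?_))
    have h4 := homForm_conj_symm a.1 _ (x (a, i)) (x (a, i))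
    exact Complex.conj_eq_iff_im.mp h4

/-- Only the components with index in `linkIndex S` can be nonzero. -/
instance : FiniteDimensional ℂ (VertexSpace S) := by
  let f : VertexSpace S →ₗ[ℂ]
      (∀ p : S × linkIndex S, rep p.1.1 ⟶ rep p.2.1 ⊗ rep p.1.1) :=
    LinearMap.pi fun p => LinearMap.proj (p.1, p.2.1)
  refine FiniteDimensional.of_injective f ((injective_iff_map_eq_zero f).mpr fun x hx => ?_)
  funext ⟨a, i⟩
  by_contra h0
  exact h0 (congrFun hx (a, ⟨i, mem_linkIndex a.2 h0⟩))

/-- The morphism `1 ⊗ V - Ṽ' ⊗ 1` from `b̄ a` to `b̄ i a`, the difference of source and target on an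
edge. -/
def edgeDiff {i a b : Irr C} (V : rep a ⟶ rep i ⊗ rep a) (V' : rep b ⟶ rep i ⊗ rep b) :
    conj b ⊗ rep a ⟶ conj b ⊗ (rep i ⊗ rep a) :=
  conj b ◁ V - tilde i b V' ▷ rep a ≫ (α_ _ _ _).hom

theorem sourceMap_sub_targetMap (x : VertexSpace S) (p : S × S × S × Irr C) :
    (sourceMap S - targetMap S) x p = ∑ k, ((onb p.2.2.1.1 (conj p.2.1.1 ⊗ rep p.1.1)).2 k ≫
      edgeDiff (x (p.1, p.2.2.2)) (x (p.2.1, p.2.2.2))) ⊗ₜ[ℂ]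
        dag ((onb p.2.2.1.1 (conj p.2.1.1 ⊗ rep p.1.1)).2 k) := by
  simp only [edgeDiff, Preadditive.comp_sub, TensorProduct.sub_tmul, Finset.sum_sub_distrib]
  rfl

/-- The second tensor factors are orthonormal, so that only the diagonal terms survive. -/
theorem edgeSummandForm_sum {a b c i : Irr C} {n : ℕ} {W : Fin n → (rep c ⟶ conj b ⊗ rep a)}
    (hW : IsONB c _ W) (T T' : conj b ⊗ rep a ⟶ conj b ⊗ (rep i ⊗ rep a)) :
    edgeSummandForm a b c i (∑ k, (W k ≫ T) ⊗ₜ[ℂ] dag (W k)) (∑ k, (W k ≫ T') ⊗ₜ[ℂ] dag (W k)) =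
      ∑ k, Tr c (W k ≫ (T' ≫ dag T) ≫ dag (W k)) := by
  simp only [map_sum, LinearMap.sum_apply, edgeSummandForm_tmul, CStarCategory.dag_comp,
    CStarCategory.dag_dag, Category.assoc]
  refine Finset.sum_congr rfl fun k _ => ?_
  rw [Finset.sum_eq_single k]
  · have := hW.1 k k
    rw [if_pos rfl, homForm_apply] at this
    rw [this, mul_one]
  · intro l _ hl
    have := hW.1 k l
    rw [if_neg hl.symm, homForm_apply] at this
    rw [this, mul_zero]
  · simp

/-- The cross term of the form of the Laplacian on an edge, that is the sum of the traces
`Tr_c(W* (contract V V') W)` over an orthonormal basis of morphisms `W : c → b̄ a`. -/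
def crossTerm {i a b : Irr C} (c : Irr C) (V : rep b ⟶ rep i ⊗ rep b)
    (V' : rep a ⟶ rep i ⊗ rep a) : ℂ :=
  ∑ k, homForm a _ (link ((onb c (conj b ⊗ rep a)).2 k) V) V'

theorem edgeDiff_comp_dag {i a b : Irr C} (V V' : rep a ⟶ rep i ⊗ rep a)
    (U U' : rep b ⟶ rep i ⊗ rep b) : edgeDiff V' U' ≫ dag (edgeDiff V U) =
      (homForm a _ V V' / dim a + homForm b _ U U' / dim b) • 𝟙 _ - contract i b a U V' -
        dag (contract i b a U' V) := by
  have h1 : dag (edgeDiff V U) = conj b ◁ dag V - (α_ _ _ _).inv ≫ dag (tilde i b U) ▷ rep a := by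
    rw [edgeDiff, dag_sub]; simp
  rw [h1, edgeDiff, Preadditive.sub_comp, Preadditive.comp_sub, Preadditive.comp_sub]
  have h2 : conj b ◁ V' ≫ conj b ◁ dag V = (homForm a _ V V' / dim a) • 𝟙 _ := by
    rw [← MonoidalCategory.whiskerLeft_comp, comp_dag_eq_homForm]; simp
  have h3 : (tilde i b U' ▷ rep a ≫ (α_ _ _ _).hom) ≫ (α_ _ _ _).inv ≫ dag (tilde i b U) ▷ rep a =
      (homForm b _ U U' / dim b) • 𝟙 _ := by
    rw [Category.assoc, Iso.hom_inv_id_assoc, ← comp_whiskerRight, tilde_comp_dag_tilde]; simp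
  have h4 : (tilde i b U' ▷ rep a ≫ (α_ _ _ _).hom) ≫ conj b ◁ dag V =
      dag (contract i b a U' V) := by
    simp [contract]
  have h5 : conj b ◁ V' ≫ (α_ _ _ _).inv ≫ dag (tilde i b U) ▷ rep a = contract i b a U V' := rfl
  rw [h2, h3, h4, h5, add_smul]
  abel

theorem edgeSummandForm_eq (a b c i : Irr C) (V V' : rep a ⟶ rep i ⊗ rep a)
    (U U' : rep b ⟶ rep i ⊗ rep b) :
    edgeSummandForm a b c i
      (∑ k, ((onb c (conj b ⊗ rep a)).2 k ≫ edgeDiff V U) ⊗ₜ[ℂ] dag ((onb c _).2 k))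
      (∑ k, ((onb c (conj b ⊗ rep a)).2 k ≫ edgeDiff V' U') ⊗ₜ[ℂ] dag ((onb c _).2 k)) =
      mult c (conj b ⊗ rep a) * (homForm a _ V V' / dim a) +
        mult c (conj b ⊗ rep a) * (homForm b _ U U' / dim b) - crossTerm c U V' -
          starRingEnd ℂ (crossTerm c U' V) := by
  rw [edgeSummandForm_sum (isONB_onb c _)]
  have h : ∀ k, Tr c ((onb c (conj b ⊗ rep a)).2 k ≫ (edgeDiff V' U' ≫ dag (edgeDiff V U)) ≫
      dag ((onb c (conj b ⊗ rep a)).2 k)) = (homForm a _ V V' / dim a + homForm b _ U U' / dim b) -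
        homForm a _ (link ((onb c (conj b ⊗ rep a)).2 k) U) V' -
          starRingEnd ℂ (homForm a _ (link ((onb c (conj b ⊗ rep a)).2 k) U') V) := by
    intro k
    have h1 := (isONB_onb c (conj b ⊗ rep a)).1 k k
    rw [if_pos rfl, homForm_apply] at h1
    rw [edgeDiff_comp_dag, homForm_link, homForm_link, ← Tr_dag]
    simp only [Preadditive.sub_comp, Preadditive.comp_sub, map_sub, Linear.smul_comp,
      Linear.comp_smul, Category.id_comp, map_smul, h1, smul_eq_mul, mul_one,
      CStarCategory.dag_comp, CStarCategory.dag_dag, Category.assoc]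
  simp only [h, Finset.sum_sub_distrib, Finset.sum_const, Finset.card_univ, Fintype.card_fin,
    onb_card_eq_mult, nsmul_eq_mul, crossTerm, map_sum]
  ring

/-- The cross term of the form of the Laplacian, a sesquilinear form on the vertex space. -/
def crossForm (x y : VertexSpace S) : ℂ := ∑ a : S, ∑ b : S, ∑ c : S, ∑ i ∈ linkIndex S,
  crossTerm c.1 (x (b, i)) (y (a, i))

theorem link_zero {i a b c : Irr C} (W : rep c ⟶ conj b ⊗ rep a) :
    link W (0 : rep b ⟶ rep i ⊗ rep b) = 0 := by
  simp [link]

variable {S}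

/-- The form of the Laplacian. The two diagonal terms agree because the degree of a vertex of the
link does not depend on whether it is taken as the source or as the target of edges. -/
theorem edgeInner_eq (hsymm : IsSymmetricSet S) (x y : VertexSpace S) :
    edgeInner S ((sourceMap S - targetMap S) x) ((sourceMap S - targetMap S) y) =
      2 * vertexInner S x y - crossForm S x y - starRingEnd ℂ (crossForm S y x) := by
  have h1 : ∀ a b c : S, ∑ᶠ i : Irr C, edgeSummandForm a.1 b.1 c.1 i
      ((sourceMap S - targetMap S) x (a, b, c, i)) ((sourceMap S - targetMap S) y (a, b, c, i)) =
      ∑ i ∈ linkIndex S, (mult c.1 (conj b.1 ⊗ rep a.1) *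
        (homForm a.1 _ (x (a, i)) (y (a, i)) / dim a.1) + mult c.1 (conj b.1 ⊗ rep a.1) *
        (homForm b.1 _ (x (b, i)) (y (b, i)) / dim b.1) - crossTerm c.1 (x (b, i)) (y (a, i)) -
          starRingEnd ℂ (crossTerm c.1 (y (b, i)) (x (a, i)))) := by
    intro a b c
    rw [finsum_eq_sum_of_support_subset (s := linkIndex S)]
    · refine Finset.sum_congr rfl fun i _ => ?_
      rw [sourceMap_sub_targetMap, sourceMap_sub_targetMap, edgeSummandForm_eq]
    · intro i hi
      by_contra h0
      have hz : ∀ (a : S) (z : VertexSpace S), z (a, i) = 0 := fun a z => by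
        by_contra h; exact h0 (mem_linkIndex a.2 h)
      apply hi
      change edgeSummandForm a.1 b.1 c.1 i _ _ = 0
      rw [sourceMap_sub_targetMap, sourceMap_sub_targetMap, edgeSummandForm_eq]
      simp only [hz, crossTerm, link_zero, map_zero]
      simp
  simp only [edgeInner, h1, Finset.sum_sub_distrib, Finset.sum_add_distrib, crossForm, map_sum]
  congr 2
  have h2 : ∑ a : S, ∑ b : S, ∑ c : S, ∑ i ∈ linkIndex S, (mult c.1 (conj b.1 ⊗ rep a.1) : ℂ) *
        (homForm a.1 _ (x (a, i)) (y (a, i)) / dim a.1) = vertexInner S x y := by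
    rw [vertexInner_eq_sum]
    refine Finset.sum_congr rfl fun a _ => ?_
    have h4 : ∀ i, (weight S a.1 : ℂ) * homForm a.1 _ (x (a, i)) (y (a, i)) = ∑ b : S, ∑ c : S,
        (mult c.1 (conj b.1 ⊗ rep a.1) : ℂ) * (homForm a.1 _ (x (a, i)) (y (a, i)) / dim a.1) := by
      intro i
      rw [weight]
      push_cast
      simp only [Finset.sum_mul]
      refine Finset.sum_congr rfl fun b _ => Finset.sum_congr rfl fun c _ => ?_
      ring
    simp only [h4]
    exact (Finset.sum_congr rfl fun _ _ => Finset.sum_comm).trans Finset.sum_comm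
  have h3 : ∑ a : S, ∑ b : S, ∑ c : S, ∑ i ∈ linkIndex S, (mult c.1 (conj b.1 ⊗ rep a.1) : ℂ) *
        (homForm b.1 _ (x (b, i)) (y (b, i)) / dim b.1) = vertexInner S x y := by
    rw [vertexInner_eq_sum, Finset.sum_comm]
    refine Finset.sum_congr rfl fun b _ => ?_
    have h4 : ∀ i, (weight S b.1 : ℂ) * homForm b.1 _ (x (b, i)) (y (b, i)) = ∑ a : S, ∑ c : S,
        (mult c.1 (conj b.1 ⊗ rep a.1) : ℂ) * (homForm b.1 _ (x (b, i)) (y (b, i)) / dim b.1) := by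
      intro i
      have h5 : (weight S b.1 : ℂ) * dim b.1 =
          ∑ a : S, ∑ c : S, (mult c.1 (conj b.1 ⊗ rep a.1) : ℂ) := by
        have h6 := sum_mult_source hsymm b.1
        rw [← Finset.sum_coe_sort] at h6
        simp only [← Finset.sum_coe_sort S] at h6
        rw [← Complex.ofReal_mul, weight_mul_dim, ← h6]
        push_cast
        rfl
      simp only [← Finset.sum_mul]
      rw [← h5, mul_assoc, mul_div_cancel₀ _ (dim_ne_zero b.1)]
    simp only [h4]
    exact (Finset.sum_congr rfl fun _ _ => Finset.sum_comm).trans Finset.sum_comm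
  rw [h2, h3, two_mul]

end Forms

/-! ### The kernel and the gap of the Laplacian -/

section ConstantVector

variable {C : Type u} [Category.{v} C] [CStarCategory C] [MonoidalCategory C]
  [CStarTensorCategory C] [IsRigid C]

/-- The constant function on the vertices: the identities of the `a ∈ S` in the components of the
unit object. -/
def constVec (S : Finset (Irr C)) : VertexSpace S := by
  classical exact fun p =>
    if h : p.2 = unitIrr C then unitVec p.1.1 ≫ eqToHom (by rw [h]) else 0

variable (S : Finset (Irr C))

theorem constVec_unitIrr (a : S) : constVec S (a, unitIrr C) = unitVec a.1 := by
  classical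
  refine (dif_pos rfl).trans ?_
  simp

theorem constVec_of_ne (a : S) {i : Irr C} (hi : i ≠ unitIrr C) : constVec S (a, i) = 0 := by
  classical
  exact dif_neg hi

theorem edgeDiff_unitVec (a b : Irr C) : edgeDiff (unitVec a) (unitVec b) = 0 := by
  rw [edgeDiff, tilde_unitVec, sub_eq_zero, unitVec]
  monoidal

theorem sourceMap_sub_targetMap_constVec : (sourceMap S - targetMap S) (constVec S) = 0 := by
  funext ⟨a, b, c, i⟩
  rw [sourceMap_sub_targetMap]
  have h : edgeDiff (constVec S (a, i)) (constVec S (b, i)) = 0 := by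
    by_cases hi : i = unitIrr C
    · subst hi
      rw [constVec_unitIrr, constVec_unitIrr, edgeDiff_unitVec]
    · rw [constVec_of_ne S a hi, constVec_of_ne S b hi]
      simp [edgeDiff]
  simp only [h, Limits.comp_zero, TensorProduct.zero_tmul, Finset.sum_const_zero]
  rfl

theorem unitVec_ne_zero (a : Irr C) : unitVec a ≠ 0 := fun h =>
  dim_ne_zero a (by rw [← homForm_unitVec, h, map_zero])

theorem vertexInner_constVec (x : VertexSpace S) : vertexInner S (constVec S) x =
    ∑ a : S, (weight S a.1 : ℂ) * homForm a.1 _ (unitVec a.1) (x (a, unitIrr C)) := by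
  rw [vertexInner_eq_sum]
  refine Finset.sum_congr rfl fun a _ => ?_
  rw [Finset.sum_eq_single (unitIrr C), constVec_unitIrr]
  · intro i _ hi
    rw [constVec_of_ne S a hi, map_zero, LinearMap.zero_apply, mul_zero]
  · exact fun h => absurd (mem_linkIndex a.2 (unitVec_ne_zero a.1)) h

theorem vertexInner_constVec_self :
    vertexInner S (constVec S) (constVec S) = totalWeight S := by
  rw [vertexInner_constVec, totalWeight, ← Finset.sum_coe_sort S]
  push_cast
  refine Finset.sum_congr rfl fun a _ => ?_
  rw [constVec_unitIrr, homForm_unitVec]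

variable {S} {Δ : Module.End ℂ (VertexSpace S)} (hΔ : IsLaplacian S Δ)
include hΔ

theorem IsLaplacian.apply_constVec : Δ (constVec S) = 0 := by
  obtain ⟨D, -, rfl⟩ := hΔ
  rw [LinearMap.smul_apply, LinearMap.comp_apply, sourceMap_sub_targetMap_constVec, map_zero,
    smul_zero]

theorem IsLaplacian.vertexInner_apply (hsymm : IsSymmetricSet S)
    (hweight : ∀ a ∈ S, 0 < weight S a) (x y : VertexSpace S) : vertexInner S (Δ x) y =
      vertexInner S x y - (crossForm S x y + starRingEnd ℂ (crossForm S y x)) / 2 := by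
  obtain ⟨D, hD, rfl⟩ := hΔ
  rw [LinearMap.smul_apply, LinearMap.comp_apply]
  have h := (vertexCore hweight).smul_left (D ((sourceMap S - targetMap S) x)) y (1 / 2)
  refine h.trans ?_
  change starRingEnd ℂ (1 / 2) * vertexInner S (D _) y = _
  rw [hD, edgeInner_eq hsymm, map_div₀, map_one, map_ofNat]
  ring

/-- The spectral gap of the Laplacian, in terms of its form. The constant vector spans the kernel.
-/
theorem IsLaplacian.gap (hsymm : IsSymmetricSet S) (hweight : ∀ a ∈ S, 0 < weight S a)
    (hne : S.Nonempty) (hsimple : Module.finrank ℂ (Module.End.eigenspace Δ 0) = 1) {lam : ℝ}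
    (hlam : ∀ μ : ℝ, μ ≠ 0 → Module.End.HasEigenvalue Δ (μ : ℂ) → lam ≤ μ) (x : VertexSpace S) :
    lam * ((vertexInner S x x).re - ‖vertexInner S (constVec S) x‖ ^ 2 / totalWeight S) ≤
      (vertexInner S x x).re - (crossForm S x x).re := by
  have hinner := hΔ.vertexInner_apply hsymm hweight
  have hconj : ∀ x y, starRingEnd ℂ (vertexInner S y x) = vertexInner S x y :=
    (vertexCore hweight).conj_inner_symm
  have hN := totalWeight_pos hweight hne
  have h := spectral_gap (vertexCore hweight) Δ (fun x y => ?_) (e := constVec S) (fun h0 => ?_)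
    hΔ.apply_constVec hsimple hlam x
  · change lam * ((vertexInner S x x).re - ‖vertexInner S (constVec S) x‖ ^ 2 /
      (vertexInner S (constVec S) (constVec S)).re) ≤ (vertexInner S x (Δ x)).re at h
    rw [vertexInner_constVec_self, Complex.ofReal_re, ← hconj x (Δ x), Complex.conj_re, hinner] at h
    refine h.trans (le_of_eq ?_)
    rw [Complex.add_conj]
    simp
  · change vertexInner S (Δ x) y = vertexInner S x (Δ y)
    rw [← hconj x (Δ y), hinner, hinner]
    simp only [map_sub, map_div₀, map_add, hconj, Complex.conj_conj, map_ofNat]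
    rw [add_comm]
  · have h1 := vertexInner_constVec_self S
    rw [vertexInner_constVec, h0] at h1
    simp only [Pi.zero_apply, map_zero, mul_zero, Finset.sum_const_zero] at h1
    exact hN.ne (by exact_mod_cast h1)

end ConstantVector

/-! ### Test vectors from a Hilbert module -/

section TestVectors

variable {H : Type w} [NormedAddCommGroup H] [InnerProductSpace ℂ H]

/-- Parseval's identity for finitely many vectors, by an orthonormal basis of their span. -/
theorem exists_parseval {s : Set H} (hs : s.Finite) : ∃ (n : ℕ) (e : Fin n → H),
    ∀ x ∈ s, ∀ y ∈ s, ∑ r, inner ℂ x (e r) * inner ℂ (e r) y = inner ℂ x y := by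
  have := FiniteDimensional.span_of_finite ℂ hs
  let b := stdOrthonormalBasis ℂ (Submodule.span ℂ s)
  refine ⟨_, fun r => b r, fun x hx y hy => ?_⟩
  exact b.sum_inner_mul_inner ⟨x, Submodule.subset_span hx⟩ ⟨y, Submodule.subset_span hy⟩

variable {C : Type u} [Category.{v} C] [CStarCategory C] [MonoidalCategory C]
  [CStarTensorCategory C] [IsRigid C] (M : HilbertModule C H)

/-- The vertex vector that a vector `ξ` of a Hilbert module defines by means of a coefficient
vector `e`: its component at `(a, i)` is `√d(i)` times the Riesz representative of
`V ↦ ⟨toUnitOp V ξ, e⟩`, written out in the chosen orthonormal basis. -/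
def testVec (S : Finset (Irr C)) (ξ e : H) : VertexSpace S := fun p =>
  (Real.sqrt (dim p.2) : ℂ) • ∑ k, inner ℂ e (toUnitOp M p.2 p.1.1 ((onb p.1.1 _).2 k) ξ) •
    (onb p.1.1 _).2 k

/-- `link W` as a linear map; it is conjugate-linear twice. -/
def linkₗ {i a b c : Irr C} (W : rep c ⟶ conj b ⊗ rep a) :
    (rep b ⟶ rep i ⊗ rep b) →ₗ[ℂ] (rep a ⟶ rep i ⊗ rep a) where
  toFun := link W
  map_add' V V' := by simp [link, CStarCategory.dag_add]
  map_smul' z V := by simp [link, CStarCategory.dag_smul]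

theorem sqrt_dim_mul_self (i : Irr C) : (Real.sqrt (dim i) : ℂ) * Real.sqrt (dim i) = dim i := by
  exact_mod_cast Real.mul_self_sqrt (dim_pos i).le

variable {M} {S : Finset (Irr C)} {ξ : H} {n : ℕ} {e : Fin n → H} {s : Set H}

/-- The squared norms of the test vectors add up to the total weight times the squared norm of the
component of `ξ` in the corner, by `sum_inner_toUnitOp`. The vectors `e r` act as an orthonormal
basis on a set `s` that contains all components of `ξ`. -/
theorem sum_vertexInner_testVec
    (he : ∀ x ∈ s, ∀ y ∈ s, ∑ r, inner ℂ x (e r) * inner ℂ (e r) y = inner ℂ x y)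
    (hs : ∀ (a i : Irr C), a ∈ S → i ∈ linkIndex S → ∀ k,
      toUnitOp M i a ((onb a (rep i ⊗ rep a)).2 k) ξ ∈ s) :
    ∑ r, vertexInner S (testVec M S ξ (e r)) (testVec M S ξ (e r)) =
      totalWeight S * inner ℂ ξ (M.act (tubeProj (unitIrr C)) ξ) := by
  have h1 : ∀ (a : S) (i : Irr C), i ∈ linkIndex S →
      ∑ r, homForm a.1 _ (testVec M S ξ (e r) (a, i)) (testVec M S ξ (e r) (a, i)) = dim i *
      ∑ k, inner ℂ (toUnitOp M i a.1 ((onb a.1 (rep i ⊗ rep a.1)).2 k) ξ)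
        (toUnitOp M i a.1 ((onb a.1 (rep i ⊗ rep a.1)).2 k) ξ) := by
    intro a i hi
    have h2 : ∀ r, homForm a.1 _ (testVec M S ξ (e r) (a, i)) (testVec M S ξ (e r) (a, i)) =
        dim i * ∑ k, inner ℂ (toUnitOp M i a.1 ((onb a.1 (rep i ⊗ rep a.1)).2 k) ξ) (e r) *
          inner ℂ (e r) (toUnitOp M i a.1 ((onb a.1 (rep i ⊗ rep a.1)).2 k) ξ) := by
      intro r
      simp only [testVec, map_smul, LinearMap.map_smulₛₗ, LinearMap.smul_apply, map_sum,
        LinearMap.sum_apply, (isONB_onb a.1 _).1, smul_eq_mul, Complex.conj_ofReal, mul_ite,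
        mul_one, mul_zero, Finset.sum_ite_eq', Finset.mem_univ, if_true,
        inner_conj_symm]
      rw [← sqrt_dim_mul_self, Finset.mul_sum, Finset.mul_sum]
      exact Finset.sum_congr rfl fun k _ => by ring
    simp only [h2, ← Finset.mul_sum]
    rw [Finset.sum_comm]
    congr 1
    exact Finset.sum_congr rfl fun k _ => he _ (hs a.1 i a.2 hi k) _ (hs a.1 i a.2 hi k)
  simp only [vertexInner_eq_sum]
  rw [Finset.sum_comm, totalWeight, ← Finset.sum_coe_sort S]
  push_cast
  rw [Finset.sum_mul]
  refine Finset.sum_congr rfl fun a _ => ?_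
  rw [Finset.sum_comm, mul_assoc, ← sum_inner_toUnitOp M a.1 (linkIndex S)
    (fun i V hV => mem_linkIndex a.2 hV), Finset.mul_sum]
  refine Finset.sum_congr rfl fun i hi => ?_
  rw [← Finset.mul_sum, h1 a i hi]

/-- The inner products with the constant vector are the coefficients of `N A ξ`. -/
theorem vertexInner_constVec_testVec (hsymm : IsSymmetricSet S) (hne : totalWeight S ≠ 0) (f : H) :
    vertexInner S (constVec S) (testVec M S ξ f) =
      inner ℂ f ((totalWeight S : ℂ) • averaging M S ξ) := by
  have h0 : (totalWeight S : ℂ) ≠ 0 := by exact_mod_cast hne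
  have h1 : (totalWeight S : ℂ) • averaging M S ξ =
      ∑ a ∈ S, (weight S a : ℂ) • M.act (tubeOne (bar a)) ξ := by
    rw [averaging, smul_apply, smul_smul, mul_inv_cancel₀ h0, one_smul, sum_apply, ← sum_bar hsymm]
    simp only [smul_apply, weight_bar hsymm]
  rw [h1, vertexInner_constVec, inner_sum, ← Finset.sum_coe_sort S]
  refine Finset.sum_congr rfl fun a _ => ?_
  rw [inner_smul_right, ← toUnitOp_unitVec, toUnitOp_eq_sum, inner_sum]
  simp only [testVec, dim_unitIrr, Real.sqrt_one, Complex.ofReal_one, one_smul, map_sum, map_smul,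
    smul_eq_mul, inner_smul_right]
  congr 1
  exact Finset.sum_congr rfl fun k _ => mul_comm _ _

/-- For each edge, `sum_inner_toUnitOp_link` turns the sum over the test vectors into the action of
a single `1_c`. -/
theorem sum_crossTerm_testVec
    (he : ∀ x ∈ s, ∀ y ∈ s, ∑ r, inner ℂ x (e r) * inner ℂ (e r) y = inner ℂ x y)
    (hs : ∀ (a i : Irr C), a ∈ S → i ∈ linkIndex S → ∀ k,
      toUnitOp M i a ((onb a (rep i ⊗ rep a)).2 k) ξ ∈ s)
    (a b : S) (c : Irr C) :
    ∑ r, ∑ i ∈ linkIndex S, crossTerm c (testVec M S ξ (e r) (b, i)) (testVec M S ξ (e r) (a, i)) =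
      mult c (conj b.1 ⊗ rep a.1) * ((dim c : ℂ)⁻¹ * inner ℂ ξ (M.act (tubeOne (bar c)) ξ)) := by
  have h1 : ∀ i ∈ linkIndex S, ∀ W : rep c ⟶ conj b.1 ⊗ rep a.1,
      ∑ r, homForm a.1 _ (link W (testVec M S ξ (e r) (b, i))) (testVec M S ξ (e r) (a, i)) =
      dim i * ∑ k, inner ℂ (toUnitOp M i b.1 ((onb b.1 (rep i ⊗ rep b.1)).2 k) ξ)
        (toUnitOp M i a.1 (link W ((onb b.1 (rep i ⊗ rep b.1)).2 k)) ξ) := by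
    intro i hi W
    have h2 : ∀ r, homForm a.1 _ (link W (testVec M S ξ (e r) (b, i)))
        (testVec M S ξ (e r) (a, i)) = dim i * ∑ k, ∑ l,
          homForm a.1 _ (link W ((onb b.1 (rep i ⊗ rep b.1)).2 k))
            ((onb a.1 (rep i ⊗ rep a.1)).2 l) *
          (inner ℂ (toUnitOp M i b.1 ((onb b.1 (rep i ⊗ rep b.1)).2 k) ξ) (e r) *
            inner ℂ (e r) (toUnitOp M i a.1 ((onb a.1 (rep i ⊗ rep a.1)).2 l) ξ)) := by
      intro r
      change homForm a.1 _ (linkₗ W _) _ = _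
      simp only [testVec, map_smul, LinearMap.map_smulₛₗ, LinearMap.smul_apply, map_sum,
        LinearMap.sum_apply, smul_eq_mul, Complex.conj_ofReal, inner_conj_symm]
      rw [← sqrt_dim_mul_self]
      simp only [Finset.mul_sum]
      rw [Finset.sum_comm]
      refine Finset.sum_congr rfl fun k _ => Finset.sum_congr rfl fun l _ => ?_
      change _ * (_ * (_ * (_ * homForm a.1 _ (link W _) _))) = _
      ring
    simp only [h2, ← Finset.mul_sum]
    congr 1
    rw [Finset.sum_comm]
    refine Finset.sum_congr rfl fun k _ => ?_
    rw [Finset.sum_comm, toUnitOp_eq_sum M i a.1 (link W _), inner_sum]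
    refine Finset.sum_congr rfl fun l _ => ?_
    rw [← Finset.mul_sum, he _ (hs b.1 i b.2 hi k) _ (hs a.1 i a.2 hi l), inner_smul_right]
  rw [Finset.sum_comm]
  calc _ = ∑ k, ∑ i ∈ linkIndex S, (dim i : ℂ) * ∑ l,
        inner ℂ (toUnitOp M i b.1 ((onb b.1 (rep i ⊗ rep b.1)).2 l) ξ)
          (toUnitOp M i a.1 (link ((onb c (conj b.1 ⊗ rep a.1)).2 k)
            ((onb b.1 (rep i ⊗ rep b.1)).2 l)) ξ) := by
        rw [Finset.sum_comm (s := Finset.univ)]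
        refine Finset.sum_congr rfl fun i hi => ?_
        simp only [crossTerm]
        rw [Finset.sum_comm]
        exact Finset.sum_congr rfl fun k _ => h1 i hi _
    _ = _ := by
        have h2 : ∀ k, ∑ i ∈ linkIndex S, (dim i : ℂ) * ∑ l,
            inner ℂ (toUnitOp M i b.1 ((onb b.1 (rep i ⊗ rep b.1)).2 l) ξ)
              (toUnitOp M i a.1 (link ((onb c (conj b.1 ⊗ rep a.1)).2 k)
                ((onb b.1 (rep i ⊗ rep b.1)).2 l)) ξ) =
            (dim c : ℂ)⁻¹ * inner ℂ ξ (M.act (tubeOne (bar c)) ξ) := fun k =>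
          sum_inner_toUnitOp_link M _ (linkIndex S) (fun i V hV => mem_linkIndex b.2 hV)
            (by rw [(isONB_onb c _).1, if_pos rfl]) ξ ξ
        simp only [h2, Finset.sum_const, Finset.card_univ, Fintype.card_fin, onb_card_eq_mult,
          nsmul_eq_mul]

/-- The cross terms of the test vectors add up to the form of the averaging operator. -/
theorem sum_crossForm_testVec
    (he : ∀ x ∈ s, ∀ y ∈ s, ∑ r, inner ℂ x (e r) * inner ℂ (e r) y = inner ℂ x y)
    (hs : ∀ (a i : Irr C), a ∈ S → i ∈ linkIndex S → ∀ k,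
      toUnitOp M i a ((onb a (rep i ⊗ rep a)).2 k) ξ ∈ s)
    (hsymm : IsSymmetricSet S) (hne : totalWeight S ≠ 0) :
    ∑ r, crossForm S (testVec M S ξ (e r)) (testVec M S ξ (e r)) =
      totalWeight S * inner ℂ ξ (averaging M S ξ) := by
  have h0 : (totalWeight S : ℂ) ≠ 0 := by exact_mod_cast hne
  have h1 : ∑ r, crossForm S (testVec M S ξ (e r)) (testVec M S ξ (e r)) =
      ∑ a : S, ∑ b : S, ∑ c : S, (mult c.1 (conj b.1 ⊗ rep a.1) : ℂ) *
        ((dim c.1 : ℂ)⁻¹ * inner ℂ ξ (M.act (tubeOne (bar c.1)) ξ)) := by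
    simp only [crossForm]
    rw [Finset.sum_comm]
    refine Finset.sum_congr rfl fun a _ => ?_
    rw [Finset.sum_comm]
    refine Finset.sum_congr rfl fun b _ => ?_
    rw [Finset.sum_comm]
    exact Finset.sum_congr rfl fun c _ => sum_crossTerm_testVec he hs a b c.1
  have h2 : ∀ c : S, ∑ a : S, ∑ b : S, (mult c.1 (conj b.1 ⊗ rep a.1) : ℂ) =
      weight S c.1 * dim c.1 := by
    intro c
    have h6 := sum_mult_target hsymm c.1
    rw [← Finset.sum_coe_sort] at h6
    simp only [← Finset.sum_coe_sort S] at h6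
    rw [← Complex.ofReal_mul, weight_mul_dim, ← h6]
    push_cast
    rfl
  calc _ = ∑ c : S, (∑ a : S, ∑ b : S, (mult c.1 (conj b.1 ⊗ rep a.1) : ℂ)) *
        ((dim c.1 : ℂ)⁻¹ * inner ℂ ξ (M.act (tubeOne (bar c.1)) ξ)) := by
        rw [h1]
        simp only [Finset.sum_mul]
        exact (Finset.sum_congr rfl fun _ _ => Finset.sum_comm).trans Finset.sum_comm
    _ = ∑ c : S, (weight S c.1 : ℂ) * inner ℂ ξ (M.act (tubeOne (bar c.1)) ξ) := by
        refine Finset.sum_congr rfl fun c _ => ?_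
        rw [h2, mul_assoc, mul_inv_cancel_left₀ (dim_ne_zero c.1)]
    _ = ∑ c ∈ S, (weight S c : ℂ) * inner ℂ ξ (M.act (tubeOne (bar c)) ξ) :=
        Finset.sum_coe_sort S fun c => (weight S c : ℂ) * inner ℂ ξ (M.act (tubeOne (bar c)) ξ)
    _ = ∑ c ∈ S, (weight S c : ℂ) * inner ℂ ξ (M.act (tubeOne c) ξ) := by
        rw [← sum_bar hsymm]
        simp only [bar_bar, weight_bar hsymm]
    _ = _ := by
        simp only [averaging, smul_apply, sum_apply, inner_smul_right, inner_sum]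
        rw [mul_inv_cancel_left₀ h0]

/-- The spectral gap of the average on the corner of the unit object: the gap of the Laplacian,
summed over the test vectors of `ξ` and divided by the total weight. -/
theorem IsLaplacian.averaging_gap {Δ : Module.End ℂ (VertexSpace S)} (hΔ : IsLaplacian S Δ)
    (hsymm : IsSymmetricSet S) (hweight : ∀ a ∈ S, 0 < weight S a)
    (hne : S.Nonempty) (hsimple : Module.finrank ℂ (Module.End.eigenspace Δ 0) = 1) {lam : ℝ}
    (hlam : ∀ μ : ℝ, μ ≠ 0 → Module.End.HasEigenvalue Δ (μ : ℂ) → lam ≤ μ)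
    (hξ : M.act (tubeProj (unitIrr C)) ξ = ξ) :
    lam * (‖ξ‖ ^ 2 - ‖averaging M S ξ‖ ^ 2) ≤ ‖ξ‖ ^ 2 - (inner ℂ ξ (averaging M S ξ)).re := by
  have hN := totalWeight_pos hweight hne
  set η := (totalWeight S : ℂ) • averaging M S ξ with hη
  let F : (Σ q : S × linkIndex S, Fin (onb q.1.1 (rep q.2.1 ⊗ rep q.1.1)).1) → H :=
    fun q => toUnitOp M q.1.2.1 q.1.1.1 ((onb q.1.1.1 (rep q.1.2.1 ⊗ rep q.1.1.1)).2 q.2) ξ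
  obtain ⟨n, e, he⟩ := exists_parseval ((Set.finite_range F).insert η)
  have hs : ∀ (a i : Irr C), a ∈ S → i ∈ linkIndex S → ∀ k,
      toUnitOp M i a ((onb a (rep i ⊗ rep a)).2 k) ξ ∈ insert η (Set.range F) :=
    fun a i ha hi k => Set.mem_insert_of_mem _ ⟨⟨(⟨a, ha⟩, ⟨i, hi⟩), k⟩, rfl⟩
  have h1 := congrArg Complex.re (sum_vertexInner_testVec he hs)
  have h2 := congrArg Complex.re (sum_crossForm_testVec he hs hsymm hN.ne')
  have h3 : ∑ r, ‖vertexInner S (constVec S) (testVec M S ξ (e r))‖ ^ 2 =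
      totalWeight S ^ 2 * ‖averaging M S ξ‖ ^ 2 := by
    have h4 := he η (Set.mem_insert _ _) η (Set.mem_insert _ _)
    have h5 : ∀ r, inner ℂ η (e r) * inner ℂ (e r) η = ((‖inner ℂ (e r) η‖ ^ 2 : ℝ) : ℂ) := by
      intro r
      rw [← inner_conj_symm, mul_comm, Complex.mul_conj, Complex.normSq_eq_norm_sq]
    simp only [h5, inner_self_eq_ofReal] at h4
    simp only [vertexInner_constVec_testVec hsymm hN.ne', ← hη]
    have h6 : ∑ r, ‖(inner ℂ (e r) η : ℂ)‖ ^ 2 = ‖η‖ ^ 2 := by exact_mod_cast h4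
    rw [h6, hη, norm_smul, Complex.norm_real, Real.norm_of_nonneg hN.le, mul_pow]
  rw [hξ, inner_self_eq_ofReal, ← Complex.ofReal_mul, Complex.ofReal_re, Complex.re_sum] at h1
  rw [Complex.re_ofReal_mul, Complex.re_sum] at h2
  have h4 := Finset.sum_le_sum fun r (_ : r ∈ Finset.univ) =>
    hΔ.gap hsymm hweight hne hsimple hlam (testVec M S ξ (e r))
  rw [← Finset.mul_sum, Finset.sum_sub_distrib, Finset.sum_sub_distrib, ← Finset.sum_div, h1, h2,
    h3] at h4
  refine le_of_mul_le_mul_left ?_ hN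
  calc totalWeight S * (lam * (‖ξ‖ ^ 2 - ‖averaging M S ξ‖ ^ 2)) = lam * (totalWeight S * ‖ξ‖ ^ 2 -
        totalWeight S ^ 2 * ‖averaging M S ξ‖ ^ 2 / totalWeight S) := by
        field_simp
    _ ≤ _ := h4
    _ = _ := by ring

end TestVectors

end RigidCStar

end

theorem theorem3p1 {C : Type u} [Category.{v} C] [CStarCategory C] [MonoidalCategory C]
    [CStarTensorCategory C] [IsRigid C]
    (S : Finset (Irr C)) (hunit : unitIrr C ∉ S) (hsymm : IsSymmetricSet S) (hgen : Generates S)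
    (hweight : ∀ a ∈ S, 0 < weight S a)
    (Δ : Module.End ℂ (VertexSpace S)) (hΔ : IsLaplacian S Δ)
    (hsimple : Module.finrank ℂ (Module.End.eigenspace Δ 0) = 1)
    (lam : ℝ) (hlam : IsLeast {μ : ℝ | μ ≠ 0 ∧ Module.End.HasEigenvalue Δ (μ : ℂ)} lam)
    (hgap : 1 / 2 < lam) :
    HasPropertyT.{w} C ∧ (lam ≤ 1 → IsKazhdanPair.{w} S (2 - lam⁻¹)) ∧
      IsCornerKazhdanPair.{w} S (2 - lam⁻¹) := by
  have hlam0 : 0 < lam := by linarith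
  have hne : S.Nonempty := by
    rw [Finset.nonempty_iff_ne_empty]
    rintro rfl
    -- for empty `S` the vertex space is zero
    have hz : Module.finrank ℂ (Module.End.eigenspace Δ 0) = 0 :=
      Module.finrank_zero_of_subsingleton
    exact one_ne_zero (hsimple.symm.trans hz)
  have hδ : 0 < 2 - lam⁻¹ := by
    have : lam⁻¹ < 2 := by
      rw [inv_lt_comm₀ hlam0 two_pos]
      linarith
    linarith
  have hcorner : IsCornerKazhdanPair.{w} S (2 - lam⁻¹) := by
    refine ⟨hδ, fun H _ _ _ M ⟨ξ, hpξ, hξ⟩ => ?_⟩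
    exact exists_invariant_of_gap M hweight hne hsymm hgen hgap (fun η hη =>
      hΔ.averaging_gap hsymm hweight hne hsimple (fun μ h0 h1 => hlam.2 ⟨h0, h1⟩) hη) hpξ hξ
  refine ⟨⟨S, min 1 (2 - lam⁻¹), hcorner.isKazhdanPair (lt_min one_pos hδ) (min_le_left _ _)
    (min_le_right _ _)⟩, fun h => hcorner.isKazhdanPair hδ ?_ le_rfl, hcorner⟩
  have : 1 ≤ lam⁻¹ := (one_le_inv₀ hlam0).mpr h
  linarith
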